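/- Let $g$ be a smooth Riemannian metric of positive Gaussian curvature on the $2$-sphere $\Sigma=\mathbb S^2$, let $H_o>0$ be a constant, and let $r_o>0$ be the area radius of $g$, i.e. $|\Sigma|_g=4\pi r_o^2$. Let $\{g(t)\}_{0\le t\le 1}$ be a smooth path of metrics on $\Sigma$ such that: (a) if $g$ is round (isometric to a round sphere of some radius), then $g(t)=g$ for all $t$; (b) if $g$ is not round, then every $g(t)$ has positive Gaussian curvature, $g(0)=g$, $g(1)$ is round, and $\operatorname{tr}_{g(t)}g'(t)=0$ for all $t\in[0,1]$. Put $$\alpha=\tfrac14\max_{t\in[0,1]}\max_\Sigma|g'(t)|^2_{g(t)},\qquad \beta=r_o^2\min_{t\in[0,1]}\min_\Sigma K(g(t)),$$ where $K$ is the Gaussian curvature. Suppose $$\tfrac14H_o^2r_o^2<\frac{\beta}{1+\alpha}.$$ Let $m\in(-\infty,\tfrac12r_o)$ satisfy $$\tfrac14H_o^2r_o^2<\frac{\beta}{1+\alpha}\Big(1-\frac{2m}{r_o}\Big),\qquad\text{and put}\qquad k=\frac{H_or_o}{2}\Big(1-\frac{2m}{r_o}\Big)^{-1/2}.$$ Let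 $\mathfrak m_H(\Sigma)=\sqrt{\tfrac{|\Sigma|_g}{16\pi}}\Big(1-\tfrac1{16\pi}\int_\Sigma H_o^2\,d\sigma\Big)$ be the Hawking mass and define $$m_*=\begin{cases}\displaystyle\tfrac12r_o\left[\frac{\tfrac14H_o^2r_o^2\,\alpha}{\big(\beta-\tfrac14H_o^2r_o^2\,\alpha\big)-k^2}\right]^{1/2}(1-k^2)+\mathfrak m_H(\Sigma),& m<0,\\[3ex]\displaystyle\tfrac12r_o\left[\frac{\alpha k^2}{\beta-(1+\alpha)k^2}\right]^{1/2}(1-k^2)+\mathfrak m_H(\Sigma),& m\ge0.\end{cases}$$ Then for every $m_e>m_*$ there is a smooth, asymptotically flat Riemannian $3$-manifold $(M,\gamma)$ with boundary $\partial M$ and non-negative scalar curvature such that (i) $\partial M$ is isometric to $(\Sigma,g)$ and has constant mean curvature $H_o$ (with respect to the unit normal pointing into $M$, with the sign for which round spheres in $\mathbb R^3$ have mean curvature $2/r$ with respect to the outer normal); (ii) outside a compact set, $M$ is isometric to the complement of a compact set in the spatial Schwarzschild manifold of mass $m_e$, i.e. to $\big(\{r>R\}\times\mathbb S^2,\ (1-\tfrac{2m_e}{r})^{-1}dr^2+r^2g_*\big)$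 for some $R>0$ with $R>2m_e$, where $g_*$ is the standard metric of $\mathbb S^2$; (iii) $M$ is foliated by $2$-spheres of positive mean curvature (with respect to the unit normal pointing towards infinity), which eventually coincide with the rotationally symmetric spheres $\{r\}\times\mathbb S^2$ of the Schwarzschild manifold in (ii). -/

import Mathlib

open scoped Manifold ContDiff Bundle
open Set MeasureTheory Module

noncomputable section

namespace CMCExtension

/-! ### Riemannian metrics and curvature in coordinates -/

section Geometry

variable {E : Type*} [NormedAddCommGroup E] [NormedSpace ℝ E]
  {H : Type*} [TopologicalSpace H] {I : ModelWithCorners ℝ E H}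
  {M : Type*} [TopologicalSpace M] [ChartedSpace H M] [IsManifold I ∞ M]
  {κ : Type*} [Fintype κ] [DecidableEq κ]

/-- Smooth Riemannian metrics on the manifold (possibly with boundary) `M`. -/
abbrev RiemMetric (I : ModelWithCorners ℝ E H) (M : Type*) [TopologicalSpace M]
    [ChartedSpace H M] [IsManifold I ∞ M] :=
  Bundle.ContMDiffRiemannianMetric I ∞ E (fun x : M => TangentSpace I x)

/-- The matrix `g_ij(y)` of the metric in the preferred chart at `p`, with respect to the
coordinate vector fields of the basis `b` of the model vector space. -/
def coordMetric (g : RiemMetric I M) (b : Basis κ ℝ E) (p : M) (y : E) : Matrix κ κ ℝ :=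
  Matrix.of fun i j =>
    g.inner ((extChartAt I p).symm y)
      (mfderivWithin 𝓘(ℝ, E) I (extChartAt I p).symm (range I) y (b i))
      (mfderivWithin 𝓘(ℝ, E) I (extChartAt I p).symm (range I) y (b j))

/-- The partial derivative `∂_i` of a function of the coordinates (one-sided at the boundary). -/
def coordDeriv (I : ModelWithCorners ℝ E H) (b : Basis κ ℝ E) (i : κ) (f : E → ℝ) (y : E) : ℝ :=
  fderivWithin ℝ f (range I) y (b i)

/-- The Christoffel symbols `Γ^k_ij(y)` in the preferred chart at `p`. -/
def christoffel (g : RiemMetric I M) (b : Basis κ ℝ E) (p : M) (k i j : κ) (y : E) : ℝ :=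
  (1 / 2) * ∑ l, (coordMetric g b p y)⁻¹ k l *
    (coordDeriv I b i (fun z => coordMetric g b p z j l) y
      + coordDeriv I b j (fun z => coordMetric g b p z i l) y
      - coordDeriv I b l (fun z => coordMetric g b p z i j) y)

/-- The components `Ric_ij(y)` of the Ricci tensor in the preferred chart at `p`. -/
def ricci (g : RiemMetric I M) (b : Basis κ ℝ E) (p : M) (i j : κ) (y : E) : ℝ :=
  ∑ k, (coordDeriv I b k (christoffel g b p k i j) y
      - coordDeriv I b j (christoffel g b p k i k) y
      + ∑ l, (christoffel g b p k k l y * christoffel g b p l i j y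
          - christoffel g b p k j l y * christoffel g b p l i k y))

/-- The scalar curvature at `p` (it does not depend on the basis `b`). -/
def scalarCurvature (g : RiemMetric I M) (b : Basis κ ℝ E) (p : M) : ℝ :=
  ∑ i, ∑ j, (coordMetric g b p (extChartAt I p p))⁻¹ i j * ricci g b p i j (extChartAt I p p)

variable {E' : Type*} [NormedAddCommGroup E'] [NormedSpace ℝ E']
  {H' : Type*} [TopologicalSpace H'] {J : ModelWithCorners ℝ E' H'}
  {N : Type*} [TopologicalSpace N] [ChartedSpace H' N]
  {κ' : Type*} [Fintype κ'] [DecidableEq κ']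

/-- The pull-back `F^*g` of a metric, at `x`, evaluated at `v, w`. -/
def pullback (J : ModelWithCorners ℝ E' H') (g : RiemMetric I M) (F : N → M) (x : N)
    (v w : TangentSpace J x) : ℝ :=
  g.inner (F x) (mfderiv J I F x v) (mfderiv J I F x w)

/-- `ν` is a unit vector normal to the immersion `F` at `x`. -/
def IsUnitNormal (J : ModelWithCorners ℝ E' H') (g : RiemMetric I M) (F : N → M) (x : N)
    (ν : TangentSpace I (F x)) : Prop :=
  g.inner (F x) ν ν = 1 ∧ ∀ v : TangentSpace J x, g.inner (F x) ν (mfderiv J I F x v) = 0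

/-- The immersion `F` in the preferred charts at `x` and at `F x`. -/
def coordMap (J : ModelWithCorners ℝ E' H') (I : ModelWithCorners ℝ E H) (F : N → M) (x : N)
    (z : E') : E :=
  extChartAt I (F x) (F ((extChartAt J x).symm z))

/-- The covariant second derivative `∇_{∂_i F} ∂_j F` at `x`, that is
`∂_i ∂_j F + Γ(∂_i F, ∂_j F)` in the preferred charts at `x` and at `F x`. -/
def covSecondDeriv (J : ModelWithCorners ℝ E' H') (g : RiemMetric I M) (b : Basis κ ℝ E)
    (c : Basis κ' ℝ E') (F : N → M) (x : N) (i j : κ') : TangentSpace I (F x) :=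
  let y := extChartAt J x x
  let dF : κ' → E' → E := fun a z => fderivWithin ℝ (coordMap J I F x) (range J) z (c a)
  (fderivWithin ℝ (dF j) (range J) y (c i)
    + ∑ k, (∑ a, ∑ d, christoffel g b (F x) k a d (extChartAt I (F x) (F x))
        * b.repr (dF i y) a * b.repr (dF j y) d) • b k : E)

/-- The mean curvature of the immersed hypersurface `F` at `x` with respect to the unit normal
`ν`: the trace of `II(X, Y) = -g(ν, ∇_X Y) = g(∇_X ν, Y)`, so that round spheres in `ℝ³` have
mean curvature `2 / r` with respect to the outer normal. -/
def meanCurvature (J : ModelWithCorners ℝ E' H') (g : RiemMetric I M) (b : Basis κ ℝ E)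
    (c : Basis κ' ℝ E') (F : N → M) (x : N) (ν : TangentSpace I (F x)) : ℝ :=
  ∑ i, ∑ j,
    (Matrix.of fun i j : κ' => pullback J g F x (c i : E') (c j : E'))⁻¹ i j
      * (-(g.inner (F x) ν (covSecondDeriv J g b c F x i j)))

end Geometry

/-! ### The 2-sphere -/

/-- `ℝ²` -/
abbrev E2 := EuclideanSpace ℝ (Fin 2)

/-- `ℝ³` -/
abbrev E3 := EuclideanSpace ℝ (Fin 3)

/-- The 2-sphere, as a smooth manifold. -/
abbrev S2 := Metric.sphere (0 : E3) 1

/-- The standard basis of `ℝ²`. -/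
def basis2 : Basis (Fin 2) ℝ E2 := (EuclideanSpace.basisFun (Fin 2) ℝ).toBasis

/-- Smooth Riemannian metrics on the 2-sphere. -/
abbrev SphereMetric := RiemMetric (𝓡 2) S2

/-- The Gaussian curvature, half of the scalar curvature. -/
def gaussCurvature (g : SphereMetric) (x : S2) : ℝ := scalarCurvature g basis2 x / 2

/-- The standard metric `g_*` of the unit sphere in `ℝ³`. -/
def stdInner (x : S2) (v w : TangentSpace (𝓡 2) x) : ℝ :=
  inner ℝ (mfderiv (𝓡 2) 𝓘(ℝ, E3) (fun q : S2 => (q : E3)) x v : E3)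
    (mfderiv (𝓡 2) 𝓘(ℝ, E3) (fun q : S2 => (q : E3)) x w : E3)

/-- `g` is a round metric: it is isometric to the metric of a sphere of some radius `c > 0`. -/
def IsRound (g : SphereMetric) : Prop :=
  ∃ c : ℝ, 0 < c ∧ ∃ φ : S2 ≃ₘ^∞⟮𝓡 2, 𝓡 2⟯ S2, ∀ (x : S2) (v w : TangentSpace (𝓡 2) x),
    g.inner x v w = c ^ 2 * stdInner (φ x) (mfderiv (𝓡 2) (𝓡 2) φ x v) (mfderiv (𝓡 2) (𝓡 2) φ x w)

/-- A base point on the sphere. -/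
def pole : S2 := ⟨EuclideanSpace.single 2 1, by simp⟩

/-- The integral `∫ f dσ_g`, computed in the stereographic chart centred at `pole`, which covers
the sphere up to one point. -/
def surfaceIntegral (g : SphereMetric) (f : S2 → ℝ) : ℝ :=
  ∫ y : E2, f ((extChartAt (𝓡 2) pole).symm y) * √(coordMetric g basis2 pole y).det

/-- The area of the sphere with respect to `g`. -/
def area (g : SphereMetric) : ℝ := surfaceIntegral g fun _ => 1

/-- The Hawking mass of the Bartnik data `(S², g, H)`. -/
def hawkingMass (g : SphereMetric) (Hf : S2 → ℝ) : ℝ :=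
  √(area g / (16 * Real.pi)) *
    (1 - 1 / (16 * Real.pi) * surfaceIntegral g fun x => Hf x ^ 2)

/-! ### Paths of metrics -/

/-- The matrix of `g` at `x`. -/
def gram (g : SphereMetric) (x : S2) : Matrix (Fin 2) (Fin 2) ℝ :=
  Matrix.of fun i j => g.inner x (basis2 i : E2) (basis2 j : E2)

/-- The matrix of `g'(t)` at `x` (derivatives at `t = 0, 1` are one-sided). -/
def gramDeriv (path : ℝ → SphereMetric) (t : ℝ) (x : S2) : Matrix (Fin 2) (Fin 2) ℝ :=
  Matrix.of fun i j => derivWithin (fun s => gram (path s) x i j) (Icc 0 1) t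

/-- `tr_{g(t)} g'(t)` at `x`. -/
def traceDeriv (path : ℝ → SphereMetric) (t : ℝ) (x : S2) : ℝ :=
  ((gram (path t) x)⁻¹ * gramDeriv path t x).trace

/-- `|g'(t)|²_{g(t)} = g^{ik} g^{jl} g'_{ij} g'_{kl}` at `x`. -/
def normSqDeriv (path : ℝ → SphereMetric) (t : ℝ) (x : S2) : ℝ :=
  ((gram (path t) x)⁻¹ * gramDeriv path t x * (gram (path t) x)⁻¹ * gramDeriv path t x).trace

/-- `{g(t)}_{0 ≤ t ≤ 1}` is a smooth path of metrics: `(t, x) ↦ g(t)_x` is smooth on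
`[0, 1] × S²`. -/
def IsSmoothPath (path : ℝ → SphereMetric) : Prop :=
  ContMDiffOn (𝓘(ℝ, ℝ).prod (𝓡 2)) ((𝓡 2).prod 𝓘(ℝ, E2 →L[ℝ] E2 →L[ℝ] ℝ)) ∞
    (fun p : ℝ × S2 => Bundle.TotalSpace.mk' (E2 →L[ℝ] E2 →L[ℝ] ℝ)
      (E := fun x : S2 => TangentSpace (𝓡 2) x →L[ℝ] TangentSpace (𝓡 2) x →L[ℝ] ℝ)
      p.2 ((path p.1).inner p.2))
    (Icc 0 1 ×ˢ univ)

/-- The paths of metrics starting at `g` that are used to build collars: the constant path if `g`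
is round, and otherwise a smooth path of metrics of positive Gaussian curvature from `g` to a round
metric with `tr_{g(t)} g'(t) = 0`. -/
def IsAdmissiblePath (g : SphereMetric) (path : ℝ → SphereMetric) : Prop :=
  IsSmoothPath path ∧
  (IsRound g → ∀ t ∈ Icc (0 : ℝ) 1, path t = g) ∧
  (¬ IsRound g →
    (∀ t ∈ Icc (0 : ℝ) 1, ∀ x, 0 < gaussCurvature (path t) x) ∧
    path 0 = g ∧ IsRound (path 1) ∧
    ∀ t ∈ Icc (0 : ℝ) 1, ∀ x, traceDeriv path t x = 0)

/-- `α = ¼ max_{t ∈ [0,1]} max_{S²} |g'(t)|²_{g(t)}`. -/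
def IsAlpha (path : ℝ → SphereMetric) (α : ℝ) : Prop :=
  IsGreatest {a | ∃ t ∈ Icc (0 : ℝ) 1, ∃ x : S2, a = 1 / 4 * normSqDeriv path t x} α

/-- `β = r_o² min_{t ∈ [0,1]} min_{S²} K(g(t))`. -/
def IsBeta (path : ℝ → SphereMetric) (ro β : ℝ) : Prop :=
  IsLeast {a | ∃ t ∈ Icc (0 : ℝ) 1, ∃ x : S2, a = ro ^ 2 * gaussCurvature (path t) x} β

/-- `k = (H_o r_o / 2) (1 - 2m / r_o)^{-1/2}`. -/
def kConst (Ho ro m : ℝ) : ℝ := Ho * ro / 2 * (1 - 2 * m / ro) ^ (-(1 / 2) : ℝ)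

/-- The threshold `m_*`; `mH` stands for the Hawking mass of the Bartnik data. -/
def mStar (Ho ro α β m mH : ℝ) : ℝ :=
  if m < 0 then
    1 / 2 * ro * √((1 / 4 * Ho ^ 2 * ro ^ 2 * α) /
      ((β - 1 / 4 * Ho ^ 2 * ro ^ 2 * α) - kConst Ho ro m ^ 2)) * (1 - kConst Ho ro m ^ 2) + mH
  else
    1 / 2 * ro * √((α * kConst Ho ro m ^ 2) /
      (β - (1 + α) * kConst Ho ro m ^ 2)) * (1 - kConst Ho ro m ^ 2) + mH

/-! ### 3-manifolds with boundary -/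

/-- The model vector space `ℝ × ℝ²` of 3-manifolds. -/
abbrev V3 := EuclideanSpace ℝ (Fin 1) × E2

/-- The half-space `[0, ∞) × ℝ²`, on which 3-manifolds with boundary are modelled. -/
abbrev Half3 := ModelProd (EuclideanHalfSpace 1) E2

/-- The model with corners `[0, ∞) × ℝ² ⊆ ℝ × ℝ²`. -/
abbrev I3 : ModelWithCorners ℝ V3 Half3 := (𝓡∂ 1).prod (𝓡 2)

/-- The standard basis of `ℝ × ℝ²`. -/
def basis3 : Basis (Fin 1 ⊕ Fin 2) ℝ V3 :=
  (EuclideanSpace.basisFun (Fin 1) ℝ).toBasis.prod (EuclideanSpace.basisFun (Fin 2) ℝ).toBasis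

section Three

variable {M : Type*} [TopologicalSpace M] [ChartedSpace Half3 M] [IsManifold I3 ∞ M]

/-- `F` identifies `(S², g)` isometrically with the boundary of `(M, γ)`. -/
def IsBoundaryIsometry (γ : RiemMetric I3 M) (g : SphereMetric) (F : S2 → M) : Prop :=
  ContMDiff (𝓡 2) I3 ∞ F ∧ Function.Injective F ∧ range F = I3.boundary M ∧
  ∀ (x : S2) (v w : TangentSpace (𝓡 2) x), pullback (𝓡 2) γ F x v w = g.inner x v w

/-- The tangent vector `ν` at the boundary point `p` points into `M`: its first component in the
preferred half-space chart at `p` is positive. -/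
def PointsInward {p : M} (ν : TangentSpace I3 p) : Prop := 0 < (show V3 from ν).1 0

/-- The coefficient `γ(∂_i, ∂_j)` in the coordinates of an end parametrized by `Ψ`. -/
def endCoeff (γ : RiemMetric I3 M) (Ψ : E3 → M) (i j : Fin 3) (y : E3) : ℝ :=
  pullback 𝓘(ℝ, E3) γ Ψ y (EuclideanSpace.single i (1 : ℝ) : E3)
    (EuclideanSpace.single j (1 : ℝ) : E3)

/-- The partial derivative `∂_k f` on `ℝ³`. -/
def pd (k : Fin 3) (f : E3 → ℝ) (y : E3) : ℝ := fderiv ℝ f y (EuclideanSpace.single k 1)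

/-- `(M, γ)` is asymptotically flat (with one end): outside a compact set it is diffeomorphic to
the complement of a ball in `ℝ³`, with `γ_ij - δ_ij = O₂(|y|^{-τ})` for some `τ > 1/2`, and with
scalar curvature `O(|y|^{-q})` for some `q > 3`. -/
def IsAsymptoticallyFlat (γ : RiemMetric I3 M) : Prop :=
  ∃ (R : ℝ) (Ψ : PartialDiffeomorph 𝓘(ℝ, E3) I3 E3 M ∞) (τ q C : ℝ),
    0 < R ∧ 1 / 2 < τ ∧ 3 < q ∧
    Ψ.source = {y | R < ‖y‖} ∧
    (∀ r, R ≤ r → IsCompact (Ψ '' {y | r < ‖y‖})ᶜ) ∧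
    ∀ y : E3, R < ‖y‖ →
      (∀ i j, |endCoeff γ Ψ i j y - if i = j then 1 else 0| ≤ C * ‖y‖ ^ (-τ)) ∧
      (∀ i j k, |pd k (endCoeff γ Ψ i j) y| ≤ C * ‖y‖ ^ (-τ - 1)) ∧
      (∀ i j k l, |pd l (pd k (endCoeff γ Ψ i j)) y| ≤ C * ‖y‖ ^ (-τ - 2)) ∧
      |scalarCurvature γ basis3 (Ψ y)| ≤ C * ‖y‖ ^ (-q)

/-- `Ψ` is an isometry from the part `{r > R}` of the spatial Schwarzschild manifold of mass `μ`,
that is `(1 - 2μ/r)⁻¹ dr² + r² g_*`, onto the complement of a compact subset of `(M, γ)`. -/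
def IsSchwarzschildEnd (γ : RiemMetric I3 M) (μ R : ℝ)
    (Ψ : PartialDiffeomorph (𝓘(ℝ, ℝ).prod (𝓡 2)) I3 (ℝ × S2) M ∞) : Prop :=
  0 < R ∧ 2 * μ < R ∧ Ψ.source = Ioi R ×ˢ univ ∧
  (∀ r, R ≤ r → IsCompact (Ψ '' (Ioi r ×ˢ univ))ᶜ) ∧
  ∀ (r : ℝ) (x : S2), R < r → ∀ (a a' : ℝ) (v v' : TangentSpace (𝓡 2) x),
    pullback (𝓘(ℝ, ℝ).prod (𝓡 2)) γ Ψ (r, x) ((a, v) : ℝ × E2) ((a', v') : ℝ × E2) =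
      (1 - 2 * μ / r)⁻¹ * (a * a') + r ^ 2 * stdInner x v v'

/-- `Φ : [0, ∞) × S² → M` is a diffeomorphism whose slices `Φ({s} × S²)`, the leaves of a foliation
of `M` by 2-spheres, are mean convex: their mean curvature with respect to the unit normal pointing
in the direction of increasing `s` is positive. -/
def IsMeanConvexFoliation (γ : RiemMetric I3 M)
    (Φ : (EuclideanHalfSpace 1 × S2) ≃ₘ^∞⟮I3, I3⟯ M) : Prop :=
  ∀ (s : EuclideanHalfSpace 1) (x : S2), ∃ ν : TangentSpace I3 (Φ (s, x)),
    IsUnitNormal (𝓡 2) γ (fun q : S2 => Φ (s, q)) x ν ∧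
    0 < γ.inner (Φ (s, x)) ν
      (mfderiv I3 I3 Φ (s, x) ((EuclideanSpace.single 0 1, 0) : V3)) ∧
    0 < meanCurvature (𝓡 2) γ basis3 basis2 (fun q : S2 => Φ (s, q)) x ν

end Three

end CMCExtension

end

open CMCExtension

/-!
The extension is built on the half-cylinder `[0, ∞) × S²`. With the area radius `r = s + ro` as
radial coordinate, its metric is
`γ = (r / w(r)) dr² + (r² / ro²) g(τ(r))`,
where `w > 0` and `τ : [ro, ∞) → [0, 1]` are functions still to be chosen, with `τ = 0` at `ro` and
`τ = 1` for large `r`. Because the path has `tr g' = 0`, the spheres `{r} × S²` have area `4 π r²`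
and constant mean curvature `(2 / r) √(w / r)`, which is positive, and equals `Ho` on the boundary as
soon as `w(ro) = ro (Ho ro / 2)²`. The Gauss equation and the formula for the variation of mean
curvature (`SmoothBlock.scalar_eq`) give the scalar curvature
`(2 / r²) (ro² K(g(τ)) - w' - ⅛ |g'|² τ'² r w)`
(`ExtensionProfile.scalarCurvature_eq`). It is nonnegative where `w' + (α / 2) τ'² r w ≤ β`, and,
since `g(1)` is a round metric of radius `ro`, also where `τ = 1` is constant and `w' ≤ 1`. For
`w = r - 2 me` and `τ = 1` the metric is the Schwarzschild metric of mass `me`, and the mass function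
`(r - w) / 2` of the slices is at the boundary the Hawking mass of the data.

So one first takes `w' = k²` with the constant `k` of the statement, which gives
`w = k² (r - 2 m)`, and lets `τ` grow almost linearly from `0` to `1` over an interval of length `D`.
The curvature condition then needs `D` to exceed a critical length, and the mass function reaches
`D (1 - k²) / 2 + 𝔪_H` at the end of this collar; for the critical length this is `m_*`. Beyond the
collar the mass function is increased, with the same slope, to `me > m_*` and capped smoothly, so that
`w' ≤ 1` (`exists_profile`).

That the round end of the path has radius `ro` and Gaussian curvature `1 / ro²` is proved directly
from the definitions: the Gauss formula for surfaces in a sphere gives the curvature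
(`matScalar_firstForm`), and a change of variables in the stereographic chart gives the area
(`area_of_round`), which is constant along the path because the area element is (`det_gram_eq`).
Asymptotic flatness is read off in the coordinates `y = r x`, in which the Schwarzschild metric differs
from the Euclidean one by products of functions in a class closed under differentiation
(`decay_schwarzschild`).
-/

noncomputable section

namespace CMCExtension

/-! ### Coordinate frames -/

section Frames

open Bundle

variable {E : Type*} [NormedAddCommGroup E] [NormedSpace ℝ E]
  {H : Type*} [TopologicalSpace H] {I : ModelWithCorners ℝ E H}
  {M : Type*} [TopologicalSpace M] [ChartedSpace H M] [IsManifold I ∞ M]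
  {E' : Type*} [NormedAddCommGroup E'] [NormedSpace ℝ E']
  {H' : Type*} [TopologicalSpace H'] {J : ModelWithCorners ℝ E' H'}
  {N : Type*} [TopologicalSpace N] [ChartedSpace H' N]
  {κ : Type*}

variable (I) in
/-- The coordinate vector field of the preferred chart at `p` in the direction `v`. -/
def chartFrame (p : M) (v : E) (q : M) : TangentSpace I q :=
  (trivializationAt E (TangentSpace I : M → Type _) p).symm q v

/-- `chartFrame` is the coordinate field used in the definition of `coordMetric`. -/
lemma chartFrame_eq {p q : M} (hq : q ∈ (chartAt H p).source) (v : E) :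
    chartFrame I p v q =
      mfderivWithin 𝓘(ℝ, E) I (extChartAt I p).symm (range I) (extChartAt I p q) v := by
  have h1 := Trivialization.symmL_apply (R := ℝ)
    (trivializationAt E (TangentSpace I : M → Type _) p) (b := q) (by simpa using hq)
  have h2 := TangentBundle.symmL_trivializationAt (I := I) hq
  exact (h1 v).symm.trans (congrArg (fun L : E →L[ℝ] E => L v) h2)

lemma contMDiffOn_chartFrame (p : M) (v : E) :
    ContMDiffOn I (I.prod 𝓘(ℝ, E)) ∞
      (fun q : M => TotalSpace.mk' E (E := (TangentSpace I : M → Type _)) q (chartFrame I p v q))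
      (chartAt H p).source := by
  set e := trivializationAt E (TangentSpace I : M → Type _) p
  have h1 := e.contMDiffOn_symm (IB := I) (n := ∞)
  have h2 : ContMDiffOn I (I.prod 𝓘(ℝ, E)) ∞ (fun q : M => (q, v)) (chartAt H p).source :=
    (contMDiff_id.prodMk contMDiff_const).contMDiffOn
  refine (h1.comp h2 ?_).congr ?_
  · intro q hq
    rw [mem_preimage, e.mem_target]
    exact hq
  · intro q hq
    exact e.mk_symm (by exact hq) v

/-- A field of bilinear forms along a smooth map is smooth as soon as its coefficients with
respect to a coordinate frame are. -/
lemma contMDiffWithinAt_bilin_of_coeff [Fintype κ] (b : Basis κ ℝ E) {f : N → M} {s : Set N} {n₀ : N}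
    (B : ∀ n, TangentSpace I (f n) →L[ℝ] TangentSpace I (f n) →L[ℝ] ℝ)
    (hn₀ : n₀ ∈ s) (hf : ContMDiffWithinAt J I ∞ f s n₀)
    (hB : ∀ i j, ContMDiffWithinAt J 𝓘(ℝ, ℝ) ∞
      (fun n => B n (chartFrame I (f n₀) (b i) (f n)) (chartFrame I (f n₀) (b j) (f n))) s n₀) :
    ContMDiffWithinAt J (I.prod 𝓘(ℝ, E →L[ℝ] E →L[ℝ] ℝ)) ∞
      (fun n => TotalSpace.mk' (E →L[ℝ] E →L[ℝ] ℝ)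
        (E := fun x : M => TangentSpace I x →L[ℝ] TangentSpace I x →L[ℝ] ℝ) (f n) (B n)) s n₀ := by
  have : FiniteDimensional ℝ E := b.finiteDimensional_of_finite
  rw [contMDiffWithinAt_hom_bundle]
  refine ⟨hf, ?_⟩
  have hev : ∀ᶠ n in nhdsWithin n₀ s, f n ∈ (chartAt H (f n₀)).source :=
    hf.continuousWithinAt.eventually_mem ((chartAt H (f n₀)).open_source.mem_nhds
      (mem_chart_source H (f n₀)))
  set c : κ → (E →L[ℝ] ℝ) := fun i => LinearMap.toContinuousLinearMap (b.coord i)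
  have key : ContMDiffWithinAt J 𝓘(ℝ, E →L[ℝ] E →L[ℝ] ℝ) ∞
      (fun n => ∑ i, ∑ j,
        B n (chartFrame I (f n₀) (b i) (f n)) (chartFrame I (f n₀) (b j) (f n)) •
          ((c i).smulRight (c j) : E →L[ℝ] E →L[ℝ] ℝ)) s n₀ := by
    refine contMDiffWithinAt_finsetSum fun i _ => contMDiffWithinAt_finsetSum fun j _ => ?_
    exact (hB i j).smul contMDiffWithinAt_const
  refine key.congr_of_eventuallyEq_of_mem ?_ hn₀
  filter_upwards [hev] with n hn
  ext v w
  rw [inCoordinates_apply_eq₂ (by simpa using hn) (by simpa using hn) (Set.mem_univ _)]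
  have hL : ∀ u : E, (trivializationAt E (TangentSpace I : M → Type _) (f n₀)).symm (f n) u =
      ∑ i, b.repr u i • chartFrame I (f n₀) (b i) (f n) := by
    intro u
    have hb : f n ∈ (trivializationAt E (TangentSpace I : M → Type _) (f n₀)).baseSet := by
      simpa using hn
    conv_lhs => rw [← b.sum_repr u, ← Trivialization.symmL_apply (R := ℝ) _ hb]
    rw [map_sum]
    refine Finset.sum_congr rfl fun i _ => ?_
    rw [map_smul, Trivialization.symmL_apply _ hb]
    rfl
  simp only [hL, map_sum, map_smul, sum_apply, smul_apply]
  simp [c, Finset.mul_sum]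
  rw [Finset.sum_comm]
  exact Finset.sum_congr rfl fun i _ => Finset.sum_congr rfl fun j _ => by ring

/-- The coefficients of a smooth field of bilinear forms with respect to a coordinate frame are
smooth. -/
lemma contMDiffWithinAt_bilin_chartFrame {f : N → M} {s : Set N} {n₀ : N}
    {B : ∀ n, TangentSpace I (f n) →L[ℝ] TangentSpace I (f n) →L[ℝ] ℝ}
    (hB : ContMDiffWithinAt J (I.prod 𝓘(ℝ, E →L[ℝ] E →L[ℝ] ℝ)) ∞
      (fun n => TotalSpace.mk' (E →L[ℝ] E →L[ℝ] ℝ)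
        (E := fun x : M => TangentSpace I x →L[ℝ] TangentSpace I x →L[ℝ] ℝ) (f n) (B n)) s n₀)
    {p : M} (hp : f n₀ ∈ (chartAt H p).source) (v w : E) :
    ContMDiffWithinAt J 𝓘(ℝ, ℝ) ∞
      (fun n => B n (chartFrame I p v (f n)) (chartFrame I p w (f n))) s n₀ := by
  have hf : ContMDiffWithinAt J I ∞ f s n₀ := by
    rw [contMDiffWithinAt_hom_bundle] at hB
    exact hB.1
  have hv : ∀ v : E, ContMDiffWithinAt J (I.prod 𝓘(ℝ, E)) ∞
      (fun n => TotalSpace.mk' E (E := (TangentSpace I : M → Type _)) (f n)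
        (chartFrame I p v (f n))) s n₀ := by
    intro v
    have h1 := ((contMDiffOn_chartFrame (I := I) p v).contMDiffAt
      ((chartAt H p).open_source.mem_nhds hp))
    exact h1.comp_contMDiffWithinAt n₀ hf
  have key : ContMDiffWithinAt J (I.prod 𝓘(ℝ, ℝ)) ∞
      (fun n => TotalSpace.mk' ℝ (E := Bundle.Trivial M ℝ) (f n)
        (B n (chartFrame I p v (f n)) (chartFrame I p w (f n)))) s n₀ :=
    ContMDiffWithinAt.clm_bundle_apply₂ (F₁ := E) (F₂ := E) hB (hv v) (hv w)
  simp only [contMDiffWithinAt_totalSpace] at key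
  exact key.2

/-- On the target of the chart, `coordMetric` is the matrix of `g` in the coordinate frame. -/
lemma coordMetric_apply (g : RiemMetric I M) (b : Basis κ ℝ E) (p : M) {y : E}
    (hy : y ∈ (extChartAt I p).target) (i j : κ) :
    coordMetric g b p y i j = g.inner ((extChartAt I p).symm y)
      (chartFrame I p (b i) ((extChartAt I p).symm y))
      (chartFrame I p (b j) ((extChartAt I p).symm y)) := by
  have hq : (extChartAt I p).symm y ∈ (chartAt H p).source := by
    simpa using (extChartAt I p).map_target hy
  rw [chartFrame_eq hq, chartFrame_eq hq, (extChartAt I p).right_inv hy]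
  rfl

lemma contDiffOn_coordMetric (g : RiemMetric I M) (b : Basis κ ℝ E) (p : M) (i j : κ) :
    ContDiffOn ℝ ∞ (fun y => coordMetric g b p y i j) (extChartAt I p).target := by
  rw [← contMDiffOn_iff_contDiffOn]
  intro y hy
  have hq : (extChartAt I p).symm y ∈ (chartAt H p).source := by
    simpa using (extChartAt I p).map_target hy
  have h1 : ContMDiffWithinAt 𝓘(ℝ, E) I ∞ (extChartAt I p).symm (extChartAt I p).target y :=
    contMDiffOn_extChartAt_symm p y hy
  refine (contMDiffWithinAt_bilin_chartFrame (I := I) (f := (extChartAt I p).symm)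
    (B := fun z => g.inner ((extChartAt I p).symm z))
    (g.contMDiff.contMDiffAt.comp_contMDiffWithinAt y h1) hq (b i) (b j)).congr ?_ ?_
  · intro z hz
    exact coordMetric_apply g b p hz i j
  · exact coordMetric_apply g b p hy i j

/-- The preferred chart at `p` induces the identification of the tangent space at `p` with the model
space. -/
lemma chartFrame_self (p : M) (v : E) : chartFrame I p v p = v := by
  rw [chartFrame_eq (mem_chart_source H p), mfderivWithin_range_extChartAt_symm]
  rfl

lemma coordMetric_self (g : RiemMetric I M) (b : Basis κ ℝ E) (p : M) (i j : κ) :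
    coordMetric g b p (extChartAt I p p) i j =
      g.inner p (show TangentSpace I p from b i) (show TangentSpace I p from b j) := by
  rw [coordMetric_apply g b p (mem_extChartAt_target p)]
  rw [extChartAt_to_inv]
  rw [chartFrame_self, chartFrame_self]

lemma chartFrame_ne_zero {p q : M} (hq : q ∈ (chartAt H p).source) {v : E} (hv : v ≠ 0) :
    chartFrame I p v q ≠ 0 := by
  intro h
  have hb : q ∈ (trivializationAt E (TangentSpace I : M → Type _) p).baseSet := by simpa using hq
  have h1 := Trivialization.apply_mk_symm
    (trivializationAt E (TangentSpace I : M → Type _) p) hb v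
  have h2 := Trivialization.apply_mk_symm
    (trivializationAt E (TangentSpace I : M → Type _) p) hb 0
  have h3 : (trivializationAt E (TangentSpace I : M → Type _) p).symm q 0 = 0 := by
    rw [← Trivialization.symmL_apply (R := ℝ) _ hb, map_zero]
  rw [h3, ← h, chartFrame, h1] at h2
  exact hv (Prod.ext_iff.1 h2).2

variable (I) in
lemma chartFrame_sum {ι : Type*} (t : Finset ι) {p q : M} (hq : q ∈ (chartAt H p).source)
    (c : ι → ℝ) (v : ι → E) :
    chartFrame I p (∑ i ∈ t, c i • v i) q = ∑ i ∈ t, c i • chartFrame I p (v i) q := by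
  have hb : q ∈ (trivializationAt E (TangentSpace I : M → Type _) p).baseSet := by simpa using hq
  simp only [chartFrame, ← Trivialization.symmL_apply (R := ℝ) _ hb, map_sum, map_smul]

lemma coordMetric_symm (g : RiemMetric I M) (b : Basis κ ℝ E) (p : M) (y : E) (i j : κ) :
    coordMetric g b p y i j = coordMetric g b p y j i := g.symm _ _ _

lemma coordMetric_posDef [Fintype κ] (g : RiemMetric I M) (b : Basis κ ℝ E) (p : M) {y : E}
    (hy : y ∈ (extChartAt I p).target) : (coordMetric g b p y).PosDef := by
  refine Matrix.PosDef.of_dotProduct_mulVec_pos ?_ fun x hx => ?_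
  · ext i j
    simpa using coordMetric_symm g b p y j i
  have hq : (extChartAt I p).symm y ∈ (chartAt H p).source := by
    simpa using (extChartAt I p).map_target hy
  have hne : ∑ i, x i • b i ≠ 0 := by
    intro h
    exact hx (funext fun i => by
      simpa using Fintype.linearIndependent_iff.1 b.linearIndependent x h i)
  have hpos := g.pos _ _ (chartFrame_ne_zero hq hne)
  rw [chartFrame_sum I _ hq] at hpos
  simp only [map_sum, map_smul, sum_apply, smul_apply, smul_eq_mul] at hpos
  simp only [Matrix.mulVec, dotProduct, coordMetric_apply g b p hy, Pi.star_apply, star_trivial,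
    Finset.mul_sum]
  simp only [Finset.mul_sum] at hpos
  rw [Finset.sum_comm] at hpos
  refine lt_of_lt_of_eq hpos ?_
  exact Finset.sum_congr rfl fun i _ => Finset.sum_congr rfl fun j _ => by ring

end Frames

/-! ### Curvature of matrix-valued functions -/

section MatrixCurvature

variable {E : Type*} [NormedAddCommGroup E] [NormedSpace ℝ E]
  {H : Type*} [TopologicalSpace H] (I : ModelWithCorners ℝ E H)
  {κ : Type*} [Fintype κ] [DecidableEq κ]

/-- The Christoffel symbols of a matrix-valued function, read as a metric in coordinates. -/
def matChristoffel (b : Basis κ ℝ E) (G : E → Matrix κ κ ℝ) (k i j : κ) (y : E) : ℝ :=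
  (1 / 2) * ∑ l, (G y)⁻¹ k l *
    (coordDeriv I b i (fun z => G z j l) y + coordDeriv I b j (fun z => G z i l) y
      - coordDeriv I b l (fun z => G z i j) y)

/-- The Ricci tensor of a matrix-valued function, read as a metric in coordinates. -/
def matRicci (b : Basis κ ℝ E) (G : E → Matrix κ κ ℝ) (i j : κ) (y : E) : ℝ :=
  ∑ k, (coordDeriv I b k (matChristoffel I b G k i j) y
      - coordDeriv I b j (matChristoffel I b G k i k) y
      + ∑ l, (matChristoffel I b G k k l y * matChristoffel I b G l i j y
          - matChristoffel I b G k j l y * matChristoffel I b G l i k y))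

/-- The scalar curvature of a matrix-valued function, read as a metric in coordinates. -/
def matScalar (b : Basis κ ℝ E) (G : E → Matrix κ κ ℝ) (y : E) : ℝ :=
  ∑ i, ∑ j, (G y)⁻¹ i j * matRicci I b G i j y

variable {I} {M : Type*} [TopologicalSpace M] [ChartedSpace H M] [IsManifold I ∞ M]

lemma scalarCurvature_eq_matScalar (g : RiemMetric I M) (b : Basis κ ℝ E) (p : M) :
    scalarCurvature g b p = matScalar I b (coordMetric g b p) (extChartAt I p p) := rfl

lemma christoffel_eq_matChristoffel (g : RiemMetric I M) (b : Basis κ ℝ E) (p : M) :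
    christoffel g b p = matChristoffel I b (coordMetric g b p) := rfl

variable {b : Basis κ ℝ E}

omit [Fintype κ] [DecidableEq κ] in
lemma coordDeriv_congr {f g : E → ℝ} (h : EqOn f g (range I)) {y : E} (hy : y ∈ range I) (i : κ) :
    coordDeriv I b i f y = coordDeriv I b i g y := by
  rw [coordDeriv, coordDeriv, fderivWithin_congr h (h hy)]

omit [Fintype κ] [DecidableEq κ] in
lemma coordDeriv_mul {f g : E → ℝ} {y : E} (hy : y ∈ range I)
    (hf : DifferentiableWithinAt ℝ f (range I) y) (hg : DifferentiableWithinAt ℝ g (range I) y)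
    (i : κ) : coordDeriv I b i (fun z => f z * g z) y
      = coordDeriv I b i f y * g y + f y * coordDeriv I b i g y := by
  rw [coordDeriv, fderivWithin_fun_mul (I.uniqueDiffOn y hy) hf hg]
  simp [coordDeriv]; ring

omit [Fintype κ] [DecidableEq κ] in
lemma coordDeriv_sum {ι : Type*} {t : Finset ι} {f : ι → E → ℝ} {y : E} (hy : y ∈ range I)
    (hf : ∀ a ∈ t, DifferentiableWithinAt ℝ (f a) (range I) y) (i : κ) :
    coordDeriv I b i (fun z => ∑ a ∈ t, f a z) y = ∑ a ∈ t, coordDeriv I b i (f a) y := by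
  rw [coordDeriv, fderivWithin_fun_sum (I.uniqueDiffOn y hy) hf]
  simp [coordDeriv]

omit [Fintype κ] [DecidableEq κ] in
lemma coordDeriv_const (c : ℝ) (y : E) (i : κ) : coordDeriv I b i (fun _ => c) y = 0 := by
  simp [coordDeriv]

omit [Fintype κ] [DecidableEq κ] in
lemma contDiffOn_coordDeriv {f : E → ℝ} (hf : ContDiffOn ℝ ∞ f (range I)) (i : κ) :
    ContDiffOn ℝ ∞ (coordDeriv I b i f) (range I) :=
  (hf.fderivWithin I.uniqueDiffOn (by simp)).clm_apply contDiffOn_const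

omit [Fintype κ] in
lemma matChristoffel_congr [Fintype κ] {G G' : E → Matrix κ κ ℝ} (h : EqOn G G' (range I))
    (k i j : κ) : EqOn (matChristoffel I b G k i j) (matChristoffel I b G' k i j) (range I) := by
  intro y hy
  have hc : ∀ a c, EqOn (fun z => G z a c) (fun z => G' z a c) (range I) :=
    fun a c z hz => by simp only [h hz]
  simp only [matChristoffel, h hy, coordDeriv_congr (hc _ _) hy]

lemma matScalar_congr {G G' : E → Matrix κ κ ℝ} (h : EqOn G G' (range I)) {y : E}
    (hy : y ∈ range I) : matScalar I b G y = matScalar I b G' y := by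
  simp only [matScalar, matRicci, h hy, coordDeriv_congr (matChristoffel_congr h _ _ _) hy,
    matChristoffel_congr h _ _ _ hy]

/-- Entries of the inverse of a smooth family of invertible matrices are smooth. -/
lemma contDiffOn_matrix_inv {S : Set E} {h : E → Matrix (Fin 2) (Fin 2) ℝ}
    (hs : ∀ i j, ContDiffOn ℝ ∞ (fun z => h z i j) S) (hd : ∀ z ∈ S, (h z).det ≠ 0) (i j : Fin 2) :
    ContDiffOn ℝ ∞ (fun z => (h z)⁻¹ i j) S := by
  have hdet : ContDiffOn ℝ ∞ (fun z => (h z).det) S := by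
    simp only [Matrix.det_fin_two]
    exact ((hs 0 0).mul (hs 1 1)).sub ((hs 0 1).mul (hs 1 0))
  have hinv : ContDiffOn ℝ ∞ (fun z => ((h z).det)⁻¹) S := hdet.inv hd
  have : ∀ z, (h z)⁻¹ i j = ((h z).det)⁻¹ * (h z).adjugate i j := by
    intro z
    rw [Matrix.inv_def, Matrix.smul_apply, Ring.inverse_eq_inv', smul_eq_mul]
  simp only [this]
  refine hinv.mul ?_
  simp only [Matrix.adjugate_fin_two]
  fin_cases i <;> fin_cases j <;> simp
  · exact hs 1 1
  · exact (hs 0 1).neg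
  · exact (hs 1 0).neg
  · exact hs 0 0

end MatrixCurvature

/-! ### Coordinates on the half-space -/

section Block

lemma range_I3 : range I3 = {z : V3 | 0 ≤ z.1 0} := by
  rw [ModelWithCorners.range_prod, range_modelWithCornersEuclideanHalfSpace]
  ext z
  simp

lemma basis3_inl : basis3 (Sum.inl 0) = (EuclideanSpace.single 0 1, 0) := by
  simp [basis3]

lemma basis3_inr (i : Fin 2) : basis3 (Sum.inr i) = (0, basis2 i) := by
  simp [basis3, basis2]

/-- Differentiation along the half-line of a function of the half-line coordinate. -/
lemma coordDeriv_inl_comp {u : ℝ → ℝ} {z : V3} (hz : z ∈ range I3)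
    (hu : DifferentiableAt ℝ u (z.1 0)) :
    coordDeriv I3 basis3 (Sum.inl 0) (fun w => u (w.1 0)) z = deriv u (z.1 0) := by
  have hp : HasFDerivAt (fun w : V3 => w.1 0)
      ((EuclideanSpace.proj (0 : Fin 1) : EuclideanSpace ℝ (Fin 1) →L[ℝ] ℝ).comp
        (ContinuousLinearMap.fst ℝ (EuclideanSpace ℝ (Fin 1)) E2)) z :=
    ((EuclideanSpace.proj (0 : Fin 1) : EuclideanSpace ℝ (Fin 1) →L[ℝ] ℝ).comp
        (ContinuousLinearMap.fst ℝ (EuclideanSpace ℝ (Fin 1)) E2)).hasFDerivAt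
  have h := (hu.hasDerivAt.comp_hasFDerivAt z hp).hasFDerivWithinAt (s := range I3)
  have h2 := h.fderivWithin (I3.uniqueDiffOn z hz)
  rw [coordDeriv, show (fun w : V3 => u (w.1 0)) = u ∘ (fun w : V3 => w.1 0) from rfl, h2, basis3_inl]
  simp

lemma coordDeriv_inr_comp {u : ℝ → ℝ} {z : V3} (hz : z ∈ range I3)
    (hu : DifferentiableAt ℝ u (z.1 0)) (i : Fin 2) :
    coordDeriv I3 basis3 (Sum.inr i) (fun w => u (w.1 0)) z = 0 := by
  have hp : HasFDerivAt (fun w : V3 => w.1 0)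
      ((EuclideanSpace.proj (0 : Fin 1) : EuclideanSpace ℝ (Fin 1) →L[ℝ] ℝ).comp
        (ContinuousLinearMap.fst ℝ (EuclideanSpace ℝ (Fin 1)) E2)) z :=
    ((EuclideanSpace.proj (0 : Fin 1) : EuclideanSpace ℝ (Fin 1) →L[ℝ] ℝ).comp
        (ContinuousLinearMap.fst ℝ (EuclideanSpace ℝ (Fin 1)) E2)).hasFDerivAt
  have h := (hu.hasDerivAt.comp_hasFDerivAt z hp).hasFDerivWithinAt (s := range I3)
  have h2 := h.fderivWithin (I3.uniqueDiffOn z hz)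
  rw [coordDeriv, show (fun w : V3 => u (w.1 0)) = u ∘ (fun w : V3 => w.1 0) from rfl, h2, basis3_inr]
  simp

/-- Differentiation along the sphere directions only sees the restriction to a slice. -/
lemma coordDeriv_inr {f : V3 → ℝ} {z : V3} (hz : z ∈ range I3)
    (hf : DifferentiableWithinAt ℝ f (range I3) z) (i : Fin 2) :
    coordDeriv I3 basis3 (Sum.inr i) f z = coordDeriv (𝓡 2) basis2 i (fun y => f (z.1, y)) z.2 := by
  have h1 : HasFDerivWithinAt (fun y : E2 => ((z.1, y) : V3))
      (ContinuousLinearMap.inr ℝ (EuclideanSpace ℝ (Fin 1)) E2) univ z.2 := by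
    exact (hasFDerivAt_prodMk_right z.1 z.2).hasFDerivWithinAt
  have h2 : HasFDerivWithinAt (fun y : E2 => f (z.1, y))
      ((fderivWithin ℝ f (range I3) z).comp
        (ContinuousLinearMap.inr ℝ (EuclideanSpace ℝ (Fin 1)) E2)) univ z.2 := by
    refine HasFDerivWithinAt.comp (t := range I3) z.2 hf.hasFDerivWithinAt h1 ?_
    intro y _
    rw [range_I3] at hz ⊢
    exact hz
  rw [coordDeriv, coordDeriv, modelWithCornersSelf_coe, range_id,
    h2.fderivWithin uniqueDiffWithinAt_univ, basis3_inr]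
  simp

/-- A metric on `[0, ∞) × ℝ²` without mixed terms, whose radial coefficient depends only on the
first variable. -/
def blockMetric (u : ℝ → ℝ) (h : V3 → Matrix (Fin 2) (Fin 2) ℝ) (z : V3) :
    Matrix (Fin 1 ⊕ Fin 2) (Fin 1 ⊕ Fin 2) ℝ :=
  Matrix.fromBlocks (Matrix.of fun _ _ => u (z.1 0)) 0 0 (h z)

lemma blockMetric_inv {u : ℝ → ℝ} {h : V3 → Matrix (Fin 2) (Fin 2) ℝ} {z : V3}
    (hu : u (z.1 0) ≠ 0) (hd : (h z).det ≠ 0) :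
    (blockMetric u h z)⁻¹ = Matrix.fromBlocks (Matrix.of fun _ _ => (u (z.1 0))⁻¹) 0 0 (h z)⁻¹ := by
  apply Matrix.inv_eq_right_inv
  rw [blockMetric, Matrix.fromBlocks_multiply, ← Matrix.fromBlocks_one]
  congr 1
  · ext i j
    simp [Matrix.mul_apply, hu, Matrix.one_apply, Subsingleton.elim i j]
  · simp
  · simp
  · simp [Matrix.mul_nonsing_inv _ (Ne.isUnit hd)]

end Block

/-! ### Curvature of a metric in block form -/

section BlockCurvature

/-- The data of a block metric `u ds² + h` with smooth nondegenerate coefficients. -/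
structure SmoothBlock (u : ℝ → ℝ) (h : V3 → Matrix (Fin 2) (Fin 2) ℝ) : Prop where
  smooth_u : ∀ s, 0 ≤ s → ContDiffAt ℝ ∞ u s
  u_ne : ∀ s, 0 ≤ s → u s ≠ 0
  smooth_h : ∀ i j, ContDiffOn ℝ ∞ (fun z => h z i j) (range I3)
  symm_h : ∀ z ∈ range I3, ∀ i j, h z i j = h z j i
  det_ne : ∀ z ∈ range I3, (h z).det ≠ 0

variable {u : ℝ → ℝ} {h : V3 → Matrix (Fin 2) (Fin 2) ℝ}

/-- The derivative `∂_s h_ij`. -/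
def radialDeriv (h : V3 → Matrix (Fin 2) (Fin 2) ℝ) (z : V3) : Matrix (Fin 2) (Fin 2) ℝ :=
  Matrix.of fun i j => coordDeriv I3 basis3 (Sum.inl 0) (fun w => h w i j) z

/-- The shape operator `½ h^{kl} ∂_s h_{li}` of the slices, up to the lapse. -/
def shapeEntry (h : V3 → Matrix (Fin 2) (Fin 2) ℝ) (k i : Fin 2) (z : V3) : ℝ :=
  1 / 2 * ∑ l, (h z)⁻¹ k l * radialDeriv h z i l

lemma contDiffOn_comp_radial {f : ℝ → ℝ} (hf : ∀ s, 0 ≤ s → ContDiffAt ℝ ∞ f s) :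
    ContDiffOn ℝ ∞ (fun z : V3 => f (z.1 0)) (range I3) := by
  intro z hz
  rw [range_I3] at hz
  have hp : ContDiff ℝ ∞ (fun z : V3 => z.1 0) :=
    ((EuclideanSpace.proj (0 : Fin 1) : EuclideanSpace ℝ (Fin 1) →L[ℝ] ℝ).comp
        (ContinuousLinearMap.fst ℝ (EuclideanSpace ℝ (Fin 1)) E2)).contDiff
  exact ((hf _ hz).comp z hp.contDiffAt).contDiffWithinAt

namespace SmoothBlock

variable (B : SmoothBlock u h)
include B

lemma u_ne' {z : V3} (hz : z ∈ range I3) : u (z.1 0) ≠ 0 := by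
  rw [range_I3] at hz
  exact B.u_ne _ hz

lemma diff_u {z : V3} (hz : z ∈ range I3) : DifferentiableAt ℝ u (z.1 0) := by
  rw [range_I3] at hz
  exact (B.smooth_u _ hz).differentiableAt (by simp)

lemma diff_h {z : V3} (hz : z ∈ range I3) (i j : Fin 2) :
    DifferentiableWithinAt ℝ (fun z => h z i j) (range I3) z :=
  ((B.smooth_h i j).differentiableOn (by simp)) z hz

lemma smooth_inv (i j : Fin 2) : ContDiffOn ℝ ∞ (fun z => (h z)⁻¹ i j) (range I3) :=
  contDiffOn_matrix_inv B.smooth_h B.det_ne i j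

lemma smooth_radialDeriv (i j : Fin 2) :
    ContDiffOn ℝ ∞ (fun z => radialDeriv h z i j) (range I3) :=
  contDiffOn_coordDeriv (B.smooth_h i j) _

lemma smooth_shapeEntry (i j : Fin 2) : ContDiffOn ℝ ∞ (shapeEntry h i j) (range I3) :=
  contDiffOn_const.mul (ContDiffOn.sum fun l _ => (B.smooth_inv i l).mul (B.smooth_radialDeriv j l))

lemma radialDeriv_symm {z : V3} (hz : z ∈ range I3) (i j : Fin 2) :
    radialDeriv h z i j = radialDeriv h z j i :=
  coordDeriv_congr (fun w hw => B.symm_h w hw i j) hz _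

lemma inv_symm {z : V3} (hz : z ∈ range I3) (i j : Fin 2) : (h z)⁻¹ i j = (h z)⁻¹ j i := by
  have : (h z).transpose = h z := by ext i j; exact B.symm_h z hz j i
  conv_lhs => rw [← this, ← Matrix.transpose_nonsing_inv]
  rfl

lemma inv_eq {z : V3} (hz : z ∈ range I3) :
    (blockMetric u h z)⁻¹ = Matrix.fromBlocks (Matrix.of fun _ _ => (u (z.1 0))⁻¹) 0 0 (h z)⁻¹ :=
  blockMetric_inv (B.u_ne' hz) (B.det_ne z hz)

lemma coordDeriv_u {z : V3} (hz : z ∈ range I3) :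
    coordDeriv I3 basis3 (Sum.inl 0) (fun w => u (w.1 0)) z = deriv u (z.1 0) :=
  coordDeriv_inl_comp hz (B.diff_u hz)

lemma coordDeriv_u' {z : V3} (hz : z ∈ range I3) (i : Fin 2) :
    coordDeriv I3 basis3 (Sum.inr i) (fun w => u (w.1 0)) z = 0 :=
  coordDeriv_inr_comp hz (B.diff_u hz) i

/-! The Christoffel symbols of `u ds² + h`: the index `Sum.inl 0` stands for `s`, and `Sum.inr i` for
the coordinates of the slices. -/

lemma chr_000 {z : V3} (hz : z ∈ range I3) :
    matChristoffel I3 basis3 (blockMetric u h) (Sum.inl 0) (Sum.inl 0) (Sum.inl 0) z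
      = deriv u (z.1 0) / (2 * u (z.1 0)) := by
  have := B.u_ne' hz
  simp [matChristoffel, B.inv_eq hz]
  simp [blockMetric, B.coordDeriv_u hz]
  field_simp

lemma chr_00i {z : V3} (hz : z ∈ range I3) (i : Fin 2) :
    matChristoffel I3 basis3 (blockMetric u h) (Sum.inl 0) (Sum.inl 0) (Sum.inr i) z = 0 := by
  simp [matChristoffel, B.inv_eq hz]
  simp [blockMetric, B.coordDeriv_u' hz, coordDeriv_const]

lemma chr_0i0 {z : V3} (hz : z ∈ range I3) (i : Fin 2) :
    matChristoffel I3 basis3 (blockMetric u h) (Sum.inl 0) (Sum.inr i) (Sum.inl 0) z = 0 := by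
  simp [matChristoffel, B.inv_eq hz]
  simp [blockMetric, B.coordDeriv_u' hz]

lemma chr_0ij {z : V3} (hz : z ∈ range I3) (i j : Fin 2) :
    matChristoffel I3 basis3 (blockMetric u h) (Sum.inl 0) (Sum.inr i) (Sum.inr j) z
      = -(1 / 2) * ((u (z.1 0))⁻¹ * radialDeriv h z i j) := by
  simp [matChristoffel, B.inv_eq hz]
  simp [blockMetric, coordDeriv_const, radialDeriv]

lemma chr_k00 {z : V3} (hz : z ∈ range I3) (k : Fin 2) :
    matChristoffel I3 basis3 (blockMetric u h) (Sum.inr k) (Sum.inl 0) (Sum.inl 0) z = 0 := by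
  simp [matChristoffel, B.inv_eq hz]
  simp [blockMetric, B.coordDeriv_u' hz, coordDeriv_const]

lemma chr_k0i {z : V3} (hz : z ∈ range I3) (k i : Fin 2) :
    matChristoffel I3 basis3 (blockMetric u h) (Sum.inr k) (Sum.inl 0) (Sum.inr i) z
      = shapeEntry h k i z := by
  simp [matChristoffel, B.inv_eq hz]
  simp [blockMetric, coordDeriv_const, radialDeriv, shapeEntry]

lemma chr_ki0 {z : V3} (hz : z ∈ range I3) (k i : Fin 2) :
    matChristoffel I3 basis3 (blockMetric u h) (Sum.inr k) (Sum.inr i) (Sum.inl 0) z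
      = shapeEntry h k i z := by
  simp [matChristoffel, B.inv_eq hz]
  simp [blockMetric, coordDeriv_const, radialDeriv, shapeEntry]

lemma chr_kij {z : V3} (hz : z ∈ range I3) (k i j : Fin 2) :
    matChristoffel I3 basis3 (blockMetric u h) (Sum.inr k) (Sum.inr i) (Sum.inr j) z
      = matChristoffel (𝓡 2) basis2 (fun y => h (z.1, y)) k i j z.2 := by
  simp [matChristoffel, B.inv_eq hz]
  simp [blockMetric, coordDeriv_inr hz (B.diff_h hz _ _)]

omit B in
lemma slice_mem {z : V3} (hz : z ∈ range I3) (y : E2) : ((z.1, y) : V3) ∈ range I3 := by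
  rw [range_I3] at hz ⊢
  exact hz

/-! Smoothness up to the boundary, which is needed to differentiate along the boundary slice. -/

lemma smooth_block (i j : Fin 1 ⊕ Fin 2) :
    ContDiffOn ℝ ∞ (fun z => blockMetric u h z i j) (range I3) := by
  rcases i with i | i <;> rcases j with j | j <;> simp only [blockMetric, Matrix.fromBlocks_apply₁₁,
    Matrix.fromBlocks_apply₁₂, Matrix.fromBlocks_apply₂₁, Matrix.fromBlocks_apply₂₂]
  · exact contDiffOn_comp_radial B.smooth_u
  · exact contDiffOn_const
  · exact contDiffOn_const
  · exact B.smooth_h i j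

lemma smooth_block_inv (i j : Fin 1 ⊕ Fin 2) :
    ContDiffOn ℝ ∞ (fun z => (blockMetric u h z)⁻¹ i j) (range I3) := by
  have : EqOn (fun z => (blockMetric u h z)⁻¹ i j) (fun z =>
    Matrix.fromBlocks (Matrix.of fun _ _ => (u (z.1 0))⁻¹) 0 0 (h z)⁻¹ i j) (range I3) :=
    fun z hz => by simp only [B.inv_eq hz]
  refine ContDiffOn.congr ?_ this
  rcases i with i | i <;> rcases j with j | j <;> simp only [Matrix.fromBlocks_apply₁₁,
    Matrix.fromBlocks_apply₁₂, Matrix.fromBlocks_apply₂₁, Matrix.fromBlocks_apply₂₂]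
  · exact (contDiffOn_comp_radial B.smooth_u).inv fun z hz => B.u_ne' hz
  · exact contDiffOn_const
  · exact contDiffOn_const
  · exact B.smooth_inv i j

lemma smooth_chr (k i j : Fin 1 ⊕ Fin 2) :
    ContDiffOn ℝ ∞ (matChristoffel I3 basis3 (blockMetric u h) k i j) (range I3) :=
  contDiffOn_const.mul (ContDiffOn.sum fun l _ => (B.smooth_block_inv k l).mul
    (((contDiffOn_coordDeriv (B.smooth_block j l) i).add
      (contDiffOn_coordDeriv (B.smooth_block i l) j)).sub
      (contDiffOn_coordDeriv (B.smooth_block i j) l)))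

/-- Along the slices the derivatives of the Christoffel symbols are those of the slice metric. -/
lemma coordDeriv_chr_kij {z : V3} (hz : z ∈ range I3) (m k i j : Fin 2) :
    coordDeriv I3 basis3 (Sum.inr m)
      (matChristoffel I3 basis3 (blockMetric u h) (Sum.inr k) (Sum.inr i) (Sum.inr j)) z
      = coordDeriv (𝓡 2) basis2 m
        (matChristoffel (𝓡 2) basis2 (fun y => h (z.1, y)) k i j) z.2 := by
  rw [coordDeriv_inr hz (((B.smooth_chr _ _ _).differentiableOn (by simp)) z hz)]
  congr 1
  funext y
  exact B.chr_kij (slice_mem hz y) k i j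

/-- The radial Ricci curvature, the evolution equation of the mean curvature of the slices. -/
lemma ricci_radial {z : V3} (hz : z ∈ range I3) :
    matRicci I3 basis3 (blockMetric u h) (Sum.inl 0) (Sum.inl 0) z
      = -(∑ k, coordDeriv I3 basis3 (Sum.inl 0) (shapeEntry h k k) z)
        + (∑ k, shapeEntry h k k z) * (deriv u (z.1 0) / (2 * u (z.1 0)))
        - ∑ k, ∑ l, shapeEntry h k l z * shapeEntry h l k z := by
  have h1 : ∀ k i, coordDeriv I3 basis3 (Sum.inr k)
      (matChristoffel I3 basis3 (blockMetric u h) (Sum.inr i) (Sum.inl 0) (Sum.inl 0)) z = 0 := by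
    intro k i
    rw [coordDeriv_congr (g := fun _ => 0) (fun w hw => B.chr_k00 hw i) hz, coordDeriv_const]
  have h2 : ∀ k i, coordDeriv I3 basis3 (Sum.inl 0)
      (matChristoffel I3 basis3 (blockMetric u h) (Sum.inr k) (Sum.inl 0) (Sum.inr i)) z
        = coordDeriv I3 basis3 (Sum.inl 0) (shapeEntry h k i) z := by
    intro k i
    rw [coordDeriv_congr (fun w hw => B.chr_k0i hw k i) hz]
  simp only [matRicci, Fintype.sum_sum_type, Fin.sum_univ_two, Finset.univ_unique,
    Finset.sum_singleton, Fin.default_eq_zero, h1, h2, B.chr_000 hz, B.chr_00i hz, B.chr_k00 hz,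
    B.chr_k0i hz, B.chr_ki0 hz]
  ring

/-- The tangential Ricci curvature in terms of that of the slices, before any assumption on `h`. -/
lemma ricci_tangential {z : V3} (hz : z ∈ range I3) (i j : Fin 2) :
    matRicci I3 basis3 (blockMetric u h) (Sum.inr i) (Sum.inr j) z
      = matRicci (𝓡 2) basis2 (fun y => h (z.1, y)) i j z.2
        - (1 / 2) * (-(deriv u (z.1 0) / u (z.1 0) ^ 2) * radialDeriv h z i j
          + (u (z.1 0))⁻¹ * coordDeriv I3 basis3 (Sum.inl 0) (fun w => radialDeriv h w i j) z)
        - (1 / 2) * (deriv u (z.1 0) / (2 * u (z.1 0)) + ∑ k, shapeEntry h k k z)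
          * ((u (z.1 0))⁻¹ * radialDeriv h z i j)
        + (1 / 2) * (u (z.1 0))⁻¹ * ∑ l, (radialDeriv h z j l * shapeEntry h l i z
          + shapeEntry h l j z * radialDeriv h z i l) := by
  have hu := B.u_ne' hz
  have hz0 : 0 ≤ z.1 0 := by
    rw [range_I3] at hz
    exact hz
  have huinv : DifferentiableAt ℝ (fun s => (u s)⁻¹) (z.1 0) :=
    (B.diff_u hz).inv hu
  have h0 : coordDeriv I3 basis3 (Sum.inl 0)
      (matChristoffel I3 basis3 (blockMetric u h) (Sum.inl 0) (Sum.inr i) (Sum.inr j)) z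
        = -(1 / 2) * (-(deriv u (z.1 0) / u (z.1 0) ^ 2) * radialDeriv h z i j
          + (u (z.1 0))⁻¹ * coordDeriv I3 basis3 (Sum.inl 0) (fun w => radialDeriv h w i j) z) := by
    have d1 : DifferentiableWithinAt ℝ (fun w : V3 => (u (w.1 0))⁻¹) (range I3) z :=
      ((contDiffOn_comp_radial B.smooth_u).inv fun z hz => B.u_ne' hz).differentiableOn
        (by simp) z hz
    have d2 := (B.smooth_radialDeriv i j).differentiableOn (by simp) z hz
    have d3 : DifferentiableWithinAt ℝ
        (fun w : V3 => (u (w.1 0))⁻¹ * radialDeriv h w i j) (range I3) z := d1.mul d2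
    rw [coordDeriv_congr (fun w hw => B.chr_0ij hw i j) hz,
      coordDeriv_mul hz (differentiableWithinAt_const _) d3, coordDeriv_const,
      coordDeriv_mul hz d1 d2, coordDeriv_inl_comp (u := fun s => (u s)⁻¹) hz huinv,
      deriv_fun_inv'' (B.diff_u hz) hu]
    ring
  have h1 : ∀ m k, coordDeriv I3 basis3 (Sum.inr m)
      (matChristoffel I3 basis3 (blockMetric u h) (Sum.inl 0) (Sum.inr k) (Sum.inl 0)) z = 0 := by
    intro m k
    rw [coordDeriv_congr (g := fun _ => 0) (fun w hw => B.chr_0i0 hw k) hz, coordDeriv_const]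
  simp only [matRicci, Fintype.sum_sum_type, Finset.univ_unique, Finset.sum_singleton,
    Fin.default_eq_zero, h0, h1, B.coordDeriv_chr_kij hz, B.chr_000 hz, B.chr_00i hz, B.chr_0i0 hz,
    B.chr_ki0 hz, B.chr_0ij hz, B.chr_kij hz]
  simp only [Fin.sum_univ_two]
  ring

/-- Scalar curvature of `u ds² + h` when the trace of the shape operator of the slices is a
function `θ` of `s` alone. -/
theorem scalar_eq {θ : ℝ → ℝ} (hθ : ∀ s, 0 ≤ s → DifferentiableAt ℝ θ s)
    (htr : ∀ z ∈ range I3, ∑ i, ∑ j, (h z)⁻¹ i j * radialDeriv h z i j = 2 * θ (z.1 0))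
    {z : V3} (hz : z ∈ range I3) :
    matScalar I3 basis3 (blockMetric u h) z
      = matScalar (𝓡 2) basis2 (fun y => h (z.1, y)) z.2
        + (u (z.1 0))⁻¹ * (-2 * deriv θ (z.1 0) - θ (z.1 0) ^ 2
          + θ (z.1 0) * deriv u (z.1 0) / u (z.1 0)
          - 1 / 4 * ((h z)⁻¹ * radialDeriv h z * (h z)⁻¹ * radialDeriv h z).trace) := by
  have hu := B.u_ne' hz
  have hz0 : 0 ≤ z.1 0 := by
    rw [range_I3] at hz
    exact hz
  have dθ := hθ _ hz0
  have dX : ∀ i j, DifferentiableWithinAt ℝ (fun z => (h z)⁻¹ i j) (range I3) z :=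
    fun i j => (B.smooth_inv i j).differentiableOn (by simp) z hz
  have dP : ∀ i j, DifferentiableWithinAt ℝ (fun z => radialDeriv h z i j) (range I3) z :=
    fun i j => (B.smooth_radialDeriv i j).differentiableOn (by simp) z hz
  have dW : ∀ i j, DifferentiableWithinAt ℝ (shapeEntry h i j) (range I3) z :=
    fun i j => (B.smooth_shapeEntry i j).differentiableOn (by simp) z hz
  -- The trace of the shape operator is `θ`.
  have hW : ∀ w ∈ range I3, ∑ k, shapeEntry h k k w = θ (w.1 0) := by
    intro w hw
    have := htr w hw
    simp only [shapeEntry, Fin.sum_univ_two] at this ⊢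
    rw [B.inv_symm hw 1 0, B.radialDeriv_symm hw 1 0] at *
    linarith
  have hW' : ∑ k, coordDeriv I3 basis3 (Sum.inl 0) (shapeEntry h k k) z = deriv θ (z.1 0) := by
    rw [← coordDeriv_sum hz (fun k _ => dW k k), coordDeriv_congr hW hz]
    exact coordDeriv_inl_comp hz dθ
  -- Differentiating `h⁻¹ h = 1` and `h^{ij} ∂_s h_ij = 2 θ`.
  have hX : ∀ i j, coordDeriv I3 basis3 (Sum.inl 0) (fun w => (h w)⁻¹ i j) z
      = -((h z)⁻¹ * radialDeriv h z * (h z)⁻¹) i j := by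
    set DX : Matrix (Fin 2) (Fin 2) ℝ := Matrix.of fun i j =>
      coordDeriv I3 basis3 (Sum.inl 0) (fun w => (h w)⁻¹ i j) z with hDX
    have h1 : DX * h z = -((h z)⁻¹ * radialDeriv h z) := by
      ext i j
      have e1 : coordDeriv I3 basis3 (Sum.inl 0) (fun w => ∑ l, (h w)⁻¹ i l * h w l j) z = 0 := by
        rw [coordDeriv_congr (g := fun _ => (1 : Matrix (Fin 2) (Fin 2) ℝ) i j) ?_ hz,
          coordDeriv_const]
        intro w hw
        have := congrFun (congrFun (Matrix.nonsing_inv_mul (h w) (B.det_ne w hw).isUnit) i) j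
        rw [Matrix.mul_apply] at this
        exact this
      have dm : ∀ l, DifferentiableWithinAt ℝ (fun w => (h w)⁻¹ i l * h w l j) (range I3) z :=
        fun l => (dX i l).mul (B.diff_h hz l j)
      rw [coordDeriv_sum hz (fun l _ => dm l)] at e1
      simp only [coordDeriv_mul hz (dX i _) (B.diff_h hz _ j), Finset.sum_add_distrib] at e1
      rw [Matrix.neg_apply, Matrix.mul_apply, Matrix.mul_apply]
      exact eq_neg_of_add_eq_zero_left e1
    have h2 : DX = -((h z)⁻¹ * radialDeriv h z * (h z)⁻¹) := by
      rw [← neg_mul, ← h1, Matrix.mul_nonsing_inv_cancel_right _ _ (B.det_ne z hz).isUnit]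
    intro i j
    exact congrFun (congrFun h2 i) j
  have hQ : ∑ i, ∑ j, (h z)⁻¹ i j * coordDeriv I3 basis3 (Sum.inl 0)
      (fun w => radialDeriv h w i j) z = 2 * deriv θ (z.1 0)
        + ((h z)⁻¹ * radialDeriv h z * (h z)⁻¹ * radialDeriv h z).trace := by
    have e1 : coordDeriv I3 basis3 (Sum.inl 0)
        (fun w => ∑ i, ∑ j, (h w)⁻¹ i j * radialDeriv h w i j) z = 2 * deriv θ (z.1 0) := by
      rw [coordDeriv_congr htr hz, coordDeriv_inl_comp (u := fun s => 2 * θ s) hz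
        (dθ.const_mul 2), deriv_const_mul _ dθ]
    have dm : ∀ i j, DifferentiableWithinAt ℝ
        (fun w => (h w)⁻¹ i j * radialDeriv h w i j) (range I3) z := fun i j => (dX i j).mul (dP i j)
    rw [coordDeriv_sum hz (fun i _ => DifferentiableWithinAt.fun_sum fun j _ => dm i j)] at e1
    simp only [coordDeriv_sum hz (fun j _ => dm _ j), coordDeriv_mul hz (dX _ _) (dP _ _), hX] at e1
    simp only [Matrix.trace_fin_two, Fin.sum_univ_two, Matrix.mul_apply] at e1 ⊢
    rw [B.inv_symm hz 1 0, B.radialDeriv_symm hz 1 0] at *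
    linear_combination e1
  simp only [matScalar, Fintype.sum_sum_type, Finset.univ_unique, Finset.sum_singleton,
    Fin.default_eq_zero, B.inv_eq hz, Matrix.fromBlocks_apply₁₁, Matrix.fromBlocks_apply₁₂,
    Matrix.fromBlocks_apply₂₁, Matrix.fromBlocks_apply₂₂, Matrix.zero_apply, zero_mul,
    Finset.sum_const_zero, add_zero, zero_add, Matrix.of_apply, B.ricci_radial hz,
    B.ricci_tangential hz, hW z hz, hW']
  have htrz := htr z hz
  have e10 := B.inv_symm hz 1 0
  have p10 := B.radialDeriv_symm hz 1 0
  simp only [shapeEntry, Matrix.trace_fin_two, Fin.sum_univ_two, Matrix.mul_apply, e10, p10]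
    at htrz hQ ⊢
  generalize coordDeriv I3 basis3 (Sum.inl 0) (fun w => radialDeriv h w 0 0) z = q00 at *
  generalize coordDeriv I3 basis3 (Sum.inl 0) (fun w => radialDeriv h w 0 1) z = q01 at *
  generalize coordDeriv I3 basis3 (Sum.inl 0) (fun w => radialDeriv h w 1 0) z = q10 at *
  generalize coordDeriv I3 basis3 (Sum.inl 0) (fun w => radialDeriv h w 1 1) z = q11 at *
  generalize radialDeriv h z 0 0 = p00 at *
  generalize radialDeriv h z 0 1 = p01 at *
  generalize radialDeriv h z 1 1 = p11 at *
  generalize (h z)⁻¹ 0 0 = x00 at *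
  generalize (h z)⁻¹ 0 1 = x01 at *
  generalize (h z)⁻¹ 1 1 = x11 at *
  generalize deriv θ (z.1 0) = θ' at *
  generalize deriv u (z.1 0) = u' at *
  generalize θ (z.1 0) = θ₀ at *
  generalize u (z.1 0) = u₀ at *
  linear_combination (-(1 / 2) * u₀⁻¹) * hQ
    + (1 / 2 * (u' / u₀ ^ 2) - 1 / 2 * (u' / (2 * u₀) + θ₀) * u₀⁻¹) * htrz

end SmoothBlock
end BlockCurvature

/-! ### Behaviour under scaling -/

section Scaling

variable {E : Type*} [NormedAddCommGroup E] [NormedSpace ℝ E]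
  {H : Type*} [TopologicalSpace H] {I : ModelWithCorners ℝ E H}
  {κ : Type*} [Fintype κ] [DecidableEq κ] {b : Basis κ ℝ E}

/-- The scalar curvature scales inversely with the metric. -/
lemma matScalar_smul {c : ℝ} (hc : c ≠ 0) (G : E → Matrix κ κ ℝ) {y : E} (hy : y ∈ range I) :
    matScalar I b (fun z => c • G z) y = c⁻¹ * matScalar I b G y := by
  have hinv : ∀ z, (c • G z)⁻¹ = c⁻¹ • (G z)⁻¹ := by
    intro z
    by_cases h : IsUnit (G z).det
    · have := invertibleOfNonzero hc
      rw [Matrix.inv_smul _ _ h, invOf_eq_inv]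
    · have h' : ¬ IsUnit (c • G z).det := by
        rw [Matrix.det_smul]
        simpa [hc] using h
      rw [Matrix.nonsing_inv_apply_not_isUnit _ h, Matrix.nonsing_inv_apply_not_isUnit _ h',
        smul_zero]
  have hd : ∀ (i : κ) (f : E → ℝ), ∀ z ∈ range I,
      coordDeriv I b i (fun w => c * f w) z = c * coordDeriv I b i f z := by
    intro i f z hz
    have := fderivWithin_const_smul_field (𝕜 := ℝ) (f := f) c (I.uniqueDiffOn z hz)
    rw [coordDeriv, coordDeriv, show (fun w => c * f w) = c • f from rfl, this]
    rfl
  have hchr : ∀ k i j, EqOn (matChristoffel I b (fun z => c • G z) k i j)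
      (matChristoffel I b G k i j) (range I) := by
    intro k i j z hz
    simp only [matChristoffel, hinv, Matrix.smul_apply, smul_eq_mul, hd _ _ z hz]
    congr 1
    refine Finset.sum_congr rfl fun l _ => ?_
    field_simp
  simp only [matScalar, matRicci, hinv, coordDeriv_congr (hchr _ _ _) hy, hchr _ _ _ hy,
    Matrix.smul_apply, smul_eq_mul, Finset.mul_sum, mul_assoc]

end Scaling

/-! ### Surfaces in a sphere -/

section GaussFormula

lemma coordDeriv_E2 (i : Fin 2) (f : E2 → ℝ) (y : E2) :
    coordDeriv (𝓡 2) basis2 i f y = fderiv ℝ f y (basis2 i) := by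
  rw [coordDeriv, modelWithCornersSelf_coe, range_id, fderivWithin_univ]

/-- The partial derivative of a vector-valued map on the plane. -/
def vecDeriv (i : Fin 2) (f : E2 → E3) (y : E2) : E3 := fderiv ℝ f y (basis2 i)

lemma contDiff_vecDeriv {f : E2 → E3} (hf : ContDiff ℝ ∞ f) (i : Fin 2) :
    ContDiff ℝ ∞ (vecDeriv i f) :=
  (hf.fderiv_right (m := ∞) (by simp)).clm_apply contDiff_const

/-- Partial derivatives commute. -/
lemma vecDeriv_comm {f : E2 → E3} (hf : ContDiff ℝ ∞ f) (i j : Fin 2) :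
    vecDeriv i (vecDeriv j f) = vecDeriv j (vecDeriv i f) := by
  funext y
  have hs : IsSymmSndFDerivAt ℝ f y := hf.contDiffAt.isSymmSndFDerivAt
    (by simpa using (mod_cast le_top : ((2 : ℕ∞) : WithTop ℕ∞) ≤ ∞))
  have hd : DifferentiableAt ℝ (fderiv ℝ f) y :=
    ((hf.fderiv_right (m := ∞) (by simp)).differentiable (by simp)) y
  have h1 : ∀ i j, vecDeriv i (vecDeriv j f) y = fderiv ℝ (fderiv ℝ f) y (basis2 i) (basis2 j) := by
    intro i j
    rw [vecDeriv]
    have : vecDeriv j f = fun z => fderiv ℝ f z (basis2 j) := rfl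
    rw [this, fderiv_clm_apply hd (differentiableAt_const _)]
    simp
  rw [h1, h1, hs]

lemma coordDeriv_inner {f g : E2 → E3} (hf : ContDiff ℝ ∞ f) (hg : ContDiff ℝ ∞ g) (i : Fin 2)
    (y : E2) : coordDeriv (𝓡 2) basis2 i (fun z => inner ℝ (f z) (g z)) y
      = inner ℝ (vecDeriv i f y) (g y) + inner ℝ (f y) (vecDeriv i g y) := by
  rw [coordDeriv_E2, fderiv_inner_apply ℝ (hf.differentiable (by simp) y)
    (hg.differentiable (by simp) y), add_comm]
  rfl

variable {X : E2 → E3} {c : ℝ}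

/-- The first fundamental form of a parametrized surface. -/
def firstForm (X : E2 → E3) (y : E2) : Matrix (Fin 2) (Fin 2) ℝ :=
  Matrix.of fun i j => inner ℝ (vecDeriv i X y) (vecDeriv j X y)

lemma firstForm_symm (y : E2) (i j : Fin 2) : firstForm X y i j = firstForm X y j i := by
  simp only [firstForm, Matrix.of_apply, real_inner_comm]

/-- The Christoffel symbols are the tangential components of the second derivatives. -/
lemma matChristoffel_firstForm (hX : ContDiff ℝ ∞ X) (k i j : Fin 2) (y : E2) :
    matChristoffel (𝓡 2) basis2 (firstForm X) k i j y
      = ∑ l, (firstForm X y)⁻¹ k l * inner ℝ (vecDeriv i (vecDeriv j X) y) (vecDeriv l X y) := by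
  rw [matChristoffel, Finset.mul_sum]
  refine Finset.sum_congr rfl fun l _ => ?_
  have hd := fun a => contDiff_vecDeriv hX a
  simp only [firstForm, Matrix.of_apply, coordDeriv_inner (hd _) (hd _)]
  rw [vecDeriv_comm hX j i, vecDeriv_comm hX l i, vecDeriv_comm hX l j,
    real_inner_comm (vecDeriv i (vecDeriv l X) y) (vecDeriv j X y)]
  ring

lemma contDiff_firstForm (hX : ContDiff ℝ ∞ X) (i j : Fin 2) : ContDiff ℝ ∞ fun y => firstForm X y i j :=
  (contDiff_vecDeriv hX i).inner ℝ (contDiff_vecDeriv hX j)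

lemma contDiff_chr_firstForm (hX : ContDiff ℝ ∞ X)
    (hdet : ∀ y, (firstForm X y).det ≠ 0) (k i j : Fin 2) :
    ContDiff ℝ ∞ (matChristoffel (𝓡 2) basis2 (firstForm X) k i j) := by
  have h1 : matChristoffel (𝓡 2) basis2 (firstForm X) k i j = fun y =>
      ∑ l, (firstForm X y)⁻¹ k l * inner ℝ (vecDeriv i (vecDeriv j X) y) (vecDeriv l X y) :=
    funext fun y => matChristoffel_firstForm hX k i j y
  rw [h1]
  refine ContDiff.sum fun l _ => ContDiff.mul ?_
    ((contDiff_vecDeriv (contDiff_vecDeriv hX j) i).inner ℝ (contDiff_vecDeriv hX l))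
  rw [← contDiffOn_univ]
  exact contDiffOn_matrix_inv (fun i j => (contDiff_firstForm hX i j).contDiffOn)
    (fun z _ => hdet z) k l

section Sphere

variable (hX : ContDiff ℝ ∞ X) (hnorm : ∀ y, inner ℝ (X y) (X y) = c ^ 2)
  (hdet : ∀ y, (firstForm X y).det ≠ 0) (hc : c ≠ 0)
include hX hnorm

lemma inner_vecDeriv_self (i : Fin 2) (y : E2) : inner ℝ (vecDeriv i X y) (X y) = (0 : ℝ) := by
  have h := coordDeriv_inner hX hX i y
  simp only [hnorm, coordDeriv_const] at h
  rw [real_inner_comm (vecDeriv i X y) (X y)] at h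
  linarith

lemma inner_vecDeriv_vecDeriv_self (i j : Fin 2) (y : E2) :
    inner ℝ (vecDeriv i (vecDeriv j X) y) (X y) = - firstForm X y i j := by
  have h := coordDeriv_inner (contDiff_vecDeriv hX j) hX i y
  simp only [inner_vecDeriv_self hX hnorm, coordDeriv_const] at h
  rw [real_inner_comm (vecDeriv i X y) (vecDeriv j X y)] at h
  rw [firstForm, Matrix.of_apply]
  linarith

include hdet

/-- Tangential components of vectors are well defined. -/
lemma tangent_frame_unique {y : E2} {a b : Fin 2 → ℝ} {r s : ℝ}
    (h : ∑ l, a l • vecDeriv l X y + r • X y = ∑ l, b l • vecDeriv l X y + s • X y) (l : Fin 2) :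
    a l = b l := by
  have h0 : ∀ m, ∑ l, (a l - b l) * firstForm X y l m = 0 := by
    intro m
    have := congrArg (fun v => inner ℝ v (vecDeriv m X y)) h
    simp only [inner_add_left, sum_inner, real_inner_smul_left,
      real_inner_comm (vecDeriv m X y) (X y), inner_vecDeriv_self hX hnorm] at this
    simp only [firstForm, Matrix.of_apply, sub_mul, Finset.sum_sub_distrib]
    linarith
  have h1 : Matrix.vecMul (a - b) (firstForm X y) = 0 := by
    funext m
    exact h0 m
  have := Matrix.eq_zero_of_vecMul_eq_zero (hdet y) h1
  exact sub_eq_zero.1 (congrFun this l)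

include hc

/-- The partial derivatives together with the position vector span `ℝ³`. -/
lemma eq_zero_of_inner_frame {y : E2} {v : E3} (hv : ∀ l, inner ℝ (vecDeriv l X y) v = (0 : ℝ))
    (hv' : inner ℝ (X y) v = (0 : ℝ)) : v = 0 := by
  have hli : LinearIndependent ℝ ![vecDeriv 0 X y, vecDeriv 1 X y, X y] := by
    rw [Fintype.linearIndependent_iff]
    intro r hr
    simp only [Fin.sum_univ_three, Matrix.cons_val_zero, Matrix.cons_val_one,
      Matrix.cons_val] at hr
    have h0 := tangent_frame_unique hX hnorm hdet (y := y) (a := ![r 0, r 1]) (b := 0)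
      (r := r 2) (s := 0) (by simpa [Fin.sum_univ_two] using hr)
    have e0 : r 0 = 0 := by simpa using h0 0
    have e1 : r 1 = 0 := by simpa using h0 1
    have e2 : r 2 = 0 := by
      rw [e0, e1] at hr
      have := congrArg (fun w => inner ℝ w (X y)) hr
      have hne : X y ≠ 0 := fun h => pow_ne_zero 2 hc (by rw [← hnorm y, h, inner_zero_left])
      simpa [real_inner_smul_left, hnorm, hc, inner_add_left, hne] using this
    intro i
    fin_cases i <;> assumption
  have hspan := hli.span_eq_top_of_card_eq_finrank (by simp)
  have hmem : v ∈ Submodule.span ℝ (range ![vecDeriv 0 X y, vecDeriv 1 X y, X y]) := by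
    rw [hspan]; trivial
  have hall : ∀ w ∈ Submodule.span ℝ (range ![vecDeriv 0 X y, vecDeriv 1 X y, X y]),
      inner ℝ w v = (0 : ℝ) := by
    intro w hw
    induction hw using Submodule.span_induction with
    | mem x hx =>
      obtain ⟨i, rfl⟩ := hx
      fin_cases i
      · exact hv 0
      · exact hv 1
      · exact hv'
    | zero => simp
    | add x z _ _ hx hz => rw [inner_add_left, hx, hz, add_zero]
    | smul a x _ hx => rw [real_inner_smul_left, hx, mul_zero]
  exact inner_self_eq_zero.1 (hall v hmem)

/-- The Gauss formula for a surface in a sphere of radius `c` about the origin. -/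
lemma gauss_formula (i j : Fin 2) (y : E2) :
    vecDeriv i (vecDeriv j X) y
      = ∑ k, matChristoffel (𝓡 2) basis2 (firstForm X) k i j y • vecDeriv k X y
        + (-(c ^ 2)⁻¹ * firstForm X y i j) • X y := by
  rw [← sub_eq_zero]
  refine eq_zero_of_inner_frame hX hnorm hdet hc (y := y) (fun m => ?_) ?_
  · rw [inner_sub_right, inner_add_right, inner_sum, real_inner_smul_right,
      inner_vecDeriv_self hX hnorm, mul_zero, add_zero, sub_eq_zero]
    simp only [real_inner_smul_right, matChristoffel_firstForm hX]
    have h1 := Matrix.nonsing_inv_mul (firstForm X y) (hdet y).isUnit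
    have h2 : ∀ l, ∑ k, (firstForm X y)⁻¹ k l * inner ℝ (vecDeriv m X y) (vecDeriv k X y)
        = (1 : Matrix (Fin 2) (Fin 2) ℝ) m l := by
      intro l
      rw [← Matrix.mul_nonsing_inv (firstForm X y) (hdet y).isUnit, Matrix.mul_apply]
      exact Finset.sum_congr rfl fun k _ => mul_comm _ _
    calc inner ℝ (vecDeriv m X y) (vecDeriv i (vecDeriv j X) y)
        = ∑ l, (1 : Matrix (Fin 2) (Fin 2) ℝ) m l
            * inner ℝ (vecDeriv i (vecDeriv j X) y) (vecDeriv l X y) := by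
          simp [Matrix.one_apply, real_inner_comm]
      _ = _ := by
          simp only [← h2, Finset.sum_mul]
          rw [Finset.sum_comm]
          exact Finset.sum_congr rfl fun l _ => Finset.sum_congr rfl fun k _ => by ring
  · rw [inner_sub_right, inner_add_right, inner_sum, real_inner_smul_right, hnorm,
      real_inner_comm, inner_vecDeriv_vecDeriv_self hX hnorm]
    simp only [real_inner_smul_right, real_inner_comm (vecDeriv _ X y) (X y),
      inner_vecDeriv_self hX hnorm, mul_zero, Finset.sum_const_zero]
    field_simp
    ring

/-- Third derivatives in the moving frame, obtained by differentiating the Gauss formula. -/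
lemma third_deriv (m i j : Fin 2) (y : E2) :
    vecDeriv m (vecDeriv i (vecDeriv j X)) y
      = ∑ l, (coordDeriv (𝓡 2) basis2 m (matChristoffel (𝓡 2) basis2 (firstForm X) l i j) y
          + ∑ k, matChristoffel (𝓡 2) basis2 (firstForm X) k i j y
            * matChristoffel (𝓡 2) basis2 (firstForm X) l m k y
          - (c ^ 2)⁻¹ * firstForm X y i j * (1 : Matrix (Fin 2) (Fin 2) ℝ) m l) • vecDeriv l X y
        + (∑ k, matChristoffel (𝓡 2) basis2 (firstForm X) k i j y
              * (-(c ^ 2)⁻¹ * firstForm X y m k)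
          + coordDeriv (𝓡 2) basis2 m (fun z => -(c ^ 2)⁻¹ * firstForm X z i j) y) • X y := by
  have h1 : vecDeriv i (vecDeriv j X) = fun y =>
      ∑ k, matChristoffel (𝓡 2) basis2 (firstForm X) k i j y • vecDeriv k X y
        + (-(c ^ 2)⁻¹ * firstForm X y i j) • X y :=
    funext fun y => gauss_formula hX hnorm hdet hc i j y
  have d1 : ∀ k, DifferentiableAt ℝ (matChristoffel (𝓡 2) basis2 (firstForm X) k i j) y :=
    fun k => (contDiff_chr_firstForm hX hdet k i j).differentiable (by simp) y
  have d2 : ∀ k, DifferentiableAt ℝ (vecDeriv k X) y :=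
    fun k => (contDiff_vecDeriv hX k).differentiable (by simp) y
  have d3 : DifferentiableAt ℝ (fun y => -(c ^ 2)⁻¹ * firstForm X y i j) y :=
    ((contDiff_firstForm hX i j).differentiable (by simp) y).const_mul _
  have d4 : DifferentiableAt ℝ X y := hX.differentiable (by simp) y
  rw [h1, vecDeriv, fderiv_fun_add (DifferentiableAt.fun_sum fun k _ => (d1 k).fun_smul (d2 k))
    (d3.fun_smul d4), fderiv_fun_sum (fun k _ => (d1 k).fun_smul (d2 k)), fderiv_fun_smul d3 d4]
  simp only [fderiv_fun_smul (d1 _) (d2 _), add_apply, sum_apply, smul_apply,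
    ContinuousLinearMap.smulRight_apply]
  have h2 : ∀ k, fderiv ℝ (vecDeriv k X) y (basis2 m) = _ :=
    fun k => gauss_formula hX hnorm hdet hc m k y
  simp only [h2, coordDeriv_E2, show fderiv ℝ X y (basis2 m) = vecDeriv m X y from rfl,
    Fin.sum_univ_two]
  obtain rfl | rfl : m = 0 ∨ m = 1 := by omega
  · simp
    module
  · simp
    module

/-- A surface in a sphere of radius `c` has scalar curvature `2 / c²`: the symmetry of the third
derivatives gives the Gauss equation. -/
theorem matScalar_firstForm (y : E2) :
    matScalar (𝓡 2) basis2 (firstForm X) y = 2 / c ^ 2 := by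
  -- In dimension two the Gauss equation makes the metric Einstein.
  have hric : ∀ i j, matRicci (𝓡 2) basis2 (firstForm X) i j y
      = (c ^ 2)⁻¹ * firstForm X y i j := by
    intro i j
    have key : ∀ m, _ := fun m => tangent_frame_unique hX hnorm hdet
      ((third_deriv hX hnorm hdet hc m i j y).symm.trans
        ((show vecDeriv m (vecDeriv i (vecDeriv j X)) y = vecDeriv j (vecDeriv i (vecDeriv m X)) y
          by rw [vecDeriv_comm hX i j, vecDeriv_comm (contDiff_vecDeriv hX i) m j,
            vecDeriv_comm hX m i]).trans (third_deriv hX hnorm hdet hc j i m y))) m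
    have k0 := key 0
    have k1 := key 1
    simp only [matRicci, Fin.sum_univ_two] at k0 k1 ⊢
    fin_cases j <;> simp at k0 k1 ⊢ <;> linarith
  simp only [matScalar, hric]
  have h1 := Matrix.nonsing_inv_mul (firstForm X y) (hdet y).isUnit
  have h2 := congrFun (congrFun h1 0) 0
  have h3 := congrFun (congrFun h1 1) 1
  simp only [Matrix.mul_apply, Fin.sum_univ_two, Matrix.one_apply_eq] at h2 h3 ⊢
  rw [firstForm_symm y 1 0] at *
  field_simp
  linarith

end Sphere
end GaussFormula

/-! ### Round metrics on the sphere -/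

section Round

lemma fact_finrank_E3 : Fact (finrank ℝ E3 = 2 + 1) := ⟨finrank_euclideanSpace_fin⟩

lemma inner_smul_smul_sq (c : ℝ) (a b : E3) :
    inner ℝ (c • a) (c • b) = c ^ 2 * (inner ℝ a b : ℝ) := by
  rw [real_inner_smul_left, real_inner_smul_right, ← mul_assoc, ← sq]

lemma extChartAt_S2_target (p : S2) : (extChartAt (𝓡 2) p).target = univ := by
  rw [extChartAt_target]
  simp only [modelWithCornersSelf_coe_symm, modelWithCornersSelf_coe, range_id, inter_univ,
    preimage_id]
  have := fact_finrank_E3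
  exact stereographic'_target (-p)

lemma mem_range_S2 (y : E2) : y ∈ range (𝓡 2) := by simp

/-- The inverse stereographic chart centred at `p`. -/
def chartInv (p : S2) (y : E2) : S2 := (extChartAt (𝓡 2) p).symm y

lemma contMDiff_chartInv (p : S2) : ContMDiff 𝓘(ℝ, E2) (𝓡 2) ∞ (chartInv p) := by
  have := contMDiffOn_extChartAt_symm (I := 𝓡 2) (n := ∞) p
  rw [extChartAt_S2_target, contMDiffOn_univ] at this
  exact this

lemma contMDiff_coe_S2 : ContMDiff (𝓡 2) 𝓘(ℝ, E3) ∞ (fun q : S2 => (q : E3)) := by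
  have := fact_finrank_E3
  exact contMDiff_coe_sphere

lemma coordMetric_posDef_S2 (g : SphereMetric) (p : S2) (y : E2) :
    (coordMetric g basis2 p y).PosDef :=
  coordMetric_posDef g basis2 p (by rw [extChartAt_S2_target]; trivial)

/-- `φ` realizes `g` as the pull-back of the metric of the sphere of radius `c`. -/
def IsRoundVia (g : SphereMetric) (c : ℝ) (φ : S2 ≃ₘ^∞⟮𝓡 2, 𝓡 2⟯ S2) : Prop :=
  ∀ (x : S2) (v w : TangentSpace (𝓡 2) x),
    g.inner x v w = c ^ 2 * stdInner (φ x) (mfderiv (𝓡 2) (𝓡 2) φ x v) (mfderiv (𝓡 2) (𝓡 2) φ x w)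

/-- The parametrization of the sphere of radius `c` obtained from a diffeomorphism of the sphere
and a stereographic chart. -/
def roundParam (c : ℝ) (φ : S2 → S2) (p : S2) (y : E2) : E3 := c • (φ (chartInv p y) : E3)

lemma contDiff_roundParam (c : ℝ) {φ : S2 → S2} (hφ : ContMDiff (𝓡 2) (𝓡 2) ∞ φ) (p : S2) :
    ContDiff ℝ ∞ (roundParam c φ p) := by
  have h : ContMDiff 𝓘(ℝ, E2) 𝓘(ℝ, E3) ∞ (fun y => (φ (chartInv p y) : E3)) :=
    contMDiff_coe_S2.comp (hφ.comp (contMDiff_chartInv p))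
  exact h.contDiff.const_smul c

lemma inner_roundParam (c : ℝ) (φ : S2 → S2) (p : S2) (y : E2) :
    inner ℝ (roundParam c φ p y) (roundParam c φ p y) = c ^ 2 := by
  rw [real_inner_self_eq_norm_sq, roundParam, norm_smul, norm_eq_of_mem_sphere, mul_one,
    Real.norm_eq_abs, sq_abs]

lemma fderiv_roundParam (c : ℝ) {φ : S2 → S2} (hφ : ContMDiff (𝓡 2) (𝓡 2) ∞ φ) (p : S2) (y v : E2) :
    fderiv ℝ (roundParam c φ p) y v
      = c • (mfderiv (𝓡 2) 𝓘(ℝ, E3) (fun q : S2 => (q : E3)) (φ (chartInv p y))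
        (mfderiv (𝓡 2) (𝓡 2) φ (chartInv p y)
          (mfderiv 𝓘(ℝ, E2) (𝓡 2) (chartInv p) y v)) : E3) := by
  have d1 : MDifferentiableAt 𝓘(ℝ, E2) (𝓡 2) (chartInv p) y :=
    (contMDiff_chartInv p).mdifferentiableAt (by simp)
  have d2 : MDifferentiableAt (𝓡 2) (𝓡 2) φ (chartInv p y) := hφ.mdifferentiableAt (by simp)
  have d3 : MDifferentiableAt (𝓡 2) 𝓘(ℝ, E3) (fun q : S2 => (q : E3)) (φ (chartInv p y)) :=
    contMDiff_coe_S2.mdifferentiableAt (by simp)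
  have h := (d3.hasMFDerivAt.comp y (d2.hasMFDerivAt.comp y d1.hasMFDerivAt)).hasFDerivAt
  have h2 := (h.const_smul c).fderiv
  exact congrArg (fun L : E2 →L[ℝ] E3 => L v) h2

/-- In charts a round metric is the first fundamental form of `roundParam`. -/
lemma coordMetric_eq_firstForm {g : SphereMetric} {c : ℝ} {φ : S2 ≃ₘ^∞⟮𝓡 2, 𝓡 2⟯ S2}
    (h : IsRoundVia g c φ) (p : S2) :
    coordMetric g basis2 p = firstForm (roundParam c φ p) := by
  funext y
  ext i j
  have e : ∀ v : E2, mfderivWithin 𝓘(ℝ, E2) (𝓡 2) (extChartAt (𝓡 2) p).symm (range (𝓡 2)) y v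
      = mfderiv 𝓘(ℝ, E2) (𝓡 2) (chartInv p) y v := by
    intro v
    rw [show range (𝓡 2) = univ by simp, mfderivWithin_univ]
    rfl
  rw [coordMetric, Matrix.of_apply, e, e]
  refine (h _ _ _).trans ?_
  rw [firstForm, Matrix.of_apply, vecDeriv, vecDeriv, fderiv_roundParam c φ.contMDiff,
    fderiv_roundParam c φ.contMDiff]
  exact (inner_smul_smul_sq c _ _).symm

/-- A round metric of radius `c` has Gaussian curvature `1 / c²`. -/
lemma gaussCurvature_of_round {g : SphereMetric} {c : ℝ} (hc : 0 < c)
    {φ : S2 ≃ₘ^∞⟮𝓡 2, 𝓡 2⟯ S2} (h : IsRoundVia g c φ) (x : S2) :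
    gaussCurvature g x = 1 / c ^ 2 := by
  have hdet : ∀ y, (firstForm (roundParam c φ x) y).det ≠ 0 := fun y => by
    rw [← coordMetric_eq_firstForm h]
    exact (coordMetric_posDef_S2 g x y).det_pos.ne'
  rw [gaussCurvature, scalarCurvature_eq_matScalar, coordMetric_eq_firstForm h,
    matScalar_firstForm (contDiff_roundParam c φ.contMDiff x) (inner_roundParam c φ x) hdet hc.ne']
  ring

end Round

/-! ### The area of round metrics -/

section Area

/-- The inverse stereographic projection centred at `pole` in closed form; `L` identifies the plane
with the orthogonal complement of `pole`. -/
lemma exists_isometry_stereographic : ∃ L : E2 →L[ℝ] E3, (∀ a b, inner ℝ (L a) (L b) = (inner ℝ a b : ℝ)) ∧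
    (∀ a, inner ℝ (L a) (-pole : S2).1 = (0 : ℝ)) ∧
    ∀ w, (chartInv pole w : E3) = (-pole : S2).1
      + (‖w‖ ^ 2 + 4)⁻¹ • ((4 : ℝ) • L w - (8 : ℝ) • (-pole : S2).1) := by
  have := fact_finrank_E3
  set v : S2 := -pole with hv
  set U : (ℝ ∙ (v : E3))ᗮ ≃ₗᵢ[ℝ] EuclideanSpace ℝ (Fin 2) :=
    (OrthonormalBasis.fromOrthogonalSpanSingleton 2 (ne_zero_of_mem_unit_sphere v)).repr with hU
  refine ⟨((ℝ ∙ (v : E3))ᗮ).subtypeL.comp (U.symm.toContinuousLinearEquiv : E2 →L[ℝ] _),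
    fun a b => ?_, fun a => ?_, fun w => ?_⟩
  · exact U.symm.inner_map_map a b
  · have := (U.symm a).2
    rw [Submodule.mem_orthogonal_singleton_iff_inner_left] at this
    exact this
  · have h := stereographic'_symm_apply (n := 2) v w
    have hn : ‖((U.symm w : (ℝ ∙ (v : E3))ᗮ) : E3)‖ = ‖w‖ := U.symm.norm_map w
    simp only [← hU, hn] at h
    refine (show (chartInv pole w : E3) = _ from h).trans ?_
    have hne : ‖w‖ ^ 2 + 4 ≠ 0 := by positivity
    have e : (‖w‖ ^ 2 + 4)⁻¹ • (‖w‖ ^ 2 - 4) • (v : E3)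
        = (v : E3) - (‖w‖ ^ 2 + 4)⁻¹ • (8 : ℝ) • (v : E3) := by
      rw [smul_smul, smul_smul, ← one_smul ℝ (v : E3), smul_smul, smul_smul, ← sub_smul]
      congr 1
      field_simp
      ring
    rw [e, smul_sub, add_comm, sub_add_eq_add_sub, add_sub_assoc]
    rfl

/-- The stereographic chart is conformal to the plane. -/
lemma firstForm_stereographic (w : E2) :
    firstForm (roundParam 1 id pole) w = (16 / (‖w‖ ^ 2 + 4) ^ 2) • (1 : Matrix (Fin 2) (Fin 2) ℝ) := by
  obtain ⟨L, hL, hLv, hX⟩ := exists_isometry_stereographic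
  set v : E3 := (-pole : S2).1 with hv
  have hvv : inner ℝ v v = (1 : ℝ) := by
    rw [real_inner_self_eq_norm_sq, hv, norm_eq_of_mem_sphere]; norm_num
  have hX' : roundParam 1 id pole = fun w => v + (‖w‖ ^ 2 + 4)⁻¹ • ((4 : ℝ) • L w - (8 : ℝ) • v) := by
    funext w
    rw [roundParam, one_smul]
    exact hX w
  have hne : ‖w‖ ^ 2 + 4 ≠ 0 := by positivity
  have hd : ∀ b : E2, fderiv ℝ (roundParam 1 id pole) w b
      = (-(2 * inner ℝ w b) / (‖w‖ ^ 2 + 4) ^ 2) • ((4 : ℝ) • L w - (8 : ℝ) • v)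
        + (‖w‖ ^ 2 + 4)⁻¹ • (4 : ℝ) • L b := by
    intro b
    have h1 : HasFDerivAt (fun w : E2 => ‖w‖ ^ 2 + 4) (2 • innerSL ℝ w) w :=
      (hasStrictFDerivAt_norm_sq w).hasFDerivAt.add_const 4
    have h2 : HasFDerivAt (fun w : E2 => (‖w‖ ^ 2 + 4)⁻¹) _ w :=
      (hasDerivAt_inv hne).comp_hasFDerivAt w h1
    have h3 : HasFDerivAt (fun w : E2 => (4 : ℝ) • L w - (8 : ℝ) • v) ((4 : ℝ) • L) w :=
      (L.hasFDerivAt.const_smul (4 : ℝ)).sub_const _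
    have h4 := ((h2.smul h3).const_add v).fderiv
    rw [hX']
    refine (congrArg (fun T : E2 →L[ℝ] E3 => T b) h4).trans ?_
    simp
    rw [div_eq_mul_inv]
    module
  ext i j
  rw [firstForm, Matrix.of_apply, vecDeriv, vecDeriv, hd, hd]
  have hLv' : ∀ a, inner ℝ v (L a) = (0 : ℝ) := fun a => by rw [real_inner_comm, hLv]
  simp only [inner_add_left, inner_add_right, real_inner_smul_left, real_inner_smul_right,
    inner_sub_left, inner_sub_right, hL, hLv, hLv', hvv]
  have hb : inner ℝ (basis2 i) (basis2 j) = ((1 : Matrix (Fin 2) (Fin 2) ℝ) i j : ℝ) := by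
    simp [basis2, Matrix.one_apply, EuclideanSpace.inner_single_left]
  rw [hb, real_inner_self_eq_norm_sq, Matrix.smul_apply, smul_eq_mul,
    real_inner_comm w (basis2 i)]
  generalize inner ℝ w (basis2 i) = p
  generalize inner ℝ w (basis2 j) = q
  generalize (1 : Matrix (Fin 2) (Fin 2) ℝ) i j = d
  field_simp
  ring

/-- The area of the unit sphere in the stereographic chart. -/
lemma integral_stereographic : ∫ w : E2, 16 / (‖w‖ ^ 2 + 4) ^ 2 = 4 * Real.pi := by
  have h := MeasureTheory.integral_fun_norm_addHaar (volume : Measure E2)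
    (fun r : ℝ => 16 / (r ^ 2 + 4) ^ 2)
  rw [h]
  have hint : ∫ y in Ioi (0 : ℝ), y ^ (finrank ℝ E2 - 1) • (16 / (y ^ 2 + 4) ^ 2) = 2 := by
    have hd : ∀ x ∈ Ici (0 : ℝ), HasDerivAt (fun y : ℝ => -8 / (y ^ 2 + 4))
        (x ^ (finrank ℝ E2 - 1) • (16 / (x ^ 2 + 4) ^ 2)) x := by
      intro x _
      have hne : x ^ 2 + 4 ≠ 0 := by positivity
      have := (((hasDerivAt_id x).pow 2).add_const 4).fun_inv hne |>.const_mul (-8)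
      convert! this using 1
      simp
      field_simp
      ring
    rw [integral_Ioi_of_hasDerivAt_of_nonneg' (l := 0) hd]
    · norm_num
    · intro x hx
      have : 0 < x := hx
      positivity
    · have h1 : Filter.Tendsto (fun y : ℝ => y ^ 2 + 4) Filter.atTop Filter.atTop :=
        Filter.tendsto_atTop_add_const_right _ _ (Filter.tendsto_pow_atTop (by norm_num))
      exact h1.const_div_atTop (-8)
  rw [hint]
  have hvol : (volume : Measure E2).real (Metric.ball 0 1) = Real.pi := by
    rw [Measure.real, EuclideanSpace.volume_ball_fin_two]
    simp [Real.pi_pos.le]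
  rw [hvol]
  simp
  ring

lemma surfaceIntegral_const (g : SphereMetric) (c : ℝ) :
    surfaceIntegral g (fun _ => c) = c * area g := by
  rw [area, surfaceIntegral, surfaceIntegral, ← integral_const_mul]
  simp

section ChangeOfVariables

variable (φ : S2 ≃ₘ^∞⟮𝓡 2, 𝓡 2⟯ S2)

/-- A diffeomorphism of the sphere, read in the stereographic chart centred at the pole. -/
def chartTransition (y : E2) : E2 := extChartAt (𝓡 2) pole (φ (chartInv pole y))

/-- The set on which `chartTransition φ` is the coordinate expression of `φ`. -/
def transitionDomain : Set E2 := {y | φ (chartInv pole y) ≠ -pole}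

lemma mem_source_pole {q : S2} (hq : q ≠ -pole) : q ∈ (extChartAt (𝓡 2) pole).source := by
  have := fact_finrank_E3
  rw [extChartAt_source]
  have h : (chartAt (EuclideanSpace ℝ (Fin 2)) pole).source = {-pole}ᶜ :=
    stereographic'_source (n := 2) (-pole)
  rw [h]
  exact hq

lemma chartInv_ne (y : E2) : chartInv pole y ≠ -pole := by
  have := fact_finrank_E3
  have h1 : chartInv pole y ∈ (extChartAt (𝓡 2) pole).source :=
    (extChartAt (𝓡 2) pole).map_target (by rw [extChartAt_S2_target]; trivial)
  rw [extChartAt_source] at h1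
  have h : (chartAt (EuclideanSpace ℝ (Fin 2)) pole).source = {-pole}ᶜ :=
    stereographic'_source (n := 2) (-pole)
  rw [h] at h1
  exact h1

lemma chart_chartInv (y : E2) : extChartAt (𝓡 2) pole (chartInv pole y) = y :=
  (extChartAt (𝓡 2) pole).right_inv (by rw [extChartAt_S2_target]; trivial)

lemma chartInv_injective : Function.Injective (chartInv pole) :=
  Function.LeftInverse.injective chart_chartInv

lemma chartInv_chart {q : S2} (hq : q ≠ -pole) : chartInv pole (extChartAt (𝓡 2) pole q) = q :=
  (extChartAt (𝓡 2) pole).left_inv (mem_source_pole hq)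

lemma chartInv_transition {y : E2} (hy : y ∈ transitionDomain φ) :
    chartInv pole (chartTransition φ y) = φ (chartInv pole y) := chartInv_chart hy

lemma isOpen_transitionDomain : IsOpen (transitionDomain φ) :=
  isOpen_ne_fun (φ.continuous.comp (contMDiff_chartInv pole).continuous) continuous_const

lemma contDiffAt_transition {y : E2} (hy : y ∈ transitionDomain φ) :
    ContDiffAt ℝ ∞ (chartTransition φ) y := by
  rw [← contMDiffAt_iff_contDiffAt]
  have h1 : ContMDiffAt (𝓡 2) 𝓘(ℝ, E2) ∞ (extChartAt (𝓡 2) pole) (φ (chartInv pole y)) :=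
    contMDiffAt_extChartAt' (by simpa using mem_source_pole hy)
  exact h1.comp y (φ.contMDiff.comp (contMDiff_chartInv pole)).contMDiffAt

lemma injOn_transition : InjOn (chartTransition φ) (transitionDomain φ) := by
  intro y hy z hz h
  have := congrArg (chartInv pole) h
  rw [chartInv_transition φ hy, chartInv_transition φ hz] at this
  exact chartInv_injective (φ.injective this)

lemma ae_eq_univ_of_subsingleton {s : Set E2} (hs : sᶜ.Subsingleton) :
    s =ᵐ[volume] (univ : Set E2) := by
  rw [ae_eq_univ]
  exact hs.measure_zero _

/-- At most one point of the plane is sent by `φ` outside the chart. -/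
lemma transitionDomain_ae : transitionDomain φ =ᵐ[volume] (univ : Set E2) := by
  refine ae_eq_univ_of_subsingleton fun y hy z hz => ?_
  simp only [transitionDomain, mem_compl_iff, mem_ofPred_eq, not_not] at hy hz
  exact chartInv_injective (φ.injective (hy.trans hz.symm))

lemma image_transition_ae :
    chartTransition φ '' transitionDomain φ =ᵐ[volume] (univ : Set E2) := by
  refine ae_eq_univ_of_subsingleton fun y hy z hz => ?_
  have key : ∀ y, y ∉ chartTransition φ '' transitionDomain φ →
      φ.symm (chartInv pole y) = -pole := by
    intro y hy
    by_contra hne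
    refine hy ⟨extChartAt (𝓡 2) pole (φ.symm (chartInv pole y)), ?_, ?_⟩
    · rw [transitionDomain, mem_ofPred_eq, chartInv_chart hne, φ.apply_symm_apply]
      exact chartInv_ne y
    · rw [chartTransition, chartInv_chart hne, φ.apply_symm_apply, chart_chartInv]
  exact chartInv_injective (φ.symm.injective ((key y hy).trans (key z hz).symm))

/-- Change of variables for the first fundamental form. -/
lemma det_firstForm_transition (c : ℝ) {y : E2} (hy : y ∈ transitionDomain φ) :
    (firstForm (roundParam c φ pole) y).det
      = (c ^ 2 * |(fderiv ℝ (chartTransition φ) y).det|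
        * (16 / (‖chartTransition φ y‖ ^ 2 + 4) ^ 2)) ^ 2 := by
  set T := fderiv ℝ (chartTransition φ) y with hT
  have hev : roundParam c φ pole =ᶠ[nhds y] fun z => c • roundParam 1 id pole (chartTransition φ z) := by
    filter_upwards [(isOpen_transitionDomain φ).mem_nhds hy] with z hz
    rw [roundParam, roundParam, one_smul, id, chartInv_transition φ hz]
  have dX : DifferentiableAt ℝ (roundParam 1 id pole) (chartTransition φ y) :=
    (contDiff_roundParam 1 contMDiff_id pole).differentiable (by simp) _
  have dT : DifferentiableAt ℝ (chartTransition φ) y :=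
    (contDiffAt_transition φ hy).differentiableAt (by simp)
  set A := LinearMap.toMatrix basis2 basis2 (T : E2 →ₗ[ℝ] E2) with hA
  have hv : ∀ i, vecDeriv i (roundParam c φ pole) y
      = c • ∑ k, A k i • vecDeriv k (roundParam 1 id pole) (chartTransition φ y) := by
    intro i
    have dXT : DifferentiableAt ℝ (fun z => roundParam 1 id pole (chartTransition φ z)) y :=
      dX.comp y dT
    rw [vecDeriv, hev.fderiv_eq, fderiv_fun_const_smul dXT]
    have h2 : fderiv ℝ (fun z => roundParam 1 id pole (chartTransition φ z)) y
        = (fderiv ℝ (roundParam 1 id pole) (chartTransition φ y)).comp T :=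
      fderiv_comp y dX dT
    rw [h2]
    have h3 : T (basis2 i) = ∑ k, A k i • basis2 k := by
      rw [hA, ← basis2.sum_repr (T (basis2 i))]
      simp [LinearMap.toMatrix_apply]
    simp only [smul_apply, ContinuousLinearMap.comp_apply, h3, map_sum, map_smul, vecDeriv]
  have hform : firstForm (roundParam c φ pole) y
      = c ^ 2 • (A.transpose * firstForm (roundParam 1 id pole) (chartTransition φ y) * A) := by
    ext i j
    rw [firstForm, Matrix.of_apply, hv, hv, inner_smul_smul_sq, Matrix.smul_apply, smul_eq_mul]
    congr 1
    simp only [sum_inner, inner_sum, real_inner_smul_left, real_inner_smul_right, Matrix.mul_apply,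
      Matrix.transpose_apply, firstForm, Matrix.of_apply, Finset.sum_mul]
    exact Finset.sum_congr rfl fun k _ => Finset.sum_congr rfl fun l _ => by ring
  have hdet : T.det = A.det := by
    rw [hA, LinearMap.det_toMatrix]
  rw [hform, firstForm_stereographic, Matrix.det_smul, Matrix.det_mul, Matrix.det_mul,
    Matrix.det_transpose, Matrix.det_smul, Matrix.det_one, hdet, mul_pow, mul_pow, sq_abs]
  simp only [Fintype.card_fin]
  ring

/-- A round metric of radius `c` has area `4 π c²`. -/
lemma area_of_round {g : SphereMetric} {c : ℝ} {φ : S2 ≃ₘ^∞⟮𝓡 2, 𝓡 2⟯ S2}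
    (h : IsRoundVia g c φ) : area g = 4 * Real.pi * c ^ 2 := by
  have hU := (isOpen_transitionDomain φ).measurableSet
  have h1 : area g = ∫ y in transitionDomain φ,
      c ^ 2 * (|(fderiv ℝ (chartTransition φ) y).det| •
        (16 / (‖chartTransition φ y‖ ^ 2 + 4) ^ 2)) := by
    rw [area, surfaceIntegral, ← setIntegral_univ, ← setIntegral_congr_set (transitionDomain_ae φ)]
    refine setIntegral_congr_fun hU fun y hy => ?_
    simp only [coordMetric_eq_firstForm h, det_firstForm_transition φ c hy]
    rw [Real.sqrt_sq (by positivity), one_mul, smul_eq_mul, mul_assoc]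
  rw [h1, integral_const_mul, ← integral_image_eq_integral_abs_det_fderiv_smul volume hU
    (fun y hy => ((contDiffAt_transition φ hy).differentiableAt
      (by simp)).hasFDerivAt.hasFDerivWithinAt) (injOn_transition φ)
    (fun w => 16 / (‖w‖ ^ 2 + 4) ^ 2), setIntegral_congr_set (image_transition_ae φ),
    setIntegral_univ, integral_stereographic]
  ring

end ChangeOfVariables
end Area

/-! ### Paths of metrics -/

section Paths

lemma gram_eq_coordMetric (g : SphereMetric) (x : S2) :
    gram g x = coordMetric g basis2 x (extChartAt (𝓡 2) x x) := by
  ext i j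
  rw [coordMetric_self]
  rfl

lemma gram_posDef (g : SphereMetric) (x : S2) : (gram g x).PosDef := by
  rw [gram_eq_coordMetric]
  exact coordMetric_posDef_S2 g x _

lemma gram_symm (g : SphereMetric) (x : S2) (i j : Fin 2) : gram g x i j = gram g x j i :=
  g.symm _ _ _

lemma bilin_eq_sum (B : E2 →L[ℝ] E2 →L[ℝ] ℝ) (v w : E2) :
    B v w = ∑ k, ∑ l, basis2.repr v k * B (basis2 k) (basis2 l) * basis2.repr w l := by
  conv_lhs => rw [← basis2.sum_repr v, ← basis2.sum_repr w]
  simp only [map_sum, map_smul, sum_apply, smul_apply, smul_eq_mul, Finset.mul_sum]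
  rw [Finset.sum_comm]
  exact Finset.sum_congr rfl fun k _ => Finset.sum_congr rfl fun l _ => by ring

/-- The Gram matrices of a metric in two frames differ by a congruence which does not depend on the
metric. -/
lemma exists_coordMetric_eq_congr (p : S2) (y : E2) : ∃ A : Matrix (Fin 2) (Fin 2) ℝ,
    ∀ g : SphereMetric, coordMetric g basis2 p y = A.transpose * gram g (chartInv p y) * A := by
  have hy : y ∈ (extChartAt (𝓡 2) p).target := by rw [extChartAt_S2_target]; trivial
  refine ⟨Matrix.of fun k i => basis2.repr (chartFrame (𝓡 2) p (basis2 i) (chartInv p y)) k,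
    fun g => ?_⟩
  ext i j
  rw [coordMetric_apply g basis2 p hy]
  refine (bilin_eq_sum (g.inner (chartInv p y)) _ _).trans ?_
  simp only [Matrix.mul_apply, Matrix.transpose_apply, Matrix.of_apply, Finset.sum_mul]
  rw [Finset.sum_comm]
  rfl

variable {path : ℝ → SphereMetric}

lemma IsSmoothPath.contDiffOn_gram (h : IsSmoothPath path) (x : S2) (i j : Fin 2) :
    ContDiffOn ℝ ∞ (fun t => gram (path t) x i j) (Icc 0 1) := by
  rw [← contMDiffOn_iff_contDiffOn]
  intro t ht
  have h1 : ContMDiffWithinAt 𝓘(ℝ, ℝ) ((𝓡 2).prod 𝓘(ℝ, E2 →L[ℝ] E2 →L[ℝ] ℝ)) ∞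
      (fun t : ℝ => Bundle.TotalSpace.mk' (E2 →L[ℝ] E2 →L[ℝ] ℝ)
        (E := fun x : S2 => TangentSpace (𝓡 2) x →L[ℝ] TangentSpace (𝓡 2) x →L[ℝ] ℝ)
        x ((path t).inner x)) (Icc 0 1) t := by
    have h2 : ContMDiff 𝓘(ℝ, ℝ) (𝓘(ℝ, ℝ).prod (𝓡 2)) ∞ (fun t : ℝ => (t, x)) :=
      contMDiff_id.prodMk contMDiff_const
    have h3 : ContMDiffOn _ _ ∞ _ (Icc (0 : ℝ) 1 ×ˢ (univ : Set S2)) := h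
    exact h3.comp h2.contMDiffOn (s := Icc 0 1) (fun s hs => ⟨hs, trivial⟩) t ht
  have h3 := contMDiffWithinAt_bilin_chartFrame h1 (f := fun _ => x) (B := fun t => (path t).inner x)
    (mem_chart_source _ x) (basis2 i) (basis2 j)
  simp only [chartFrame_self] at h3
  exact h3

lemma IsSmoothPath.hasDerivWithinAt_gram (h : IsSmoothPath path) (x : S2) (i j : Fin 2) {t : ℝ}
    (ht : t ∈ Icc (0 : ℝ) 1) :
    HasDerivWithinAt (fun t => gram (path t) x i j) (gramDeriv path t x i j) (Icc 0 1) t :=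
  (((h.contDiffOn_gram x i j).differentiableOn (by simp)) t ht).hasDerivWithinAt

lemma gramDeriv_symm (x : S2) (t : ℝ) (i j : Fin 2) :
    gramDeriv path t x i j = gramDeriv path t x j i := by
  simp only [gramDeriv, Matrix.of_apply, gram_symm _ x i j]

lemma trace_inv_mul {G S : Matrix (Fin 2) (Fin 2) ℝ} :
    (G⁻¹ * S).trace = (G.det)⁻¹ * (G 1 1 * S 0 0 - G 0 1 * S 1 0 - G 1 0 * S 0 1 + G 0 0 * S 1 1) := by
  rw [Matrix.inv_def, Ring.inverse_eq_inv', Matrix.adjugate_fin_two, Matrix.trace_fin_two]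
  simp [Matrix.mul_apply, Fin.sum_univ_two]
  ring

/-- The area element is constant along a path with `tr g' = 0`. -/
lemma det_gram_eq (h : IsSmoothPath path) {x : S2}
    (htr : ∀ t ∈ Icc (0 : ℝ) 1, traceDeriv path t x = 0) {t : ℝ} (ht : t ∈ Icc (0 : ℝ) 1) :
    (gram (path t) x).det = (gram (path 0) x).det := by
  have hd : ∀ t ∈ Icc (0 : ℝ) 1,
      HasDerivWithinAt (fun t => (gram (path t) x).det) 0 (Icc 0 1) t := by
    intro t ht
    have H := fun i j => h.hasDerivWithinAt_gram x i j ht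
    simp only [Matrix.det_fin_two]
    have h1 := ((H 0 0).mul (H 1 1)).sub ((H 0 1).mul (H 1 0))
    convert! h1 using 1
    have h2 := htr t ht
    rw [traceDeriv, trace_inv_mul] at h2
    have h3 := (mul_eq_zero.1 h2).resolve_left (inv_ne_zero (gram_posDef (path t) x).det_pos.ne')
    linarith
  exact constant_of_derivWithin_zero (fun t ht => (hd t ht).differentiableWithinAt)
    (fun t ht => (hd t ⟨ht.1, ht.2.le⟩).derivWithin (uniqueDiffOn_Icc zero_lt_one t ⟨ht.1, ht.2.le⟩))
    t ht

lemma area_eq_of_path (h : IsSmoothPath path)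
    (htr : ∀ t ∈ Icc (0 : ℝ) 1, ∀ x, traceDeriv path t x = 0) {t : ℝ} (ht : t ∈ Icc (0 : ℝ) 1) :
    area (path t) = area (path 0) := by
  rw [area, area, surfaceIntegral, surfaceIntegral]
  congr 1
  funext y
  obtain ⟨A, hA⟩ := exists_coordMetric_eq_congr pole y
  rw [hA, hA, Matrix.det_mul, Matrix.det_mul, Matrix.det_mul, Matrix.det_mul,
    det_gram_eq h (fun t ht => htr t ht _) ht]

/-- `|g'|²` is nonnegative. In dimension two with `tr g' = 0` it equals `-2 det g' / det g`. -/
lemma normSqDeriv_nonneg {t : ℝ} {x : S2} (htr : traceDeriv path t x = 0) :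
    0 ≤ normSqDeriv path t x := by
  have hpos := gram_posDef (path t) x
  have hG : 0 < (gram (path t) x).det := hpos.det_pos
  have h00 : 0 < gram (path t) x 0 0 := hpos.diag_pos
  rw [traceDeriv, trace_inv_mul] at htr
  have h3 := (mul_eq_zero.1 htr).resolve_left (inv_ne_zero hG.ne')
  have hs := gram_symm (path t) x 1 0
  have hs' := gramDeriv_symm (path := path) x t 1 0
  rw [normSqDeriv]
  generalize gramDeriv path t x = S at *
  generalize gram (path t) x = G at *
  have key : (G⁻¹ * S * G⁻¹ * S).trace = (G.det)⁻¹ * (-2 * S.det) := by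
    have hd : (G.det)⁻¹ * G.det = 1 := inv_mul_cancel₀ hG.ne'
    rw [Matrix.inv_def, Ring.inverse_eq_inv', Matrix.adjugate_fin_two, Matrix.trace_fin_two]
    simp only [Matrix.mul_apply, Fin.sum_univ_two, Matrix.smul_apply, Matrix.of_apply,
      Matrix.cons_val', Matrix.cons_val_zero, Matrix.cons_val_one, Matrix.cons_val_fin_one,
      smul_eq_mul]
    generalize (G.det)⁻¹ = d at *
    rw [Matrix.det_fin_two] at hd ⊢
    rw [hs] at h3 hd ⊢
    rw [hs'] at h3 ⊢
    linear_combination d ^ 2 * (G 1 1 * S 0 0 - 2 * G 0 1 * S 0 1 + G 0 0 * S 1 1) * h3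
      - 2 * d * (S 0 0 * S 1 1 - S 0 1 * S 0 1) * hd
  rw [key]
  refine mul_nonneg (inv_nonneg.2 hG.le) ?_
  rw [Matrix.det_fin_two, hs] at hG
  rw [hs, hs'] at h3
  rw [Matrix.det_fin_two, hs']
  have e : G 0 0 * (S 0 0 * S 1 1 - S 0 1 * S 0 1)
      = -(G 1 1 * S 0 0 ^ 2 - 2 * G 0 1 * S 0 0 * S 0 1 + G 0 0 * S 0 1 ^ 2) := by
    linear_combination S 0 0 * h3
  have e2 : 0 ≤ G 0 0 * (G 1 1 * S 0 0 ^ 2 - 2 * G 0 1 * S 0 0 * S 0 1 + G 0 0 * S 0 1 ^ 2) := by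
    nlinarith [sq_nonneg (G 0 0 * S 0 1 - G 0 1 * S 0 0), mul_nonneg hG.le (sq_nonneg (S 0 0))]
  have e3 := nonneg_of_mul_nonneg_right e2 h00
  have e4 : 0 ≤ G 0 0 * -(S 0 0 * S 1 1 - S 0 1 * S 0 1) := by linarith
  have e5 := nonneg_of_mul_nonneg_right e4 h00
  linarith

/-- What the construction uses of an admissible path: it joins `g`, without changing the area
element, to a round metric of the same area radius. -/
structure IsRoundingPath (g : SphereMetric) (ro : ℝ) (path : ℝ → SphereMetric)
    (φ : S2 ≃ₘ^∞⟮𝓡 2, 𝓡 2⟯ S2) : Prop where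
  smooth : IsSmoothPath path
  zero : path 0 = g
  round : IsRoundVia (path 1) ro φ
  trace : ∀ t ∈ Icc (0 : ℝ) 1, ∀ x, traceDeriv path t x = 0

/-- The round end has the area radius of `g`, since the area is constant along the path. If `g` is
round this concerns the constant path. -/
lemma IsAdmissiblePath.exists_isRoundingPath {g : SphereMetric} {ro : ℝ} (hro : 0 < ro)
    (harea : area g = 4 * Real.pi * ro ^ 2) (h : IsAdmissiblePath g path) :
    ∃ φ, IsRoundingPath g ro path φ := by
  obtain ⟨hs, hr, hn⟩ := h
  have key : path 0 = g ∧ IsRound (path 1) ∧ ∀ t ∈ Icc (0 : ℝ) 1, ∀ x, traceDeriv path t x = 0 := by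
    by_cases hg : IsRound g
    · have hc := hr hg
      refine ⟨hc 0 (by simp), by rw [hc 1 (by simp)]; exact hg, fun t ht x => ?_⟩
      have : gramDeriv path t x = 0 := by
        ext i j
        rw [gramDeriv, Matrix.of_apply, derivWithin_congr (f := fun _ => gram g x i j)
          (fun s hs => by rw [hc s hs]) (by rw [hc t ht])]
        simp
      rw [traceDeriv, this, Matrix.mul_zero, Matrix.trace_zero]
    · exact (hn hg).2
  obtain ⟨h0, ⟨c, hc, φ, hφ⟩, htr⟩ := key
  have ha : 4 * Real.pi * c ^ 2 = 4 * Real.pi * ro ^ 2 := by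
    rw [← harea, ← h0, ← area_eq_of_path hs htr (right_mem_Icc.2 zero_le_one)]
    exact (area_of_round hφ).symm
  have hcr : c = ro := by
    have h4 : (4 * Real.pi) ≠ 0 := by positivity
    exact (pow_left_inj₀ hc.le hro.le two_ne_zero).1 (mul_left_cancel₀ h4 ha)
  exact ⟨φ, hs, h0, by rw [← hcr]; exact hφ, htr⟩

/-- The curvature of the round end of the path bounds `β`. -/
lemma IsRoundingPath.beta_le_one {g : SphereMetric} {ro β : ℝ} {φ : S2 ≃ₘ^∞⟮𝓡 2, 𝓡 2⟯ S2}
    (h : IsRoundingPath g ro path φ) (hro : 0 < ro) (hβ : IsBeta path ro β) : β ≤ 1 := by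
  refine (hβ.2 ⟨1, by simp, pole, rfl⟩).trans_eq ?_
  rw [gaussCurvature_of_round hro h.round]
  field_simp

lemma IsRoundingPath.alpha_nonneg {g : SphereMetric} {ro α : ℝ} {φ : S2 ≃ₘ^∞⟮𝓡 2, 𝓡 2⟯ S2}
    (h : IsRoundingPath g ro path φ) (hα : IsAlpha path α) : 0 ≤ α := by
  obtain ⟨t, ht, x, hx⟩ := hα.1
  rw [hx]
  exact mul_nonneg (by norm_num) (normSqDeriv_nonneg (h.trace t ht x))

end Paths

/-! ### The radial profiles -/

section Profile

lemma smoothTransition_one_sub (t : ℝ) :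
    Real.smoothTransition (1 - t) = 1 - Real.smoothTransition t := by
  have h : expNegInvGlue t + expNegInvGlue (1 - t) ≠ 0 :=
    (Real.smoothTransition.pos_denom t).ne'
  simp only [Real.smoothTransition, sub_sub_cancel]
  rw [add_comm (expNegInvGlue (1 - t))]
  field_simp
  ring

/-- The primitive of `1 - smoothTransition`: the identity on the negatives, constant after `1`. -/
def unitCap (x : ℝ) : ℝ := ∫ t in (0 : ℝ)..x, (1 - Real.smoothTransition t)

lemma continuous_one_sub_transition : Continuous fun t => 1 - Real.smoothTransition t :=
  continuous_const.sub Real.smoothTransition.continuous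

lemma hasDerivAt_unitCap (x : ℝ) : HasDerivAt unitCap (1 - Real.smoothTransition x) x :=
  continuous_one_sub_transition.integral_hasStrictDerivAt 0 x |>.hasDerivAt

lemma unitCap_of_nonpos {x : ℝ} (hx : x ≤ 0) : unitCap x = x := by
  have : ∫ t in (0 : ℝ)..x, (1 - Real.smoothTransition t) = ∫ t in (0 : ℝ)..x, (1 : ℝ) := by
    refine intervalIntegral.integral_congr fun t ht => ?_
    rw [uIcc_of_ge hx] at ht
    simp [Real.smoothTransition.zero_of_nonpos ht.2]
  rw [unitCap, this]
  simp

/-- The value follows from the symmetry `t ↦ 1 - t` of the transition function. -/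
lemma unitCap_one : unitCap 1 = 1 / 2 := by
  have h1 : unitCap 1 = ∫ t in (0 : ℝ)..1, Real.smoothTransition t := by
    have := intervalIntegral.integral_comp_sub_left (a := 0) (b := 1) Real.smoothTransition 1
    simp only [sub_self, sub_zero, smoothTransition_one_sub] at this
    exact this
  have h2 : unitCap 1 = 1 - ∫ t in (0 : ℝ)..1, Real.smoothTransition t := by
    rw [unitCap, intervalIntegral.integral_sub (by simp)
      (Real.smoothTransition.continuous.intervalIntegrable _ _)]
    simp
  linarith

lemma unitCap_of_one_le {x : ℝ} (hx : 1 ≤ x) : unitCap x = 1 / 2 := by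
  have : ∫ t in (1 : ℝ)..x, (1 - Real.smoothTransition t) = ∫ t in (1 : ℝ)..x, (0 : ℝ) := by
    refine intervalIntegral.integral_congr fun t ht => ?_
    rw [uIcc_of_le hx] at ht
    simp [Real.smoothTransition.one_of_one_le ht.1]
  rw [unitCap, ← intervalIntegral.integral_add_adjacent_intervals (b := 1)
    (continuous_one_sub_transition.intervalIntegrable _ _)
    (continuous_one_sub_transition.intervalIntegrable _ _), this]
  have := unitCap_one
  rw [unitCap] at this
  simp [this]

lemma unitCap_le (x : ℝ) : unitCap x ≤ x := by
  have hm : Monotone fun x => x - unitCap x :=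
    monotone_of_hasDerivAt_nonneg (f' := fun x => Real.smoothTransition x)
      (fun x => by
        have := (hasDerivAt_id x).sub (hasDerivAt_unitCap x)
        convert! this using 1
        ring)
      fun x => Real.smoothTransition.nonneg x
  rcases le_total x 0 with hx | hx
  · exact (unitCap_of_nonpos hx).le
  · have := hm hx
    simp only [unitCap_of_nonpos le_rfl] at this
    linarith

lemma contDiff_unitCap : ContDiff ℝ ∞ unitCap := by
  rw [contDiff_infty_iff_deriv]
  refine ⟨fun x => (hasDerivAt_unitCap x).differentiableAt, ?_⟩
  rw [show deriv unitCap = fun x => 1 - Real.smoothTransition x from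
    funext fun x => (hasDerivAt_unitCap x).deriv]
  exact contDiff_const.sub Real.smoothTransition.contDiff

/-- A smooth version of `min x b` which is the identity up to `a < b`. -/
lemma exists_smooth_cap {a b : ℝ} (hab : a < b) : ∃ σ σ' : ℝ → ℝ, ContDiff ℝ ∞ σ ∧
    (∀ x, HasDerivAt σ (σ' x) x) ∧ (∀ x, 0 ≤ σ' x) ∧ (∀ x, σ' x ≤ 1) ∧ Monotone σ ∧
    (∀ x, σ x ≤ x) ∧ (∀ x, x ≤ a → σ x = x ∧ σ' x = 1) ∧
    (∀ x, 2 * b - a ≤ x → σ x = b ∧ σ' x = 0) := by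
  have hL : 0 < 2 * (b - a) := by linarith
  have hba : b - a ≠ 0 := by linarith
  have hd : ∀ x, HasDerivAt (fun x => a + 2 * (b - a) * unitCap ((x - a) / (2 * (b - a))))
      (1 - Real.smoothTransition ((x - a) / (2 * (b - a)))) x := by
    intro x
    have h1 : HasDerivAt (fun x => (x - a) / (2 * (b - a))) (1 / (2 * (b - a))) x :=
      ((hasDerivAt_id x).sub_const a).div_const _
    have h2 := (((hasDerivAt_unitCap _).comp x h1).const_mul (2 * (b - a))).const_add a
    convert! h2 using 1
    field_simp
  refine ⟨_, _, ?_, hd, fun x => sub_nonneg.2 (Real.smoothTransition.le_one _),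
    fun x => sub_le_self _ (Real.smoothTransition.nonneg _), ?_, fun x => ?_, fun x hx => ?_,
    fun x hx => ?_⟩
  · exact contDiff_const.add (contDiff_const.mul
      (contDiff_unitCap.comp ((contDiff_id.sub contDiff_const).div_const _)))
  · exact monotone_of_hasDerivAt_nonneg hd
      fun x => sub_nonneg.2 (Real.smoothTransition.le_one _)
  · have := mul_le_mul_of_nonneg_left (unitCap_le ((x - a) / (2 * (b - a)))) hL.le
    rw [mul_div_cancel₀ _ hL.ne'] at this
    linarith
  · have h : (x - a) / (2 * (b - a)) ≤ 0 := div_nonpos_of_nonpos_of_nonneg (by linarith) hL.le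
    rw [unitCap_of_nonpos h, mul_div_cancel₀ _ hL.ne', Real.smoothTransition.zero_of_nonpos h]
    constructor <;> ring
  · have h : 1 ≤ (x - a) / (2 * (b - a)) := by
      rw [le_div_iff₀ hL]; linarith
    rw [unitCap_of_one_le h, Real.smoothTransition.one_of_one_le h]
    constructor <;> ring

lemma kConst_sq {Ho ro m : ℝ} (h : 0 < 1 - 2 * m / ro) :
    kConst Ho ro m ^ 2 * (1 - 2 * m / ro) = (Ho * ro / 2) ^ 2 := by
  have : ((1 - 2 * m / ro) ^ (-(1 / 2) : ℝ)) ^ 2 = (1 - 2 * m / ro)⁻¹ := by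
    rw [← Real.rpow_natCast, ← Real.rpow_mul h.le]
    norm_num
    exact Real.rpow_neg_one _
  rw [kConst, mul_pow, this]
  field_simp

/-- Both cases of the threshold `m_*` in a single expression. Here `Q` is an upper bound of
`k² (r - 2 m) / r` for `r ≥ ro`, the limit `k²` for `m ≥ 0` and the value at `ro` for `m < 0`. -/
lemma mStar_eq {Ho ro α β m mH : ℝ} (hro : 0 < ro) (hα : 0 ≤ α)
    (hW : 1 / 4 * Ho ^ 2 * ro ^ 2 < β / (1 + α)) (hm : m < ro / 2)
    (hWm : 1 / 4 * Ho ^ 2 * ro ^ 2 < β / (1 + α) * (1 - 2 * m / ro)) :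
    ∃ Q : ℝ, 0 ≤ Q ∧ 0 < β - kConst Ho ro m ^ 2 - α * Q ∧
      (∀ r, ro ≤ r → kConst Ho ro m ^ 2 * (r - 2 * m) ≤ Q * r) ∧
      mStar Ho ro α β m mH = 1 / 2 * ro * √(α * Q / (β - kConst Ho ro m ^ 2 - α * Q))
        * (1 - kConst Ho ro m ^ 2) + mH := by
  have hx : 0 < 1 - 2 * m / ro := by
    rw [sub_pos, div_lt_one hro]; linarith
  have hk := kConst_sq (Ho := Ho) hx
  have hα1 : 0 < 1 + α := by linarith
  by_cases h : m < 0
  · refine ⟨(Ho * ro / 2) ^ 2, sq_nonneg _, ?_, ?_, ?_⟩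
    · have h1 : kConst Ho ro m ^ 2 ≤ (Ho * ro / 2) ^ 2 := by
        rw [← hk]
        refine le_mul_of_one_le_right (sq_nonneg _) ?_
        have : 2 * m / ro ≤ 0 := div_nonpos_of_nonpos_of_nonneg (by linarith) hro.le
        linarith
      rw [lt_div_iff₀ hα1] at hW
      nlinarith
    · intro r hr
      have h2 : kConst Ho ro m ^ 2 * (ro - 2 * m) = (Ho * ro / 2) ^ 2 * ro := by
        rw [← hk]; field_simp
      have h3 : kConst Ho ro m ^ 2 * (r - 2 * m) * ro ≤ kConst Ho ro m ^ 2 * (ro - 2 * m) * r := by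
        have := mul_nonneg (sq_nonneg (kConst Ho ro m)) (mul_nonneg (by linarith : 0 ≤ -m) (sub_nonneg.2 hr))
        nlinarith
      rw [h2] at h3
      have : kConst Ho ro m ^ 2 * (r - 2 * m) * ro ≤ (Ho * ro / 2) ^ 2 * r * ro := by linarith
      exact le_of_mul_le_mul_right this hro
    · rw [mStar, if_pos h]
      congr 5 <;> ring
  · rw [not_lt] at h
    refine ⟨kConst Ho ro m ^ 2, sq_nonneg _, ?_, ?_, ?_⟩
    · have h1 : (kConst Ho ro m ^ 2) * (1 - 2 * m / ro) < β / (1 + α) * (1 - 2 * m / ro) := by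
        rw [hk]; linarith
      have h2 := lt_of_mul_lt_mul_right h1 hx.le
      rw [lt_div_iff₀ hα1] at h2
      linarith
    · intro r hr
      exact mul_le_mul_of_nonneg_left (by linarith) (sq_nonneg _)
    · rw [mStar, if_neg (not_lt.2 h)]
      congr 5
      ring

/-- The radial profiles of the extension. In terms of the area radius `r` the metric is
`(r / w) dr² + (r² / ro²) g(τ)`; the function `(r - w) / 2` is the Hawking mass of the slices, and
the last field makes the scalar curvature nonnegative. -/
structure ExtensionProfile (ro Ho α β me : ℝ) (w τ : ℝ → ℝ) (R : ℝ) : Prop where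
  smooth_w : ContDiff ℝ ∞ w
  smooth_τ : ContDiff ℝ ∞ τ
  le_R : ro ≤ R
  w_pos : ∀ r, ro ≤ r → 0 < w r
  w_ro : w ro = ro * (Ho * ro / 2) ^ 2
  schwarzschild : ∀ r, R ≤ r → w r = r - 2 * me ∧ τ r = 1
  τ_ro : τ ro = 0
  τ_mem : ∀ r, ro ≤ r → τ r ∈ Icc (0 : ℝ) 1
  curvature : ∀ r, ro ≤ r → deriv w r + α / 2 * deriv τ r ^ 2 * (r * w r) ≤ β ∨
    (τ r = 1 ∧ deriv τ r = 0 ∧ deriv w r ≤ 1)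

set_option maxHeartbeats 1000000 in
/-- Existence of the profiles: the mass function `(r - w) / 2` grows with slope `(1 - k²) / 2` while
`τ < 1`, and increases to the mass `me` afterwards. -/
theorem exists_profile {Ho ro α β m me : ℝ} (hro : 0 < ro) (hHo : 0 < Ho) (hα : 0 ≤ α)
    (hβ : β ≤ 1) (hW : 1 / 4 * Ho ^ 2 * ro ^ 2 < β / (1 + α)) (hm : m < ro / 2)
    (hWm : 1 / 4 * Ho ^ 2 * ro ^ 2 < β / (1 + α) * (1 - 2 * m / ro))
    (hme : mStar Ho ro α β m (ro / 2 * (1 - (Ho * ro / 2) ^ 2)) < me) :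
    ∃ (w τ : ℝ → ℝ) (R : ℝ), ExtensionProfile ro Ho α β me w τ R := by
  obtain ⟨Q, hQ, hΔ, hVQ, hms⟩ := mStar_eq (mH := ro / 2 * (1 - (Ho * ro / 2) ^ 2)) hro hα hW hm hWm
  have hx : 0 < 1 - 2 * m / ro := by
    rw [sub_pos, div_lt_one hro]; linarith
  have hk := kConst_sq (Ho := Ho) hx
  rw [hms] at hme
  set K := kConst Ho ro m ^ 2 with hK
  have hK0 : 0 ≤ K := sq_nonneg _
  have hKro : K * (ro - 2 * m) = ro * (Ho * ro / 2) ^ 2 := by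
    rw [← hk]; field_simp
  have hK1 : K < 1 := by
    have := mul_nonneg hα hQ
    linarith
  have hp : 0 < ro * (Ho * ro / 2) ^ 2 := by positivity
  -- The thickness `D` of the collar, slightly above the critical one.
  obtain ⟨D, hD0, hD⟩ : ∃ D, ro * √(α * Q / (β - K - α * Q)) < D ∧
      D / 2 * (1 - K) + ro / 2 * (1 - (Ho * ro / 2) ^ 2) < me := by
    set D₀ := ro * √(α * Q / (β - K - α * Q)) with hD₀
    have hme' : D₀ / 2 * (1 - K) + ro / 2 * (1 - (Ho * ro / 2) ^ 2) < me := by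
      rw [hD₀]; linarith
    set δ := me - (D₀ / 2 * (1 - K) + ro / 2 * (1 - (Ho * ro / 2) ^ 2)) with hδ
    have hδ0 : 0 < δ := by rw [hδ]; linarith
    have h1K : 0 < 1 - K := by linarith
    refine ⟨D₀ + δ / (1 - K), by linarith [div_pos hδ0 h1K], ?_⟩
    have : (D₀ + δ / (1 - K)) / 2 * (1 - K) = D₀ / 2 * (1 - K) + δ / 2 := by
      field_simp
    rw [this]
    linarith
  have hDpos : 0 < D := lt_of_le_of_lt (by positivity) hD0
  have hcrit : α * Q * (ro ^ 2 + D ^ 2) < D ^ 2 * (β - K) := by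
    have h1 : (ro * √(α * Q / (β - K - α * Q))) ^ 2 < D ^ 2 :=
      pow_lt_pow_left₀ hD0 (by positivity) two_ne_zero
    rw [mul_pow, Real.sq_sqrt (div_nonneg (mul_nonneg hα hQ) hΔ.le), mul_div_assoc',
      div_lt_iff₀ hΔ] at h1
    linarith
  -- The room that remains for smoothing the linear function `(r - ro) / D`.
  set A := α * Q * (ro ^ 2 + D ^ 2) with hA
  set B := D ^ 2 * (β - K) with hB
  have hA0 : 0 ≤ A := by positivity
  have hB0 : 0 < B := lt_of_le_of_lt hA0 hcrit
  set ε := (B - A) / (3 * B) with hε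
  have hε0 : 0 < ε := div_pos (by linarith) (by linarith)
  have hε1 : ε ≤ 1 / 3 := by
    rw [hε, div_le_iff₀ (by linarith)]; linarith
  have hεB : (1 + ε) ^ 2 * A ≤ B := by
    have h1 : 3 * ε * B = B - A := by rw [hε]; field_simp
    have h2 : (1 + ε) ^ 2 ≤ 1 + 3 * ε := by nlinarith
    have h3 : 3 * ε * A ≤ 3 * ε * B := by gcongr
    calc (1 + ε) ^ 2 * A ≤ (1 + 3 * ε) * A := by gcongr
      _ ≤ B := by linarith
  obtain ⟨σ, σ', hσs, hσd, hσ0, hσ1, hσm, -, hσa, hσb⟩ :=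
    exists_smooth_cap (a := 1 - ε) (b := 1) (by linarith)
  -- The mass function with slope `(1 - k²) / 2`, to be capped at `me`.
  set μ : ℝ → ℝ := fun r => (r - K * (r - 2 * m)) / 2 with hμ
  have hμ1 : μ (ro + D) < me := by
    have : μ (ro + D) = D / 2 * (1 - K) + ro / 2 * (1 - (Ho * ro / 2) ^ 2) := by
      rw [hμ]; linear_combination -(1 / 2) * hKro
    rw [this]; exact hD
  obtain ⟨s, s', hss, hsd, hs0, hs1, hsm, hsx, hsa, hsb⟩ := exists_smooth_cap hμ1
  have hμd : ∀ r, HasDerivAt μ ((1 - K) / 2) r := by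
    intro r
    have := (((hasDerivAt_id r).sub (((hasDerivAt_id r).sub_const (2 * m)).const_mul K))).div_const 2
    simpa using this
  have hμmono : ∀ r r', r ≤ r' → μ r ≤ μ r' := by
    intro r r' h
    simp only [hμ]
    have := mul_le_mul_of_nonneg_left h (by linarith : 0 ≤ 1 - K)
    linarith
  have hwd : ∀ r, HasDerivAt (fun r => r - 2 * s (μ r)) (1 - (1 - K) * s' (μ r)) r := by
    intro r
    have := (hasDerivAt_id r).sub (((hsd (μ r)).comp r (hμd r)).const_mul 2)
    convert! this using 1
    ring
  have hτd : ∀ r, HasDerivAt (fun r => σ ((1 + ε) * (r - ro) / D))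
      (σ' ((1 + ε) * (r - ro) / D) * ((1 + ε) / D)) r := by
    intro r
    have h1 : HasDerivAt (fun r => (1 + ε) * (r - ro) / D) ((1 + ε) / D) r := by
      simpa using ((((hasDerivAt_id r).sub_const ro).const_mul (1 + ε)).div_const D)
    exact (hσd _).comp r h1
  have hτ1 : ∀ r, ro + D ≤ r → 2 * 1 - (1 - ε) ≤ (1 + ε) * (r - ro) / D := by
    intro r hr
    rw [le_div_iff₀ hDpos]
    nlinarith
  set R := max (ro + D) (2 * (2 * me - μ (ro + D) - K * m) / (1 - K)) with hR
  refine ⟨fun r => r - 2 * s (μ r), fun r => σ ((1 + ε) * (r - ro) / D), R, ?_, ?_, ?_, ?_, ?_, ?_,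
    ?_, ?_, ?_⟩
  · have : ContDiff ℝ ∞ μ := by
      rw [hμ]
      exact (contDiff_id.sub (contDiff_const.mul (contDiff_id.sub contDiff_const))).div_const 2
    exact contDiff_id.sub (contDiff_const.mul (hss.comp this))
  · exact hσs.comp ((contDiff_const.mul (contDiff_id.sub contDiff_const)).div_const D)
  · exact (by linarith : ro ≤ ro + D).trans (le_max_left _ _)
  · intro r hr
    have h1 := hsx (μ r)
    have h2 : K * (ro - 2 * m) ≤ K * (r - 2 * m) := by gcongr
    have h3 : r - 2 * μ r = K * (r - 2 * m) := by simp only [hμ]; ring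
    show 0 < r - 2 * s (μ r)
    linarith
  · have h1 := (hsa (μ ro) (hμmono _ _ (by linarith))).1
    show ro - 2 * s (μ ro) = _
    rw [h1, ← hKro]
    simp only [hμ]
    ring
  · intro r hr
    have h1 : ro + D ≤ r := (le_max_left _ _).trans hr
    have h2 : 2 * (2 * me - μ (ro + D) - K * m) / (1 - K) ≤ r := (le_max_right _ _).trans hr
    refine ⟨?_, (hσb _ (hτ1 r h1)).1⟩
    rw [div_le_iff₀ (by linarith)] at h2
    have h3 : 2 * me - μ (ro + D) ≤ μ r := by
      have : μ r = (r * (1 - K) + 2 * K * m) / 2 := by simp only [hμ]; ring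
      rw [this]; linarith
    show r - 2 * s (μ r) = _
    rw [(hsb _ h3).1]
  · show σ ((1 + ε) * (ro - ro) / D) = 0
    rw [sub_self, mul_zero, zero_div, (hσa 0 (by linarith)).1]
  · intro r hr
    have h0 : 0 ≤ (1 + ε) * (r - ro) / D :=
      div_nonneg (mul_nonneg (by linarith) (by linarith)) hDpos.le
    refine ⟨?_, ?_⟩
    · have := hσm h0
      rw [(hσa 0 (by linarith)).1] at this
      exact this
    · have h1 := hσm (le_max_left ((1 + ε) * (r - ro) / D) (2 * 1 - (1 - ε)))
      rw [(hσb _ (le_max_right _ _)).1] at h1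
      exact h1
  · intro r hr
    rcases le_total r (ro + D) with h | h
    · left
      have h1 := hsa (μ r) (hμmono _ _ h)
      rw [(hwd r).deriv, (hτd r).deriv]
      rw [h1.1, h1.2]
      have h2 : r - 2 * μ r = K * (r - 2 * m) := by simp only [hμ]; ring
      have h3 : r * (K * (r - 2 * m)) ≤ 2 * (Q * (ro ^ 2 + D ^ 2)) := by
        have hr0 : 0 ≤ r := by linarith
        calc r * (K * (r - 2 * m)) ≤ r * (Q * r) := by
              exact mul_le_mul_of_nonneg_left (hVQ r hr) hr0
          _ = Q * r ^ 2 := by ring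
          _ ≤ Q * (ro + D) ^ 2 := by gcongr
          _ ≤ Q * (2 * (ro ^ 2 + D ^ 2)) := by
              gcongr
              nlinarith [sq_nonneg (ro - D)]
          _ = _ := by ring
      have h4 : (σ' ((1 + ε) * (r - ro) / D) * ((1 + ε) / D)) ^ 2 ≤ ((1 + ε) / D) ^ 2 := by
        have ha := hσ0 ((1 + ε) * (r - ro) / D)
        have hb := hσ1 ((1 + ε) * (r - ro) / D)
        have hc : 0 ≤ (1 + ε) / D := by positivity
        exact pow_le_pow_left₀ (mul_nonneg ha hc) (mul_le_of_le_one_left hc hb) 2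
      have h5 : 0 ≤ r * (K * (r - 2 * m)) := by
        have : 0 ≤ K * (r - 2 * m) := mul_nonneg hK0 (by linarith)
        have hr0 : 0 ≤ r := by linarith
        positivity
      rw [h2]
      have h6 : α / 2 * (σ' ((1 + ε) * (r - ro) / D) * ((1 + ε) / D)) ^ 2 * (r * (K * (r - 2 * m)))
          ≤ α / 2 * ((1 + ε) / D) ^ 2 * (2 * (Q * (ro ^ 2 + D ^ 2))) := by gcongr
      have h7 : α / 2 * ((1 + ε) / D) ^ 2 * (2 * (Q * (ro ^ 2 + D ^ 2))) = (1 + ε) ^ 2 * A / D ^ 2 := by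
        rw [hA]; field_simp
      have h8 : (1 + ε) ^ 2 * A / D ^ 2 ≤ β - K := by
        rw [div_le_iff₀ (by positivity)]
        linarith
      linarith
    · right
      have h1 := hσb _ (hτ1 r h)
      have h2 : 0 ≤ (1 - K) * s' (μ r) := mul_nonneg (by linarith) (hs0 (μ r))
      refine ⟨h1.1, (hτd r).deriv.trans ?_, (hwd r).deriv.trans_le (sub_le_self _ h2)⟩
      rw [h1.2, zero_mul]

end Profile

/-! ### Coordinate frames of products -/

section Frames

/-- On the model space itself all coordinate frames agree. -/
lemma chartFrame_model {E : Type*} [NormedAddCommGroup E] [NormedSpace ℝ E]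
    {H : Type*} [TopologicalSpace H] (I : ModelWithCorners ℝ E H) (p q : H) (v : E) :
    chartFrame I p v q = v := by
  have h : achart H p = achart H q := Subtype.ext (by simp [chartAt_self_eq])
  have h2 : chartFrame I p v q = chartFrame I q v q := by
    rw [chartFrame, chartFrame, TangentBundle.trivializationAt_eq_localTriv,
      TangentBundle.trivializationAt_eq_localTriv, h]
  exact h2.trans (chartFrame_self q v)

variable {E : Type*} [NormedAddCommGroup E] [NormedSpace ℝ E]
  {H : Type*} [TopologicalSpace H] {I : ModelWithCorners ℝ E H}
  {M : Type*} [TopologicalSpace M] [ChartedSpace H M] [IsManifold I ∞ M]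
  {E' : Type*} [NormedAddCommGroup E'] [NormedSpace ℝ E']
  {H' : Type*} [TopologicalSpace H'] {J : ModelWithCorners ℝ E' H'}
  {N : Type*} [TopologicalSpace N] [ChartedSpace H' N] [IsManifold J ∞ N]

lemma chartFrame_prod {p q : M × N} (h1 : q.1 ∈ (chartAt H p.1).source)
    (h2 : q.2 ∈ (chartAt H' p.2).source) (v : E) (w : E') :
    chartFrame (I.prod J) p (v, w) q = (chartFrame I p.1 v q.1, chartFrame J p.2 w q.2) := by
  have hq : q ∈ (chartAt (ModelProd H H') p).source := by
    rw [prodChartedSpace_chartAt]; exact ⟨h1, h2⟩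
  have e1 := chartFrame_eq (I := I.prod J) hq (v, w)
  have e2 := chartFrame_eq (I := I) h1 v
  have e3 := chartFrame_eq (I := J) h2 w
  have hd1 : MDifferentiableWithinAt 𝓘(ℝ, E) I (extChartAt I p.1).symm (range I)
      (extChartAt I p.1 q.1) := by
    have := contMDiffWithinAt_extChartAt_symm_range (I := I) (n := ∞) p.1
      ((extChartAt I p.1).map_source (by simpa using h1))
    exact this.mdifferentiableWithinAt (by simp)
  have hd2 : MDifferentiableWithinAt 𝓘(ℝ, E') J (extChartAt J p.2).symm (range J)
      (extChartAt J p.2 q.2) := by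
    have := contMDiffWithinAt_extChartAt_symm_range (I := J) (n := ∞) p.2
      ((extChartAt J p.2).map_source (by simpa using h2))
    exact this.mdifferentiableWithinAt (by simp)
  have hu1 : UniqueMDiffWithinAt 𝓘(ℝ, E) (range I) (extChartAt I p.1 q.1) :=
    (I.uniqueDiffOn _ (extChartAt_target_subset_range p.1
      ((extChartAt I p.1).map_source (by simpa using h1)))).uniqueMDiffWithinAt
  have hu2 : UniqueMDiffWithinAt 𝓘(ℝ, E') (range J) (extChartAt J p.2 q.2) :=
    (J.uniqueDiffOn _ (extChartAt_target_subset_range p.2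
      ((extChartAt J p.2).map_source (by simpa using h2)))).uniqueMDiffWithinAt
  have key := mfderivWithin_prodMap (p := (extChartAt I p.1 q.1, extChartAt J p.2 q.2))
    hd1 hd2 hu1 hu2
  refine e1.trans ?_
  rw [e2, e3]
  have : mfderivWithin 𝓘(ℝ, E × E') (I.prod J) (extChartAt (I.prod J) p).symm (range (I.prod J))
      (extChartAt (I.prod J) p q) = mfderivWithin (𝓘(ℝ, E).prod 𝓘(ℝ, E')) (I.prod J)
        (Prod.map (extChartAt I p.1).symm (extChartAt J p.2).symm) (range I ×ˢ range J)
        (extChartAt I p.1 q.1, extChartAt J p.2 q.2) := by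
    rw [← ModelWithCorners.range_prod, modelWithCornersSelf_prod, ← chartedSpaceSelf_prod,
      extChartAt_prod]
    rfl
  have key2 := this.trans key
  exact congrArg (fun L : E × E' →L[ℝ] E × E' => L (v, w)) key2

end Frames

/-! ### Warped metrics on the half-cylinder -/

section Collar

/-- The half-cylinder `[0, ∞) × S²`. -/
abbrev HalfCylinder := EuclideanHalfSpace 1 × S2

/-- The radial coordinate of tangent vectors. -/
def radialForm : V3 →L[ℝ] ℝ :=
  (EuclideanSpace.proj (0 : Fin 1) : EuclideanSpace ℝ (Fin 1) →L[ℝ] ℝ).comp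
    (ContinuousLinearMap.fst ℝ (EuclideanSpace ℝ (Fin 1)) E2)

@[simp] lemma radialForm_apply (v : V3) : radialForm v = v.1 0 := rfl

/-- The bilinear form `a ds² + c B` on `ℝ × ℝ²`. -/
def blockForm (a c : ℝ) (B : E2 →L[ℝ] E2 →L[ℝ] ℝ) : V3 →L[ℝ] V3 →L[ℝ] ℝ :=
  a • radialForm.smulRight radialForm + c • B.bilinearComp (ContinuousLinearMap.snd ℝ _ E2)
    (ContinuousLinearMap.snd ℝ _ E2)

lemma blockForm_apply (a c : ℝ) (B : E2 →L[ℝ] E2 →L[ℝ] ℝ) (v w : V3) :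
    blockForm a c B v w = a * (v.1 0 * w.1 0) + c * B v.2 w.2 := by
  simp [blockForm]

lemma V3.eq_zero {v : V3} (h1 : v.1 0 = 0) (h2 : v.2 = 0) : v = 0 := by
  refine Prod.ext ?_ h2
  ext i
  rw [Subsingleton.elim i 0]
  exact h1

/-- The unit ball of a positive definite form is bounded, as the form is bounded below on the unit
sphere. -/
lemma isVonNBounded_of_pos {E : Type*} [NormedAddCommGroup E] [NormedSpace ℝ E]
    [FiniteDimensional ℝ E] (B : E →L[ℝ] E →L[ℝ] ℝ) (hB : ∀ v, v ≠ 0 → 0 < B v v) :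
    Bornology.IsVonNBounded ℝ {v : E | B v v < 1} := by
  rw [NormedSpace.isVonNBounded_iff]
  have hc : ContinuousOn (fun v => B v v) (Metric.sphere 0 1) :=
    (B.continuous.clm_apply continuous_id).continuousOn
  have : ∃ δ > 0, ∀ v ∈ Metric.sphere (0 : E) 1, δ ≤ B v v := by
    rcases (Metric.sphere (0 : E) 1).eq_empty_or_nonempty with h | h
    · exact ⟨1, one_pos, fun v hv => by rw [h] at hv; exact hv.elim⟩
    · obtain ⟨v₀, hv₀, hmin⟩ := (isCompact_sphere (0 : E) 1).exists_isMinOn h hc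
      exact ⟨B v₀ v₀, hB v₀ (ne_zero_of_mem_unit_sphere ⟨v₀, hv₀⟩), fun v hv => hmin hv⟩
  obtain ⟨δ, hδ, hmin⟩ := this
  refine (Metric.isBounded_closedBall (x := (0 : E)) (r := max 1 (1 / δ))).subset fun v hv => ?_
  rw [mem_closedBall_zero_iff]
  by_contra! hlt
  have hv1 : 1 < ‖v‖ := (le_max_left _ _).trans_lt hlt
  have hv2 : 1 / δ < ‖v‖ := (le_max_right _ _).trans_lt hlt
  have hn : 0 < ‖v‖ := by linarith
  have h1 := hmin (‖v‖⁻¹ • v) (by simp [norm_smul, hn.ne'])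
  simp only [map_smul, smul_apply, smul_eq_mul] at h1
  have h2 : δ * ‖v‖ ^ 2 ≤ B v v := by
    have := mul_le_mul_of_nonneg_right h1 (sq_nonneg ‖v‖)
    calc _ ≤ _ := this
      _ = B v v := by field_simp
  have h3 : B v v < 1 := hv
  rw [div_lt_iff₀ hδ] at hv2
  nlinarith

/-- The bilinear form of a metric on the sphere at a point, on `ℝ²`, with which all tangent spaces
are identified as vector spaces. -/
def planeForm (g : SphereMetric) (x : S2) : E2 →L[ℝ] E2 →L[ℝ] ℝ := g.inner x

lemma planeForm_symm (g : SphereMetric) (x : S2) (v w : E2) :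
    planeForm g x v w = planeForm g x w v := g.symm x v w

lemma planeForm_pos (g : SphereMetric) (x : S2) (v : E2) (hv : v ≠ 0) : 0 < planeForm g x v v :=
  g.pos x v hv

lemma planeForm_zero_left (g : SphereMetric) (x : S2) (w : E2) : planeForm g x 0 w = 0 := by
  simp

lemma planeForm_zero_right (g : SphereMetric) (x : S2) (w : E2) : planeForm g x w 0 = 0 :=
  map_zero _

/-- The data of the metric `u(s) ds² + c(s) g(τ(s))` on `[0, ∞) × S²`. -/
structure CollarData (path : ℝ → SphereMetric) (u c τ : ℝ → ℝ) : Prop where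
  smooth_path : IsSmoothPath path
  smooth_u : ∀ s, 0 ≤ s → ContDiffAt ℝ ∞ u s
  smooth_c : ∀ s, 0 ≤ s → ContDiffAt ℝ ∞ c s
  smooth_τ : ∀ s, 0 ≤ s → ContDiffAt ℝ ∞ τ s
  u_pos : ∀ s, 0 ≤ s → 0 < u s
  c_pos : ∀ s, 0 ≤ s → 0 < c s
  τ_mem : ∀ s, 0 ≤ s → τ s ∈ Icc (0 : ℝ) 1

variable {path : ℝ → SphereMetric} {u c τ : ℝ → ℝ}

/-- The radial coordinate `s` on the half-cylinder. -/
def height (p : HalfCylinder) : ℝ := p.1.1 0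

lemma height_nonneg (p : HalfCylinder) : 0 ≤ height p := p.1.2

lemma contMDiff_height : ContMDiff I3 𝓘(ℝ, ℝ) ∞ height := by
  have h1 : ContMDiff (𝓡∂ 1) 𝓘(ℝ, EuclideanSpace ℝ (Fin 1)) ∞ (𝓡∂ 1) :=
    ModelWithCorners.contMDiff _
  have h2 : ContMDiff 𝓘(ℝ, EuclideanSpace ℝ (Fin 1)) 𝓘(ℝ, ℝ) ∞
      (fun v : EuclideanSpace ℝ (Fin 1) => v 0) :=
    (EuclideanSpace.proj (0 : Fin 1) : EuclideanSpace ℝ (Fin 1) →L[ℝ] ℝ).contDiff.contMDiff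
  exact h2.comp (h1.comp contMDiff_fst)

lemma contMDiff_comp_height {f : ℝ → ℝ} (hf : ∀ s, 0 ≤ s → ContDiffAt ℝ ∞ f s) :
    ContMDiff I3 𝓘(ℝ, ℝ) ∞ (fun p : HalfCylinder => f (height p)) := fun p =>
  (hf _ (height_nonneg p)).contMDiffAt.comp p (contMDiff_height p)

/-- The bilinear forms `u(s) ds² + c(s) g(τ(s))`. -/
def collarForm (path : ℝ → SphereMetric) (u c τ : ℝ → ℝ) (p : HalfCylinder) :
    V3 →L[ℝ] V3 →L[ℝ] ℝ :=
  blockForm (u (height p)) (c (height p)) (planeForm (path (τ (height p))) p.2)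

/-- The coordinate fields of the half-cylinder are the constant one and those of the sphere. -/
lemma chartFrame_I3 {p q : HalfCylinder} (hq : q.2 ∈ (chartAt E2 p.2).source) (v : V3) :
    chartFrame I3 p v q = ((v.1, chartFrame (𝓡 2) p.2 v.2 q.2) : V3) := by
  refine (chartFrame_prod (I := 𝓡∂ 1) (J := 𝓡 2) (p := p) (q := q)
    (by rw [chartAt_self_eq]; trivial) hq v.1 v.2).trans ?_
  rw [chartFrame_model]
  rfl

namespace CollarData
variable (D : CollarData path u c τ)
include D

omit D in
lemma collarForm_symm (p : HalfCylinder) (v w : V3) :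
    collarForm path u c τ p v w = collarForm path u c τ p w v := by
  rw [collarForm, blockForm_apply, blockForm_apply, planeForm_symm, mul_comm (v.1 0)]

lemma collarForm_pos (p : HalfCylinder) (v : V3) (hv : v ≠ 0) :
    0 < collarForm path u c τ p v v := by
  rw [collarForm, blockForm_apply]
  have hu := D.u_pos _ (height_nonneg p)
  have hc := D.c_pos _ (height_nonneg p)
  by_cases h2 : v.2 = 0
  · have h1 : v.1 0 ≠ 0 := fun h1 => hv (V3.eq_zero h1 h2)
    rw [h2, map_zero, mul_zero, add_zero]
    exact mul_pos hu (mul_self_pos.2 h1)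
  · exact add_pos_of_nonneg_of_pos (mul_nonneg hu.le (mul_self_nonneg _))
      (mul_pos hc (planeForm_pos _ p.2 v.2 h2))

/-- The coefficients of `g(τ(s))` in a coordinate frame of the sphere. -/
lemma contMDiffAt_path_coeff (p : HalfCylinder) (v w : E2) :
    ContMDiffAt I3 𝓘(ℝ, ℝ) ∞ (fun q : HalfCylinder =>
      (path (τ (height q))).inner q.2 (chartFrame (𝓡 2) p.2 v q.2) (chartFrame (𝓡 2) p.2 w q.2))
      p := by
  have h1 : ContMDiff I3 (𝓘(ℝ, ℝ).prod (𝓡 2)) ∞ (fun q : HalfCylinder => (τ (height q), q.2)) :=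
    (contMDiff_comp_height D.smooth_τ).prodMk contMDiff_snd
  have h2 : ContMDiffWithinAt I3 ((𝓡 2).prod 𝓘(ℝ, E2 →L[ℝ] E2 →L[ℝ] ℝ)) ∞
      (fun q : HalfCylinder => Bundle.TotalSpace.mk' (E2 →L[ℝ] E2 →L[ℝ] ℝ)
        (E := fun x : S2 => TangentSpace (𝓡 2) x →L[ℝ] TangentSpace (𝓡 2) x →L[ℝ] ℝ)
        q.2 ((path (τ (height q))).inner q.2)) univ p := by
    have h3 : ContMDiffOn _ _ ∞ _ (Icc (0 : ℝ) 1 ×ˢ (univ : Set S2)) := D.smooth_path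
    exact h3.comp h1.contMDiffOn (s := univ)
      (fun q _ => ⟨D.τ_mem _ (height_nonneg q), trivial⟩) p trivial
  have h3 := contMDiffWithinAt_bilin_chartFrame (I := 𝓡 2) h2 (f := Prod.snd)
    (B := fun q : HalfCylinder => (path (τ (height q))).inner q.2) (mem_chart_source _ p.2) v w
  rwa [contMDiffWithinAt_univ] at h3

/-- The metric `u(s) ds² + c(s) g(τ(s))`. -/
def metric : RiemMetric I3 HalfCylinder where
  inner p := collarForm path u c τ p
  symm p v w := collarForm_symm p v w
  pos p v hv := D.collarForm_pos p v hv
  isVonNBounded p := isVonNBounded_of_pos (collarForm path u c τ p) (D.collarForm_pos p)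
  contMDiff := by
    intro p
    rw [← contMDiffWithinAt_univ]
    refine contMDiffWithinAt_bilin_of_coeff (I := I3) basis3 (f := id)
      (fun p => collarForm path u c τ p) (mem_univ p) contMDiffWithinAt_id fun i j => ?_
    rw [contMDiffWithinAt_univ]
    have key : ContMDiffAt I3 𝓘(ℝ, ℝ) ∞ (fun q : HalfCylinder =>
        u (height q) * ((basis3 i).1 0 * (basis3 j).1 0) + c (height q) *
          planeForm (path (τ (height q))) q.2 (chartFrame (𝓡 2) p.2 (basis3 i).2 q.2)
            (chartFrame (𝓡 2) p.2 (basis3 j).2 q.2)) p :=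
      ((contMDiff_comp_height D.smooth_u p).mul contMDiffAt_const).add
        ((contMDiff_comp_height D.smooth_c p).mul (D.contMDiffAt_path_coeff p _ _))
    refine key.congr_of_eventuallyEq ?_
    have : ∀ᶠ q : HalfCylinder in nhds p, q.2 ∈ (chartAt E2 p.2).source :=
      continuous_snd.continuousAt.eventually_mem
        ((chartAt E2 p.2).open_source.mem_nhds (mem_chart_source _ _))
    filter_upwards [this] with q hq
    exact (congrArg₂ (fun v w : V3 => collarForm path u c τ q v w) (chartFrame_I3 hq _)
      (chartFrame_I3 hq _)).trans (blockForm_apply _ _ _ _ _)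

lemma metric_apply (p : HalfCylinder) (v w : V3) :
    D.metric.inner p v w = u (height p) * (v.1 0 * w.1 0) +
      c (height p) * planeForm (path (τ (height p))) p.2 v.2 w.2 :=
  blockForm_apply _ _ _ _ _

end CollarData

/-- The coefficients of the sphere part of the collar metric in the chart centred at `x`. -/
def collarBlock (path : ℝ → SphereMetric) (c τ : ℝ → ℝ) (x : S2) (z : V3) :
    Matrix (Fin 2) (Fin 2) ℝ :=
  c (z.1 0) • coordMetric (path (τ (z.1 0))) basis2 x z.2

lemma extChartAt_I3_target (p : HalfCylinder) : (extChartAt I3 p).target = range I3 := by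
  rw [extChartAt_prod, PartialEquiv.prod_target, ModelWithCorners.range_prod, extChartAt_S2_target]
  rw [extChartAt_target, chartAt_self_eq]
  simp

lemma extChartAt_I3_apply (p q : HalfCylinder) :
    extChartAt I3 p q = (q.1.1, extChartAt (𝓡 2) p.2 q.2) := by
  rw [extChartAt_prod]
  rfl

lemma extChartAt_I3_symm {p : HalfCylinder} {z : V3} (hz : z ∈ range I3) :
    height ((extChartAt I3 p).symm z) = z.1 0 ∧ ((extChartAt I3 p).symm z).2 = chartInv p.2 z.2 := by
  have h := (extChartAt I3 p).right_inv (by rw [extChartAt_I3_target]; exact hz)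
  rw [extChartAt_I3_apply] at h
  refine ⟨congrArg (fun v : V3 => v.1 0) h, ?_⟩
  rw [extChartAt_prod]
  rfl

namespace CollarData
variable (D : CollarData path u c τ)
include D

lemma coordMetric_eq (p : HalfCylinder) {z : V3} (hz : z ∈ range I3) :
    coordMetric D.metric basis3 p z = blockMetric u (collarBlock path c τ p.2) z := by
  obtain ⟨h1, h2⟩ := extChartAt_I3_symm (p := p) hz
  have hz' : z ∈ (extChartAt I3 p).target := by rw [extChartAt_I3_target]; exact hz
  have hsrc : ((extChartAt I3 p).symm z).2 ∈ (chartAt E2 p.2).source := by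
    have := (extChartAt I3 p).map_target hz'
    rw [extChartAt_source, prodChartedSpace_chartAt] at this
    exact this.2
  have hy : z.2 ∈ (extChartAt (𝓡 2) p.2).target := by rw [extChartAt_S2_target]; trivial
  have key : ∀ i j, coordMetric D.metric basis3 p z i j =
      u (z.1 0) * ((basis3 i).1 0 * (basis3 j).1 0) + c (z.1 0) *
        planeForm (path (τ (z.1 0))) (chartInv p.2 z.2)
          (chartFrame (𝓡 2) p.2 (basis3 i).2 (chartInv p.2 z.2))
          (chartFrame (𝓡 2) p.2 (basis3 j).2 (chartInv p.2 z.2)) := by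
    intro i j
    rw [coordMetric_apply _ _ _ hz', ← h1, ← h2]
    exact (congrArg₂ (fun v w : V3 => collarForm path u c τ _ v w) (chartFrame_I3 hsrc _)
      (chartFrame_I3 hsrc _)).trans (blockForm_apply _ _ _ _ _)
  have hz0 : chartFrame (𝓡 2) p.2 0 (chartInv p.2 z.2) = 0 := by
    have := chartFrame_sum (𝓡 2) (∅ : Finset (Fin 2)) (p := p.2) (q := chartInv p.2 z.2)
      (by rw [← h2]; exact hsrc) (fun _ => 0) (fun _ => 0)
    simpa using this
  ext i j
  rw [key]
  rcases i with i | i <;> rcases j with j | j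
  · obtain rfl := Subsingleton.elim i 0
    obtain rfl := Subsingleton.elim j 0
    rw [basis3_inl, hz0]
    simp [blockMetric]
    exact Or.inr (planeForm_zero_left _ _ _)
  · obtain rfl := Subsingleton.elim i 0
    rw [basis3_inl, basis3_inr, hz0]
    simp [blockMetric]
    exact Or.inr (planeForm_zero_left _ _ _)
  · obtain rfl := Subsingleton.elim j 0
    rw [basis3_inl, basis3_inr, hz0]
    simp [blockMetric]
    exact Or.inr (planeForm_zero_right _ _ _)
  · rw [basis3_inr, basis3_inr]
    simp only [blockMetric, Matrix.fromBlocks_apply₂₂, collarBlock, Matrix.smul_apply, smul_eq_mul,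
      coordMetric_apply _ _ _ hy]
    rw [PiLp.zero_apply, zero_mul, mul_zero, zero_add]
    rfl

lemma smoothBlock (x : S2) : SmoothBlock u (collarBlock path c τ x) where
  smooth_u := D.smooth_u
  u_ne s hs := (D.u_pos s hs).ne'
  smooth_h i j := by
    have h1 := contDiffOn_coordMetric D.metric basis3 ((⟨0, le_rfl⟩, x) : HalfCylinder)
      (Sum.inr i) (Sum.inr j)
    rw [extChartAt_I3_target] at h1
    refine h1.congr fun z hz => ?_
    rw [D.coordMetric_eq _ hz]
    rfl
  symm_h z hz i j := by
    simp only [collarBlock, Matrix.smul_apply]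
    rw [coordMetric_symm]
  det_ne z hz := by
    rw [range_I3] at hz
    rw [collarBlock, Matrix.det_smul]
    exact mul_ne_zero (pow_ne_zero _ (D.c_pos _ hz).ne') (coordMetric_posDef_S2 _ x _).det_pos.ne'

end CollarData
end Collar

/-! ### The curvature of the half-cylinder -/

section CollarCurvature

variable {path : ℝ → SphereMetric} {u c τ : ℝ → ℝ}

/-- The radial derivative is the one-sided derivative along the half-line. -/
lemma coordDeriv_inl_eq_of_line {f : V3 → ℝ} {z : V3} (hz : z ∈ range I3)
    (hf : DifferentiableWithinAt ℝ f (range I3) z) {f' : ℝ}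
    (h : HasDerivWithinAt (fun s : ℝ => f (EuclideanSpace.single 0 s, z.2)) f' (Ici 0) (z.1 0)) :
    coordDeriv I3 basis3 (Sum.inl 0) f z = f' := by
  have hz1 : ∀ v : EuclideanSpace ℝ (Fin 1), EuclideanSpace.single 0 (v 0) = v := by
    intro v; ext i; obtain rfl := Subsingleton.elim i 0; simp
  set L : ℝ →L[ℝ] V3 := (ContinuousLinearMap.inl ℝ (EuclideanSpace ℝ (Fin 1)) E2).comp
    (ContinuousLinearMap.toSpanSingleton ℝ (EuclideanSpace.single 0 1)) with hL
  have hl : HasDerivWithinAt (fun s : ℝ => ((EuclideanSpace.single 0 s, z.2) : V3))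
      ((EuclideanSpace.single 0 1, 0) : V3) (Ici 0) (z.1 0) := by
    have h1 := (L.hasDerivAt (x := z.1 0)).add_const ((0, z.2) : V3)
    have e1 : (fun s : ℝ => ((EuclideanSpace.single 0 s, z.2) : V3)) =
        fun s => L s + ((0, z.2) : V3) := by
      funext s
      refine Prod.ext ?_ ?_
      · ext i; obtain rfl := Subsingleton.elim i 0; simp [L]
      · simp [L]
    rw [e1]
    refine HasDerivAt.hasDerivWithinAt ?_
    convert! h1 using 1
    simp [L]
  have hzz : ((EuclideanSpace.single 0 (z.1 0), z.2) : V3) = z := by rw [hz1]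
  rw [← hzz] at hf
  have h2 := hf.hasFDerivWithinAt.comp_hasDerivWithinAt (z.1 0) hl (fun s hs => by
    rw [range_I3]; simpa using hs)
  rw [hzz] at h2
  rw [range_I3] at hz
  have h3 := (uniqueDiffOn_Ici (0 : ℝ) _ hz).eq_deriv _ h h2
  rw [coordDeriv, basis3_inl]
  exact h3.symm

namespace CollarData
variable (D : CollarData path u c τ)
include D

/-- The radial derivative of the sphere part of the collar metric, in a frame related to the
standard one by the matrix `A`. -/
lemma radialDeriv_collarBlock (x : S2) {z : V3} (hz : z ∈ range I3)
    {A : Matrix (Fin 2) (Fin 2) ℝ}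
    (hA : ∀ g : SphereMetric,
      coordMetric g basis2 x z.2 = A.transpose * gram g (chartInv x z.2) * A) :
    radialDeriv (collarBlock path c τ x) z =
      deriv c (z.1 0) • (A.transpose * gram (path (τ (z.1 0))) (chartInv x z.2) * A)
        + (c (z.1 0) * deriv τ (z.1 0)) •
          (A.transpose * gramDeriv path (τ (z.1 0)) (chartInv x z.2) * A) := by
  have hz0 : 0 ≤ z.1 0 := by rw [range_I3] at hz; exact hz
  ext i j
  refine coordDeriv_inl_eq_of_line hz ((D.smoothBlock x).diff_h hz i j) ?_
  have e1 : (fun s : ℝ => collarBlock path c τ x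
      ((EuclideanSpace.single 0 s, z.2) : V3) i j) = fun s =>
        c s * ∑ l, (∑ k, A k i * gram (path (τ s)) (chartInv x z.2) k l) * A l j := by
    funext s
    rw [collarBlock, Matrix.smul_apply, smul_eq_mul, hA]
    simp [Matrix.mul_apply]
  rw [e1]
  have hc : HasDerivWithinAt c (deriv c (z.1 0)) (Ici 0) (z.1 0) :=
    ((D.smooth_c _ hz0).differentiableAt (by simp)).hasDerivAt.hasDerivWithinAt
  have hτ : HasDerivWithinAt τ (deriv τ (z.1 0)) (Ici 0) (z.1 0) :=
    ((D.smooth_τ _ hz0).differentiableAt (by simp)).hasDerivAt.hasDerivWithinAt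
  have hg : ∀ k l, HasDerivWithinAt (fun s => gram (path (τ s)) (chartInv x z.2) k l)
      (gramDeriv path (τ (z.1 0)) (chartInv x z.2) k l * deriv τ (z.1 0)) (Ici 0) (z.1 0) :=
    fun k l => (D.smooth_path.hasDerivWithinAt_gram _ k l (D.τ_mem _ hz0)).comp _ hτ
      fun s hs => D.τ_mem s hs
  have hsum : HasDerivWithinAt
      (fun s => ∑ l, (∑ k, A k i * gram (path (τ s)) (chartInv x z.2) k l) * A l j)
      (∑ l, (∑ k, A k i * (gramDeriv path (τ (z.1 0)) (chartInv x z.2) k l * deriv τ (z.1 0)))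
        * A l j) (Ici 0) (z.1 0) :=
    HasDerivWithinAt.fun_sum fun l _ =>
      (HasDerivWithinAt.fun_sum fun k _ => (hg k l).const_mul _).mul_const _
  convert! hc.mul hsum using 1
  simp only [Matrix.add_apply, Matrix.smul_apply, Matrix.mul_apply, Matrix.transpose_apply,
    smul_eq_mul, Fin.sum_univ_two]
  ring

omit D in
/-- For a congruence `A`, the endomorphisms `G⁻¹ S` are conjugate by `A`. -/
lemma inv_congr_mul {A G S : Matrix (Fin 2) (Fin 2) ℝ} (hA : A.det ≠ 0) :
    (A.transpose * G * A)⁻¹ * (A.transpose * S * A) = A⁻¹ * (G⁻¹ * S) * A := by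
  have h1 : (A.transpose)⁻¹ * A.transpose = 1 :=
    Matrix.nonsing_inv_mul _ (by rw [Matrix.det_transpose]; exact hA.isUnit)
  rw [Matrix.mul_inv_rev, Matrix.mul_inv_rev]
  calc A⁻¹ * (G⁻¹ * A.transpose⁻¹) * (A.transpose * S * A)
      = A⁻¹ * G⁻¹ * (A.transpose⁻¹ * A.transpose) * S * A := by simp only [Matrix.mul_assoc]
    _ = _ := by rw [h1]; simp only [Matrix.mul_assoc, Matrix.mul_one]

/-- The endomorphism `h⁻¹ ∂_s h` is, up to conjugation, `(c' / c) + τ' g⁻¹ g'`. -/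
lemma inv_mul_radialDeriv (x : S2) {z : V3} (hz : z ∈ range I3) :
    ∃ A : Matrix (Fin 2) (Fin 2) ℝ, A.det ≠ 0 ∧
    (collarBlock path c τ x z)⁻¹ * radialDeriv (collarBlock path c τ x) z =
      (deriv c (z.1 0) / c (z.1 0)) • 1 + deriv τ (z.1 0) •
        (A⁻¹ * ((gram (path (τ (z.1 0))) (chartInv x z.2))⁻¹ *
          gramDeriv path (τ (z.1 0)) (chartInv x z.2)) * A) := by
  have hz0 : 0 ≤ z.1 0 := by rw [range_I3] at hz; exact hz
  obtain ⟨A, hA⟩ := exists_coordMetric_eq_congr x z.2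
  set t := τ (z.1 0)
  have hdet : (A.transpose * gram (path t) (chartInv x z.2) * A).det ≠ 0 := by
    rw [← hA]
    exact (coordMetric_posDef_S2 (path t) x z.2).det_pos.ne'
  have hAd : A.det ≠ 0 := by
    intro h0
    rw [Matrix.det_mul, h0, mul_zero] at hdet
    exact hdet rfl
  have hc : c (z.1 0) ≠ 0 := (D.c_pos _ hz0).ne'
  refine ⟨A, hAd, ?_⟩
  rw [D.radialDeriv_collarBlock x hz hA, collarBlock, hA, ← inv_congr_mul hAd, Matrix.mul_add]
  have hinv : (c (z.1 0) • (A.transpose * gram (path t) (chartInv x z.2) * A))⁻¹ =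
      (c (z.1 0))⁻¹ • (A.transpose * gram (path t) (chartInv x z.2) * A)⁻¹ := by
    apply Matrix.inv_eq_right_inv
    rw [Matrix.smul_mul, Matrix.mul_smul, smul_smul, mul_inv_cancel₀ hc, one_smul,
      Matrix.mul_nonsing_inv _ hdet.isUnit]
  rw [hinv]
  congr 1
  · rw [Matrix.smul_mul, Matrix.mul_smul, smul_smul, Matrix.nonsing_inv_mul _ hdet.isUnit]
    congr 1
    field_simp
  · rw [Matrix.smul_mul, Matrix.mul_smul, smul_smul]
    congr 1
    field_simp

lemma trace_shape (x : S2) {z : V3} (hz : z ∈ range I3)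
    (htr : ∀ t ∈ Icc (0 : ℝ) 1, ∀ x, traceDeriv path t x = 0) :
    ((collarBlock path c τ x z)⁻¹ * radialDeriv (collarBlock path c τ x) z).trace =
      2 * (deriv c (z.1 0) / c (z.1 0)) := by
  have hz0 : 0 ≤ z.1 0 := by rw [range_I3] at hz; exact hz
  obtain ⟨A, hA, h⟩ := D.inv_mul_radialDeriv x hz
  have h1 := htr _ (D.τ_mem _ hz0) (chartInv x z.2)
  rw [traceDeriv] at h1
  rw [h, Matrix.trace_add, Matrix.trace_smul, Matrix.trace_smul, Matrix.trace_mul_comm,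
    ← Matrix.mul_assoc, Matrix.mul_nonsing_inv _ hA.isUnit, Matrix.one_mul, h1]
  simp
  ring

lemma trace_shape_sq (x : S2) {z : V3} (hz : z ∈ range I3)
    (htr : ∀ t ∈ Icc (0 : ℝ) 1, ∀ x, traceDeriv path t x = 0) :
    ((collarBlock path c τ x z)⁻¹ * radialDeriv (collarBlock path c τ x) z *
      (collarBlock path c τ x z)⁻¹ * radialDeriv (collarBlock path c τ x) z).trace =
      2 * (deriv c (z.1 0) / c (z.1 0)) ^ 2
        + deriv τ (z.1 0) ^ 2 * normSqDeriv path (τ (z.1 0)) (chartInv x z.2) := by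
  have hz0 : 0 ≤ z.1 0 := by rw [range_I3] at hz; exact hz
  obtain ⟨A, hA, h⟩ := D.inv_mul_radialDeriv x hz
  have h1 := htr _ (D.τ_mem _ hz0) (chartInv x z.2)
  rw [traceDeriv] at h1
  rw [normSqDeriv]
  rw [Matrix.mul_assoc _ (collarBlock path c τ x z)⁻¹, Matrix.mul_assoc _ (gram _ _)⁻¹, h]
  generalize (gram (path (τ (z.1 0))) (chartInv x z.2))⁻¹ *
    gramDeriv path (τ (z.1 0)) (chartInv x z.2) = T at *
  have h2 : (A⁻¹ * T * A).trace = 0 := by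
    rw [Matrix.trace_mul_comm, ← Matrix.mul_assoc, Matrix.mul_nonsing_inv _ hA.isUnit,
      Matrix.one_mul, h1]
  have h3 : ((A⁻¹ * T * A) * (A⁻¹ * T * A)).trace = (T * T).trace := by
    have : (A⁻¹ * T * A) * (A⁻¹ * T * A) = A⁻¹ * (T * (A * A⁻¹) * T) * A := by
      simp only [Matrix.mul_assoc]
    rw [this, Matrix.mul_nonsing_inv _ hA.isUnit, Matrix.mul_one, Matrix.trace_mul_comm,
      ← Matrix.mul_assoc, Matrix.mul_nonsing_inv _ hA.isUnit, Matrix.one_mul]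
  generalize A⁻¹ * T * A = Z at *
  rw [← h3]
  rw [Matrix.trace_fin_two] at h2 ⊢
  simp [Matrix.mul_apply, Fin.sum_univ_two, Matrix.trace_fin_two] at h2 ⊢
  linear_combination 2 * (deriv c (z.1 0) / c (z.1 0)) * deriv τ (z.1 0) * h2

/-- The scalar curvature of the warped metric `u(s) ds² + c(s) g(τ(s))`. -/
theorem scalarCurvature_eq (htr : ∀ t ∈ Icc (0 : ℝ) 1, ∀ x, traceDeriv path t x = 0)
    {θ : ℝ → ℝ} (hθ : ∀ s, 0 ≤ s → DifferentiableAt ℝ θ s)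
    (hcθ : ∀ s, 0 ≤ s → deriv c s = θ s * c s) (p : HalfCylinder) :
    scalarCurvature D.metric basis3 p =
      2 * gaussCurvature (path (τ (height p))) p.2 / c (height p) + (u (height p))⁻¹ *
        (-2 * deriv θ (height p) - θ (height p) ^ 2
          + θ (height p) * deriv u (height p) / u (height p)
          - 1 / 4 * (2 * θ (height p) ^ 2 + deriv τ (height p) ^ 2 *
              normSqDeriv path (τ (height p)) p.2)) := by
  have hz : extChartAt I3 p p ∈ range I3 := by
    rw [← extChartAt_I3_target p]; exact mem_extChartAt_target p
  have hz1 : (extChartAt I3 p p).1 0 = height p := by rw [extChartAt_I3_apply]; rfl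
  have hz2 : (extChartAt I3 p p).2 = extChartAt (𝓡 2) p.2 p.2 := by rw [extChartAt_I3_apply]
  have hx : chartInv p.2 (extChartAt (𝓡 2) p.2 p.2) = p.2 := extChartAt_to_inv p.2
  have hθc : ∀ s, 0 ≤ s → deriv c s / c s = θ s := by
    intro s hs
    rw [hcθ s hs, mul_div_cancel_right₀ _ (D.c_pos s hs).ne']
  rw [scalarCurvature_eq_matScalar]
  rw [matScalar_congr (fun z hz => D.coordMetric_eq p hz) hz]
  rw [(D.smoothBlock p.2).scalar_eq hθ ?_ hz, D.trace_shape_sq _ hz htr, hz1, hz2, hx,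
    hθc _ (height_nonneg p)]
  · congr 1
    have : (fun y => collarBlock path c τ p.2 ((extChartAt I3 p p).1, y)) =
        fun y => c (height p) • coordMetric (path (τ (height p))) basis2 p.2 y := by
      funext y
      rw [collarBlock, hz1]
    rw [this, matScalar_smul (D.c_pos _ (height_nonneg p)).ne' _ (mem_range_S2 _), gaussCurvature,
      scalarCurvature_eq_matScalar]
    field_simp
  · intro z hz
    have hz0 : 0 ≤ z.1 0 := by rw [range_I3] at hz; exact hz
    have h1 := D.trace_shape p.2 hz htr
    rw [hθc _ hz0] at h1
    rw [← h1, Matrix.trace]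
    refine Finset.sum_congr rfl fun i _ => ?_
    rw [Matrix.diag_apply, Matrix.mul_apply]
    refine Finset.sum_congr rfl fun j _ => ?_
    rw [(D.smoothBlock p.2).radialDeriv_symm hz]

end CollarData
end CollarCurvature

/-! ### The slices of the half-cylinder -/

section Slices

variable {path : ℝ → SphereMetric} {u c τ : ℝ → ℝ}

lemma contMDiff_slice (s : EuclideanHalfSpace 1) :
    ContMDiff (𝓡 2) I3 ∞ (fun q : S2 => ((s, q) : HalfCylinder)) :=
  contMDiff_const.prodMk contMDiff_id

lemma mfderiv_slice (s : EuclideanHalfSpace 1) (x : S2) (v : E2) :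
    (mfderiv (𝓡 2) I3 (fun q : S2 => ((s, q) : HalfCylinder)) x v : V3) = ((0, v) : V3) := by
  have := mfderiv_prod_right (I := 𝓡∂ 1) (I' := 𝓡 2) (x₀ := s) (y₀ := x)
  exact congrArg (fun L : E2 →L[ℝ] V3 => L v) this

lemma coordMap_slice (s : EuclideanHalfSpace 1) (x : S2) (y : E2) :
    coordMap (𝓡 2) I3 (fun q : S2 => ((s, q) : HalfCylinder)) x y = ((s.1, y) : V3) := by
  rw [coordMap, extChartAt_I3_apply]
  exact Prod.ext rfl ((extChartAt (𝓡 2) x).right_inv (by rw [extChartAt_S2_target]; trivial))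

/-- In charts the slices are affine, so only the Christoffel symbols contribute. -/
lemma covSecondDeriv_slice (γ : RiemMetric I3 HalfCylinder) (s : EuclideanHalfSpace 1) (x : S2)
    (i j : Fin 2) :
    (covSecondDeriv (𝓡 2) γ basis3 basis2 (fun q : S2 => ((s, q) : HalfCylinder)) x i j : V3) =
      ∑ k, christoffel γ basis3 ((s, x) : HalfCylinder) k (Sum.inr i) (Sum.inr j)
        (extChartAt I3 ((s, x) : HalfCylinder) (s, x)) • basis3 k := by
  have h1 : coordMap (𝓡 2) I3 (fun q : S2 => ((s, q) : HalfCylinder)) x =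
      fun y => ((s.1, y) : V3) := funext fun y => coordMap_slice s x y
  have h2 : ∀ (a : Fin 2) (z : E2),
      fderivWithin ℝ (coordMap (𝓡 2) I3 (fun q : S2 => ((s, q) : HalfCylinder)) x) (range (𝓡 2)) z
        (basis2 a) = basis3 (Sum.inr a) := by
    intro a z
    rw [h1, modelWithCornersSelf_coe, range_id, fderivWithin_univ,
      (hasFDerivAt_prodMk_right s.1 z).fderiv, basis3_inr]
    simp
  have h3 : ∀ (a : Fin 2) (z : E2), fderivWithin ℝ (fun z =>
      fderivWithin ℝ (coordMap (𝓡 2) I3 (fun q : S2 => ((s, q) : HalfCylinder)) x) (range (𝓡 2)) z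
        (basis2 a)) (range (𝓡 2)) z = 0 := by
    intro a z
    simp only [h2]
    simp
  simp only [covSecondDeriv]
  rw [h3]
  simp only [h2, Basis.repr_self]
  refine (zero_add _).trans ?_
  refine Finset.sum_congr rfl fun k _ => ?_
  congr 1
  rw [Finset.sum_eq_single (Sum.inr i), Finset.sum_eq_single (Sum.inr j)]
  · simp
  · intro b _ hb
    simp [hb.symm]
  · simp
  · intro b _ hb
    refine Finset.sum_eq_zero fun d _ => ?_
    simp [Finsupp.single_apply, hb.symm]
  · simp

namespace CollarData
variable (D : CollarData path u c τ)

/-- The unit normal `u^{-1/2} ∂_s` of the slices. -/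
def normal (u : ℝ → ℝ) (s : EuclideanHalfSpace 1) : V3 :=
  (EuclideanSpace.single 0 (√(u (s.1 0)))⁻¹, 0)

include D

/-- The inner product with the normal, for arbitrary vectors. -/
lemma inner_normal (s : EuclideanHalfSpace 1) (x : S2) (w : V3) :
    D.metric.inner ((s, x) : HalfCylinder) (normal u s) w = √(u (s.1 0)) * w.1 0 := by
  refine (D.metric_apply _ _ _).trans ?_
  have hu := D.u_pos _ s.2
  have h2 : √(u (s.1 0)) ≠ 0 := (Real.sqrt_pos.2 hu).ne'
  have h1 : u (s.1 0) = √(u (s.1 0)) * √(u (s.1 0)) := (Real.mul_self_sqrt hu.le).symm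
  have e : planeForm (path (τ (height ((s, x) : HalfCylinder)))) x (normal u s).2 w.2 = 0 :=
    planeForm_zero_left _ _ _
  rw [e, mul_zero, add_zero]
  show u (s.1 0) * (_ * _) = _
  simp only [normal]
  rw [PiLp.single_apply, if_pos rfl]
  nth_rw 1 [h1]
  field_simp

lemma isUnitNormal_slice (s : EuclideanHalfSpace 1) (x : S2) :
    IsUnitNormal (𝓡 2) D.metric (fun q : S2 => ((s, q) : HalfCylinder)) x (normal u s) := by
  have hu := D.u_pos _ s.2
  refine ⟨(D.inner_normal s x _).trans ?_, fun v => (D.inner_normal s x _).trans ?_⟩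
  · simp only [normal]
    rw [PiLp.single_apply, if_pos rfl]
    exact mul_inv_cancel₀ (Real.sqrt_pos.2 hu).ne'
  · have := mfderiv_slice s x v
    rw [this]
    simp

lemma pullback_slice (s : EuclideanHalfSpace 1) (x : S2) (v w : E2) :
    pullback (𝓡 2) D.metric (fun q : S2 => ((s, q) : HalfCylinder)) x v w =
      c (s.1 0) * planeForm (path (τ (s.1 0))) x v w := by
  refine (congrArg₂ (fun v w : V3 => collarForm path u c τ ((s, x) : HalfCylinder) v w)
    (mfderiv_slice s x v) (mfderiv_slice s x w)).trans ?_
  refine (blockForm_apply _ _ _ _ _).trans ?_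
  simp [height]

/-- The mean curvature of the slices: half the trace of `h⁻¹ ∂_s h`, divided by the lapse. -/
theorem meanCurvature_slice (htr : ∀ t ∈ Icc (0 : ℝ) 1, ∀ x, traceDeriv path t x = 0)
    (s : EuclideanHalfSpace 1) (x : S2) :
    meanCurvature (𝓡 2) D.metric basis3 basis2 (fun q : S2 => ((s, q) : HalfCylinder)) x
      (normal u s) = deriv c (s.1 0) / c (s.1 0) / √(u (s.1 0)) := by
  set p : HalfCylinder := (s, x) with hp
  have hz : extChartAt I3 p p ∈ range I3 := by
    rw [← extChartAt_I3_target p]; exact mem_extChartAt_target p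
  have hz1 : (extChartAt I3 p p).1 0 = s.1 0 := by rw [extChartAt_I3_apply]
  have hz2 : (extChartAt I3 p p).2 = extChartAt (𝓡 2) x x := by rw [extChartAt_I3_apply]
  have hu := D.u_pos _ s.2
  have hu2 : √(u (s.1 0)) ≠ 0 := (Real.sqrt_pos.2 hu).ne'
  have h1 : (Matrix.of fun i j : Fin 2 => pullback (𝓡 2) D.metric
      (fun q : S2 => ((s, q) : HalfCylinder)) x (basis2 i : E2) (basis2 j : E2)) =
      collarBlock path c τ x (extChartAt I3 p p) := by
    ext i j
    refine (D.pullback_slice s x _ _).trans ?_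
    rw [collarBlock, hz1, hz2, ← gram_eq_coordMetric]
    rfl
  have h2 : ∀ i j : Fin 2, D.metric.inner p (normal u s)
      (covSecondDeriv (𝓡 2) D.metric basis3 basis2 (fun q : S2 => ((s, q) : HalfCylinder)) x i j) =
      -(1 / 2 * (√(u (s.1 0)))⁻¹ * radialDeriv (collarBlock path c τ x) (extChartAt I3 p p) i j) := by
    intro i j
    refine (D.inner_normal s x _).trans ?_
    rw [covSecondDeriv_slice]
    have e1 : (∑ k, christoffel D.metric basis3 p k (Sum.inr i) (Sum.inr j) (extChartAt I3 p p) •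
        basis3 k).1 0 =
        christoffel D.metric basis3 p (Sum.inl 0) (Sum.inr i) (Sum.inr j) (extChartAt I3 p p) := by
      rw [Fintype.sum_sum_type]
      simp [basis3_inl, basis3_inr]
    rw [e1, christoffel_eq_matChristoffel,
      matChristoffel_congr (fun z hz => D.coordMetric_eq p hz) _ _ _ hz, (D.smoothBlock x).chr_0ij hz, hz1]
    have e2 : √(u (s.1 0)) * (u (s.1 0))⁻¹ = (√(u (s.1 0)))⁻¹ := by
      rw [← div_eq_mul_inv, Real.sqrt_div_self', one_div]
    linear_combination (-(1 / 2) *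
      radialDeriv (collarBlock path c τ x) (extChartAt I3 p p) i j) * e2
  have h3 := D.trace_shape x hz htr
  rw [hz1] at h3
  have h4 : ∀ i j : Fin 2, (collarBlock path c τ x (extChartAt I3 p p))⁻¹ i j *
      -(D.metric.inner p (normal u s) (covSecondDeriv (𝓡 2) D.metric basis3 basis2
        (fun q : S2 => ((s, q) : HalfCylinder)) x i j)) =
      1 / 2 * (√(u (s.1 0)))⁻¹ * ((collarBlock path c τ x (extChartAt I3 p p))⁻¹ i j *
        radialDeriv (collarBlock path c τ x) (extChartAt I3 p p) j i) := by
    intro i j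
    rw [h2, (D.smoothBlock x).radialDeriv_symm hz j i]
    ring
  have h5 : meanCurvature (𝓡 2) D.metric basis3 basis2 (fun q : S2 => ((s, q) : HalfCylinder)) x
      (normal u s) = ∑ i, ∑ j, (collarBlock path c τ x (extChartAt I3 p p))⁻¹ i j *
      -(D.metric.inner p (normal u s) (covSecondDeriv (𝓡 2) D.metric basis3 basis2
        (fun q : S2 => ((s, q) : HalfCylinder)) x i j)) := by
    rw [← h1]; rfl
  refine h5.trans ?_
  refine (Finset.sum_congr rfl fun i _ => Finset.sum_congr rfl fun j _ => h4 i j).trans ?_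
  simp only [← Finset.mul_sum]
  rw [Matrix.trace] at h3
  simp only [Matrix.diag_apply, Matrix.mul_apply] at h3
  rw [h3]
  field_simp

end CollarData

lemma boundary_halfCylinder (p : HalfCylinder) : p ∈ I3.boundary HalfCylinder ↔ height p = 0 := by
  rw [ModelWithCorners.boundary_of_boundaryless_right]
  refine (and_iff_left (mem_univ _)).trans ?_
  rw [ModelWithCorners.boundary, mem_ofPred_eq, ModelWithCorners.isBoundaryPoint_iff, 
    frontier_range_modelWithCornersEuclideanHalfSpace]
  exact eq_comm

end Slices

/-! ### Maps into the half-cylinder -/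

section HalfCylinderMaps

/-- Tangent vectors of the half-cylinder are determined by their images under the differentials of
the two projections; this is the first one. -/
lemma mfderiv_height (p : HalfCylinder) (v : V3) :
    (mfderiv I3 𝓘(ℝ, ℝ) height p v : ℝ) = v.1 0 := by
  have h1 : height = radialForm ∘ (extChartAt I3 p) := by
    funext q
    rw [Function.comp_apply, extChartAt_I3_apply]
    rfl
  have h2 : mfderiv I3 𝓘(ℝ, ℝ) (radialForm ∘ (extChartAt I3 p)) p =
      (mfderiv 𝓘(ℝ, V3) 𝓘(ℝ, ℝ) radialForm (extChartAt I3 p p)).comp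
        (mfderiv I3 𝓘(ℝ, V3) (extChartAt I3 p) p) :=
    mfderiv_comp p (radialForm.differentiableAt.mdifferentiableAt)
      (mdifferentiableAt_extChartAt (mem_chart_source _ p))
  rw [h1]
  refine (congrArg (fun L : V3 →L[ℝ] ℝ => L v) h2).trans ?_
  have h3 : (mfderiv I3 𝓘(ℝ, V3) (extChartAt I3 p) p : V3 →L[ℝ] V3) v = v :=
    congrArg (fun L : V3 →L[ℝ] V3 => L v) (mfderiv_extChartAt_self (I := I3) (x := p))
  refine (congrArg (fun w : V3 => (mfderiv 𝓘(ℝ, V3) 𝓘(ℝ, ℝ) radialForm (extChartAt I3 p p)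
    : V3 →L[ℝ] ℝ) w) h3).trans ?_
  rw [mfderiv_eq_fderiv, radialForm.fderiv]
  rfl

variable {E' : Type*} [NormedAddCommGroup E'] [NormedSpace ℝ E']
  {H' : Type*} [TopologicalSpace H'] {J : ModelWithCorners ℝ E' H'}
  {N : Type*} [TopologicalSpace N] [ChartedSpace H' N]

lemma mfderiv_fst_zero {F : N → HalfCylinder} {x : N} (hF : MDifferentiableAt J I3 F x) (v : E') :
    (mfderiv J I3 F x v : V3).1 0 = (mfderiv J 𝓘(ℝ, ℝ) (fun q => height (F q)) x v : ℝ) := by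
  have h := mfderiv_comp x (contMDiff_height.mdifferentiable (by simp) (F x)) hF
  have h2 := congrArg (fun L : E' →L[ℝ] ℝ => L v) h
  exact ((mfderiv_height (F x) (mfderiv J I3 F x v : V3)).symm).trans h2.symm

lemma mfderiv_snd_eq {F : N → HalfCylinder} {x : N} (hF : MDifferentiableAt J I3 F x) (v : E') :
    (mfderiv J I3 F x v : V3).2 = (mfderiv J (𝓡 2) (fun q => (F q).2) x v : E2) := by
  have h := mfderiv_comp x (mdifferentiableAt_snd (I := 𝓡∂ 1) (I' := 𝓡 2) (x := F x)) hF
  have h2 := congrArg (fun L : E' →L[ℝ] E2 => L v) h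
  have h3 := congrArg (fun L : V3 →L[ℝ] E2 => L (mfderiv J I3 F x v : V3))
    (mfderiv_snd (I := 𝓡∂ 1) (I' := 𝓡 2) (x := F x))
  exact (h2.trans h3).symm

end HalfCylinderMaps

/-! ### The cylindrical end -/

section End

/-- The point of `[0, ∞)` with coordinate `max s 0`. -/
def halfPoint (s : ℝ) : EuclideanHalfSpace 1 := (𝓡∂ 1).symm (EuclideanSpace.single 0 s)

lemma halfPoint_apply {s : ℝ} (hs : 0 ≤ s) : (halfPoint s).1 0 = s := by
  have h : (𝓡∂ 1) (halfPoint s) = EuclideanSpace.single 0 s :=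
    (𝓡∂ 1).right_inv (by rw [range_modelWithCornersEuclideanHalfSpace]; simpa using hs)
  have := congrArg (fun v : EuclideanSpace ℝ (Fin 1) => v 0) h
  simpa using this

lemma halfPoint_height (s : EuclideanHalfSpace 1) : halfPoint (s.1 0) = s := by
  apply EuclideanHalfSpace.ext
  ext i
  obtain rfl := Subsingleton.elim i 0
  exact halfPoint_apply s.2

lemma contMDiffOn_halfPoint : ContMDiffOn 𝓘(ℝ, ℝ) (𝓡∂ 1) ∞ halfPoint (Ici 0) := by
  have h1 : ContMDiff 𝓘(ℝ, ℝ) 𝓘(ℝ, EuclideanSpace ℝ (Fin 1)) ∞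
      (fun s : ℝ => (EuclideanSpace.single 0 s : EuclideanSpace ℝ (Fin 1))) := by
    have : (fun s : ℝ => (EuclideanSpace.single 0 s : EuclideanSpace ℝ (Fin 1))) =
        ContinuousLinearMap.toSpanSingleton ℝ (EuclideanSpace.single 0 1) := by
      funext s
      ext i
      obtain rfl := Subsingleton.elim i 0
      simp
    rw [this]
    exact (ContinuousLinearMap.contDiff _).contMDiff
  refine (ModelWithCorners.contMDiffOn_symm (I := 𝓡∂ 1)).comp h1.contMDiffOn fun s hs => ?_
  rw [mem_preimage, range_modelWithCornersEuclideanHalfSpace]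
  simpa using hs

/-- The region `{height + ro > R}` of the half-cylinder, parametrized by `r = height + ro` and the
inverse of a diffeomorphism `φ` of the sphere. -/
def cylinderEnd (ro R : ℝ) (hR : ro ≤ R) (φ : S2 ≃ₘ^∞⟮𝓡 2, 𝓡 2⟯ S2) :
    PartialDiffeomorph (𝓘(ℝ, ℝ).prod (𝓡 2)) I3 (ℝ × S2) HalfCylinder ∞ where
  toFun q := (halfPoint (q.1 - ro), φ.symm q.2)
  invFun p := (height p + ro, φ p.2)
  source := Ioi R ×ˢ univ
  target := {p | R < height p + ro}
  map_source' q hq := by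
    have h : R < q.1 := hq.1
    show R < (halfPoint (q.1 - ro)).1 0 + ro
    rw [halfPoint_apply (by linarith)]
    linarith
  map_target' p hp := ⟨hp, trivial⟩
  left_inv' q hq := by
    have h : R < q.1 := hq.1
    refine Prod.ext ?_ (φ.apply_symm_apply _)
    show (halfPoint (q.1 - ro)).1 0 + ro = q.1
    rw [halfPoint_apply (by linarith)]
    ring
  right_inv' p hp := by
    refine Prod.ext ?_ (φ.symm_apply_apply _)
    show halfPoint (height p + ro - ro) = p.1
    rw [add_sub_cancel_right]
    exact halfPoint_height p.1
  open_source := isOpen_Ioi.prod isOpen_univ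
  open_target := isOpen_lt continuous_const (contMDiff_height.continuous.add continuous_const)
  contMDiffOn_toFun := by
    refine ContMDiffOn.prodMk ?_ ?_
    · refine contMDiffOn_halfPoint.comp (t := Ici 0) ?_ fun q hq => ?_
      · exact (contMDiff_fst.sub contMDiff_const).contMDiffOn
      · have h : R < q.1 := hq.1
        show 0 ≤ q.1 - ro
        linarith
    · exact (φ.symm.contMDiff.comp contMDiff_snd).contMDiffOn
  contMDiffOn_invFun :=
    ((contMDiff_height.add contMDiff_const).prodMk (φ.contMDiff.comp contMDiff_snd)).contMDiffOn

lemma isCompact_height_le (b : ℝ) : IsCompact {p : HalfCylinder | height p ≤ b} := by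
  have h1 : IsCompact (halfPoint '' Icc 0 b) :=
    isCompact_Icc.image_of_continuousOn
      (contMDiffOn_halfPoint.continuousOn.mono Icc_subset_Ici_self)
  refine (h1.prod (isCompact_univ (X := S2))).of_isClosed_subset
    (isClosed_le contMDiff_height.continuous continuous_const) fun p hp => ⟨?_, trivial⟩
  exact ⟨height p, ⟨height_nonneg p, hp⟩, halfPoint_height p.1⟩

variable {ro R : ℝ} {hR : ro ≤ R} {φ : S2 ≃ₘ^∞⟮𝓡 2, 𝓡 2⟯ S2}

lemma height_cylinderEnd {r : ℝ} (hr : R < r) (x : S2) :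
    height (cylinderEnd ro R hR φ (r, x)) = r - ro := halfPoint_apply (by linarith)

lemma cylinderEnd_image {r : ℝ} (hr : R ≤ r) :
    (cylinderEnd ro R hR φ '' (Ioi r ×ˢ univ))ᶜ = {p : HalfCylinder | height p ≤ r - ro} := by
  ext p
  rw [mem_compl_iff, mem_image]
  constructor
  · intro h
    by_contra! hlt
    rw [mem_ofPred_eq, not_le] at hlt
    have hp : p ∈ (cylinderEnd ro R hR φ).target := by
      show R < height p + ro
      linarith
    refine h ⟨(height p + ro, φ p.2), ⟨?_, trivial⟩, (cylinderEnd ro R hR φ).right_inv' hp⟩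
    show r < height p + ro
    linarith
  · rintro h ⟨q, hq, rfl⟩
    have h1 : r < q.1 := hq.1
    have h2 : height (cylinderEnd ro R hR φ q) ≤ r - ro := h
    rw [height_cylinderEnd (x := q.2) (by linarith)] at h2
    linarith

/-- The standard metric as a form on `ℝ²`. -/
def stdForm (x : S2) (v w : E2) : ℝ := stdInner x v w

lemma planeForm_symm_pullback {g : SphereMetric} {ro : ℝ} (h : IsRoundVia g ro φ) (x : S2)
    (v w : E2) :
    planeForm g (φ.symm x) (mfderiv (𝓡 2) (𝓡 2) φ.symm x v : E2)
      (mfderiv (𝓡 2) (𝓡 2) φ.symm x w : E2) = ro ^ 2 * stdForm x v w := by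
  have hcomp : ∀ v : E2, (mfderiv (𝓡 2) (𝓡 2) φ (φ.symm x)
      (mfderiv (𝓡 2) (𝓡 2) φ.symm x v) : E2) = v := by
    intro v
    have h1 := mfderiv_comp x (φ.contMDiff.mdifferentiable (by simp) (φ.symm x))
      (φ.symm.contMDiff.mdifferentiable (by simp) x)
    have h2 : φ ∘ φ.symm = id := funext φ.apply_symm_apply
    have h3 : (mfderiv (𝓡 2) (𝓡 2) (φ ∘ φ.symm) x : E2 →L[ℝ] E2) v = v := by
      rw [h2, mfderiv_id]; rfl
    exact (congrArg (fun L : E2 →L[ℝ] E2 => L v) h1).symm.trans h3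
  refine (h _ _ _).trans ?_
  refine congrArg (ro ^ 2 * ·) ?_
  have h4 : φ (φ.symm x) = x := φ.apply_symm_apply x
  show stdForm (φ (φ.symm x)) (mfderiv (𝓡 2) (𝓡 2) φ (φ.symm x)
      (mfderiv (𝓡 2) (𝓡 2) φ.symm x v) : E2) (mfderiv (𝓡 2) (𝓡 2) φ (φ.symm x)
      (mfderiv (𝓡 2) (𝓡 2) φ.symm x w) : E2) = _
  rw [hcomp, hcomp, h4]

variable {path : ℝ → SphereMetric} {u c τ : ℝ → ℝ}

/-- Where `τ = 1` the metric is rotationally symmetric in the coordinates of the end. -/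
lemma CollarData.pullback_cylinderEnd (D : CollarData path u c τ)
    (hround : IsRoundVia (path 1) ro φ) {r : ℝ} (hr : R < r) (hτ : τ (r - ro) = 1) (x : S2)
    (a a' : ℝ) (v v' : E2) :
    pullback (𝓘(ℝ, ℝ).prod (𝓡 2)) D.metric (cylinderEnd ro R hR φ) (r, x)
      ((a, v) : ℝ × E2) ((a', v') : ℝ × E2) =
      u (r - ro) * (a * a') + c (r - ro) * (ro ^ 2 * stdForm x v v') := by
  set Ψ := cylinderEnd ro R hR φ
  have hsrc : (r, x) ∈ Ψ.source := ⟨hr, trivial⟩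
  have hd : MDifferentiableAt (𝓘(ℝ, ℝ).prod (𝓡 2)) I3 Ψ (r, x) :=
    Ψ.mdifferentiableAt (by simp) hsrc
  have hh : height (Ψ (r, x)) = r - ro := height_cylinderEnd hr x
  have h1 : ∀ (a : ℝ) (v : E2), (mfderiv (𝓘(ℝ, ℝ).prod (𝓡 2)) I3 Ψ (r, x)
      ((a, v) : ℝ × E2) : V3).1 0 = a := by
    intro a v
    refine (mfderiv_fst_zero hd ((a, v) : ℝ × E2)).trans ?_
    have he : (fun q => height (Ψ q)) =ᶠ[nhds (r, x)] fun q => q.1 - ro := by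
      filter_upwards [Ψ.open_source.mem_nhds hsrc] with q hq
      exact height_cylinderEnd hq.1 q.2
    rw [he.mfderiv_eq]
    have h2 : HasMFDerivAt (𝓘(ℝ, ℝ).prod (𝓡 2)) 𝓘(ℝ, ℝ) (fun q : ℝ × S2 => q.1 - ro) (r, x)
        (ContinuousLinearMap.fst ℝ ℝ E2) := by
      have h3 := hasMFDerivAt_fst (I := 𝓘(ℝ, ℝ)) (I' := 𝓡 2) (r, x)
      have h4 : HasMFDerivAt 𝓘(ℝ, ℝ) 𝓘(ℝ, ℝ) (fun r : ℝ => r - ro) r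
          (ContinuousLinearMap.id ℝ ℝ) :=
        ((hasFDerivAt_id r).sub_const ro).hasMFDerivAt
      exact h4.comp (r, x) h3
    exact congrArg (fun L : ℝ × E2 →L[ℝ] ℝ => L (a, v)) h2.mfderiv
  have h2 : ∀ (a : ℝ) (v : E2), (mfderiv (𝓘(ℝ, ℝ).prod (𝓡 2)) I3 Ψ (r, x)
      ((a, v) : ℝ × E2) : V3).2 = (mfderiv (𝓡 2) (𝓡 2) φ.symm x v : E2) := by
    intro a v
    refine (mfderiv_snd_eq hd ((a, v) : ℝ × E2)).trans ?_
    have h3 := hasMFDerivAt_snd (I := 𝓘(ℝ, ℝ)) (I' := 𝓡 2) (r, x)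
    have h4 := (φ.symm.contMDiff.mdifferentiable (by simp) x).hasMFDerivAt
    have h5 := h4.comp (r, x) h3
    exact congrArg (fun L : ℝ × E2 →L[ℝ] E2 => L (a, v)) h5.mfderiv
  refine (D.metric_apply (Ψ (r, x)) _ _).trans ?_
  rw [h1, h1, h2, h2, hh, hτ]
  refine congrArg (fun z => u (r - ro) * (a * a') + c (r - ro) * z) ?_
  exact planeForm_symm_pullback hround x v v'

end End

/-! ### Polar coordinates on the end -/

section Polar

/-- The direction `y / |y|` of a vector, with a junk value at `0`. -/
def direction (y : E3) : S2 :=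
  if h : y = 0 then pole else ⟨‖y‖⁻¹ • y, by simp [norm_smul, h]⟩

lemma coe_direction {y : E3} (h : y ≠ 0) : (direction y : E3) = ‖y‖⁻¹ • y := by
  rw [direction, dif_neg h]

/-- `ContMDiff.codRestrict_sphere` is global, so it is applied on the open submanifold `{y ≠ 0}`. -/
lemma contMDiffAt_direction {y : E3} (h : y ≠ 0) :
    ContMDiffAt 𝓘(ℝ, E3) (𝓡 2) ∞ direction y := by
  let U : TopologicalSpace.Opens E3 := ⟨{0}ᶜ, isOpen_compl_singleton⟩
  have := fact_finrank_E3
  have hU : ContMDiff 𝓘(ℝ, E3) 𝓘(ℝ, E3) ∞ (fun z : U => ‖(z : E3)‖⁻¹ • (z : E3)) := by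
    intro z
    refine contMDiffAt_subtype_iff (f := fun z : E3 => ‖z‖⁻¹ • z) |>.2 ?_
    have hz : (z : E3) ≠ 0 := z.2
    exact (((contDiffAt_norm ℝ hz).inv (norm_ne_zero_iff.2 hz)).smul contDiffAt_id).contMDiffAt
  have h2 := hU.codRestrict_sphere (n := 2) (fun z => by
    have hz : (z : E3) ≠ 0 := z.2
    simp [norm_smul, hz])
  have h3 : ContMDiff 𝓘(ℝ, E3) (𝓡 2) ∞ (fun z : U => direction z) := by
    refine h2.congr fun z => ?_
    have hz : (z : E3) ≠ 0 := z.2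
    exact Subtype.ext (coe_direction hz)
  exact contMDiffAt_subtype_iff (x := (⟨y, h⟩ : U)).1 (h3 ⟨y, h⟩)

/-- Polar coordinates on the complement of a ball. -/
def polar (R : ℝ) (hR : 0 < R) :
    PartialDiffeomorph 𝓘(ℝ, E3) (𝓘(ℝ, ℝ).prod (𝓡 2)) E3 (ℝ × S2) ∞ where
  toFun y := (‖y‖, direction y)
  invFun q := q.1 • (q.2 : E3)
  source := {y | R < ‖y‖}
  target := Ioi R ×ˢ univ
  map_source' y hy := ⟨hy, trivial⟩
  map_target' q hq := by
    have h : R < q.1 := hq.1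
    rw [mem_ofPred_eq, norm_smul, norm_eq_of_mem_sphere, mul_one, Real.norm_eq_abs,
      abs_of_pos (hR.trans h)]
    exact h
  left_inv' y hy := by
    have hn : ‖y‖ ≠ 0 := (hR.trans hy).ne'
    rw [coe_direction (norm_ne_zero_iff.1 hn), smul_smul, mul_inv_cancel₀ hn, one_smul]
  right_inv' q hq := by
    have h : 0 < q.1 := hR.trans hq.1
    have hn : ‖q.1 • (q.2 : E3)‖ = q.1 := by
      rw [norm_smul, norm_eq_of_mem_sphere, mul_one, Real.norm_eq_abs, abs_of_pos h]
    refine Prod.ext hn (Subtype.ext ?_)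
    rw [coe_direction (norm_ne_zero_iff.1 (by rw [hn]; exact h.ne')), hn, smul_smul,
      inv_mul_cancel₀ h.ne', one_smul]
  open_source := isOpen_lt continuous_const continuous_norm
  open_target := isOpen_Ioi.prod isOpen_univ
  contMDiffOn_toFun := by
    intro y hy
    have h0 : y ≠ 0 := norm_ne_zero_iff.1 (hR.trans hy).ne'
    exact ((contDiffAt_norm ℝ h0).contMDiffAt.prodMk (contMDiffAt_direction h0)).contMDiffWithinAt
  contMDiffOn_invFun :=
    (contMDiff_fst.smul (contMDiff_coe_S2.comp contMDiff_snd)).contMDiffOn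

/-- The differential of `y ↦ |y|`. -/
lemma hasFDerivAt_norm {y : E3} (h : y ≠ 0) :
    HasFDerivAt (fun y : E3 => ‖y‖) (‖y‖⁻¹ • innerSL ℝ y) y := by
  have hn : ‖y‖ ≠ 0 := norm_ne_zero_iff.2 h
  have h1 : HasFDerivAt (fun y : E3 => ‖y‖ ^ 2) (2 • innerSL ℝ y) y :=
    (hasStrictFDerivAt_norm_sq y).hasFDerivAt
  have h2 := h1.sqrt (pow_ne_zero 2 hn)
  have h3 : (fun y : E3 => √(‖y‖ ^ 2)) = fun y => ‖y‖ := funext fun y => Real.sqrt_sq (norm_nonneg y)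
  rw [h3, Real.sqrt_sq (norm_nonneg y)] at h2
  convert! h2 using 1
  ext v
  simp
  field_simp

lemma hasFDerivAt_direction {y : E3} (h : y ≠ 0) :
    HasFDerivAt (fun y : E3 => ‖y‖⁻¹ • y) (‖y‖⁻¹ • ContinuousLinearMap.id ℝ E3 +
      (-(‖y‖ ^ 3)⁻¹ • innerSL ℝ y).smulRight y) y := by
  have hn : ‖y‖ ≠ 0 := norm_ne_zero_iff.2 h
  have h1 := ((hasDerivAt_inv hn).comp_hasFDerivAt y (hasFDerivAt_norm h)).smul (hasFDerivAt_id y)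
  convert! h1 using 1
  ext v
  simp
  field_simp
  exact Or.inl trivial

/-- The pull-back of the standard metric of the sphere under `y ↦ y / |y|`. -/
lemma stdForm_direction {y : E3} (h : y ≠ 0) (v w : E3) :
    stdForm (direction y) (mfderiv 𝓘(ℝ, E3) (𝓡 2) direction y v : E2)
      (mfderiv 𝓘(ℝ, E3) (𝓡 2) direction y w : E2) =
      (inner ℝ v w - inner ℝ y v * inner ℝ y w / ‖y‖ ^ 2) / ‖y‖ ^ 2 := by
  have hn : ‖y‖ ≠ 0 := norm_ne_zero_iff.2 h
  have key : ∀ v : E3, (mfderiv (𝓡 2) 𝓘(ℝ, E3) (fun q : S2 => (q : E3)) (direction y)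
      (mfderiv 𝓘(ℝ, E3) (𝓡 2) direction y v) : E3) =
      ‖y‖⁻¹ • v - ((‖y‖ ^ 3)⁻¹ * inner ℝ y v) • y := by
    intro v
    have h1 := mfderiv_comp y (contMDiff_coe_S2.mdifferentiable (by simp) (direction y))
      ((contMDiffAt_direction h).mdifferentiableAt (by simp))
    refine (congrArg (fun L : E3 →L[ℝ] E3 => L v) h1).symm.trans ?_
    have he : ((fun q : S2 => (q : E3)) ∘ direction) =ᶠ[nhds y] fun y => ‖y‖⁻¹ • y := by
      filter_upwards [isOpen_ne.mem_nhds h] with z hz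
      exact coe_direction hz
    rw [he.mfderiv_eq, mfderiv_eq_fderiv, (hasFDerivAt_direction h).fderiv]
    simp
    rw [sub_eq_add_neg]
  refine (congrArg₂ (fun a b : E3 => (inner ℝ a b : ℝ)) (key v) (key w)).trans ?_
  have hyy : inner ℝ y y = ‖y‖ ^ 2 := real_inner_self_eq_norm_sq y
  rw [inner_sub_left, inner_sub_right, inner_sub_right]
  simp only [real_inner_smul_left, real_inner_smul_right, hyy, real_inner_comm y v]
  field_simp
  ring

variable {path : ℝ → SphereMetric} {u c τ : ℝ → ℝ} {ro R : ℝ} {φ : S2 ≃ₘ^∞⟮𝓡 2, 𝓡 2⟯ S2}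

/-- The asymptotically Euclidean coordinates on the end of the half-cylinder. -/
def flatEnd (ro R : ℝ) (hR0 : 0 < R) (hR : ro ≤ R) (φ : S2 ≃ₘ^∞⟮𝓡 2, 𝓡 2⟯ S2) :
    PartialDiffeomorph 𝓘(ℝ, E3) I3 E3 HalfCylinder ∞ :=
  (polar R hR0).trans (cylinderEnd ro R hR φ)

variable {hR0 : 0 < R} {hR : ro ≤ R}

lemma flatEnd_source : (flatEnd ro R hR0 hR φ).source = {y | R < ‖y‖} := by
  show {y : E3 | R < ‖y‖} ∩ _ = _
  refine inter_eq_left.2 fun y hy => ?_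
  exact ⟨hy, trivial⟩

lemma flatEnd_image {r : ℝ} (hr : R ≤ r) :
    flatEnd ro R hR0 hR φ '' {y | r < ‖y‖} = cylinderEnd ro R hR φ '' (Ioi r ×ˢ univ) := by
  have h : polar R hR0 '' {y | r < ‖y‖} = Ioi r ×ˢ univ := by
    ext q
    constructor
    · rintro ⟨y, hy, rfl⟩
      exact ⟨hy, trivial⟩
    · intro hq
      have h1 : r < q.1 := hq.1
      have h2 : q ∈ (polar R hR0).target := ⟨hr.trans_lt h1, trivial⟩
      refine ⟨q.1 • (q.2 : E3), ?_, (polar R hR0).right_inv' h2⟩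
      rw [mem_ofPred_eq, norm_smul, norm_eq_of_mem_sphere, mul_one, Real.norm_eq_abs,
        abs_of_pos (hR0.trans (hr.trans_lt h1))]
      exact h1
  rw [← h, image_image]
  rfl

/-- The metric coefficients in the coordinates `y`, where `|y|` is the area radius. -/
lemma CollarData.endCoeff_flatEnd (D : CollarData path u c τ)
    (hround : IsRoundVia (path 1) ro φ) {y : E3} (hy : R < ‖y‖) (hτ : τ (‖y‖ - ro) = 1)
    (hc : c (‖y‖ - ro) * ro ^ 2 = ‖y‖ ^ 2) (i j : Fin 3) :
    endCoeff D.metric (flatEnd ro R hR0 hR φ) i j y =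
      (if i = j then 1 else 0) + y i * y j * (‖y‖ ^ 2)⁻¹ * (u (‖y‖ - ro) - 1) := by
  have hn : ‖y‖ ≠ 0 := (hR0.trans hy).ne'
  have h0 : y ≠ 0 := norm_ne_zero_iff.1 hn
  have hd1 : MDifferentiableAt 𝓘(ℝ, E3) (𝓘(ℝ, ℝ).prod (𝓡 2)) (polar R hR0) y :=
    (polar R hR0).mdifferentiableAt (by simp) hy
  have hd2 : MDifferentiableAt (𝓘(ℝ, ℝ).prod (𝓡 2)) I3 (cylinderEnd ro R hR φ) (polar R hR0 y) :=
    (cylinderEnd ro R hR φ).mdifferentiableAt (by simp) ⟨hy, trivial⟩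
  have hcomp : ∀ v : E3, (mfderiv 𝓘(ℝ, E3) I3 (flatEnd ro R hR0 hR φ) y v : V3) =
      mfderiv (𝓘(ℝ, ℝ).prod (𝓡 2)) I3 (cylinderEnd ro R hR φ) (‖y‖, direction y)
        ((‖y‖⁻¹ * inner ℝ y v, (mfderiv 𝓘(ℝ, E3) (𝓡 2) direction y v : E2)) : ℝ × E2) := by
    intro v
    have h1 := congrArg (fun L : E3 →L[ℝ] V3 => L v) (mfderiv_comp y hd2 hd1)
    refine h1.trans ?_
    have h2 : (mfderiv 𝓘(ℝ, E3) (𝓘(ℝ, ℝ).prod (𝓡 2)) (polar R hR0) y v : ℝ × E2) =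
        (‖y‖⁻¹ * inner ℝ y v, (mfderiv 𝓘(ℝ, E3) (𝓡 2) direction y v : E2)) := by
      have h3 := ((hasFDerivAt_norm h0).hasMFDerivAt).prodMk
        ((contMDiffAt_direction h0).mdifferentiableAt (by simp)).hasMFDerivAt
      exact congrArg (fun L : E3 →L[ℝ] ℝ × E2 => L v) h3.mfderiv
    exact congrArg (fun z : ℝ × E2 => (mfderiv (𝓘(ℝ, ℝ).prod (𝓡 2)) I3 (cylinderEnd ro R hR φ)
      (‖y‖, direction y) : ℝ × E2 →L[ℝ] V3) z) h2
  have h5 := D.pullback_cylinderEnd (hR := hR) hround hy hτ (direction y)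
    (‖y‖⁻¹ * inner ℝ y (EuclideanSpace.single i (1 : ℝ)))
    (‖y‖⁻¹ * inner ℝ y (EuclideanSpace.single j (1 : ℝ)))
    (mfderiv 𝓘(ℝ, E3) (𝓡 2) direction y (EuclideanSpace.single i (1 : ℝ) : E3))
    (mfderiv 𝓘(ℝ, E3) (𝓡 2) direction y (EuclideanSpace.single j (1 : ℝ) : E3))
  have h6 : endCoeff D.metric (flatEnd ro R hR0 hR φ) i j y = _ :=
    congrArg₂ (fun v w : V3 => (D.metric.inner (cylinderEnd ro R hR φ (‖y‖, direction y)) :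
      V3 →L[ℝ] V3 →L[ℝ] ℝ) v w) (hcomp (EuclideanSpace.single i 1)) (hcomp (EuclideanSpace.single j 1))
  refine h6.trans (h5.trans ?_)
  rw [stdForm_direction h0, ← mul_assoc (c _), hc]
  have hi : ∀ k, inner ℝ y (EuclideanSpace.single k (1 : ℝ)) = y k := by
    intro k
    simp [EuclideanSpace.inner_single_right]
  have hij : inner ℝ (EuclideanSpace.single i (1 : ℝ) : E3) (EuclideanSpace.single j (1 : ℝ)) =
      if i = j then (1 : ℝ) else 0 := by
    simp [EuclideanSpace.inner_single_left]
  rw [hi, hi, hij]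
  field_simp
  ring

end Polar

/-! ### Decay of the metric coefficients -/

section Decay

/-- Smooth functions outside the ball of radius `R` which are `O_n(|y|^a)`: each derivative up to
order `n` improves the decay by one power. -/
def Decay (R : ℝ) : ℕ → ℤ → (E3 → ℝ) → Prop
  | 0, a, f => ContDiffOn ℝ ∞ f {y | R < ‖y‖} ∧ ∃ C, ∀ y, R < ‖y‖ → |f y| ≤ C * ‖y‖ ^ a
  | n + 1, a, f => (ContDiffOn ℝ ∞ f {y | R < ‖y‖} ∧ ∃ C, ∀ y, R < ‖y‖ → |f y| ≤ C * ‖y‖ ^ a) ∧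
      ∀ k, Decay R n (a - 1) (pd k f)

lemma isOpen_exterior (R : ℝ) : IsOpen {y : E3 | R < ‖y‖} :=
  isOpen_lt continuous_const continuous_norm

lemma pd_congr {R : ℝ} {f g : E3 → ℝ} (h : EqOn f g {y | R < ‖y‖}) (k : Fin 3) :
    EqOn (pd k f) (pd k g) {y | R < ‖y‖} := fun y hy => by
  rw [pd, pd, (h.eventuallyEq_of_mem ((isOpen_exterior R).mem_nhds hy)).fderiv_eq]

namespace Decay

variable {R : ℝ} {n : ℕ} {a b : ℤ} {f g : E3 → ℝ}

lemma zero (h : Decay R n a f) : Decay R 0 a f := by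
  cases n with
  | zero => exact h
  | succ n => exact h.1

lemma contDiffOn (h : Decay R n a f) : ContDiffOn ℝ ∞ f {y | R < ‖y‖} := h.zero.1

lemma differentiableAt (h : Decay R n a f) {y : E3} (hy : R < ‖y‖) : DifferentiableAt ℝ f y :=
  (h.contDiffOn.contDiffAt ((isOpen_exterior R).mem_nhds hy)).differentiableAt (by simp)

/-- The bound holds with every large constant, which allows to choose a common one. -/
lemma bound (h : Decay R n a f) :
    ∀ᶠ C in Filter.atTop, ∀ y, R < ‖y‖ → |f y| ≤ C * ‖y‖ ^ a := by
  obtain ⟨-, C, hC⟩ := h.zero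
  filter_upwards [Filter.eventually_ge_atTop C] with C' hC' y hy
  exact (hC y hy).trans (mul_le_mul_of_nonneg_right hC' (zpow_nonneg (norm_nonneg y) a))

lemma congr (h : Decay R n a f) (hfg : EqOn g f {y | R < ‖y‖}) : Decay R n a g := by
  induction n generalizing a f g with
  | zero =>
    obtain ⟨h1, C, hC⟩ := h
    exact ⟨h1.congr hfg, C, fun y hy => by rw [hfg hy]; exact hC y hy⟩
  | succ n ih =>
    obtain ⟨⟨h1, C, hC⟩, h2⟩ := h
    exact ⟨⟨h1.congr hfg, C, fun y hy => by rw [hfg hy]; exact hC y hy⟩,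
      fun k => ih (h2 k) (pd_congr hfg k)⟩

lemma of_succ (h : Decay R (n + 1) a f) : Decay R n a f := by
  induction n generalizing a f with
  | zero => exact h.1
  | succ n ih => exact ⟨h.1, fun k => ih (h.2 k)⟩

lemma zero_add (hf : Decay R 0 a f) (hg : Decay R 0 a g) : Decay R 0 a (fun y => f y + g y) := by
  obtain ⟨h1, C, hC⟩ := hf
  obtain ⟨h2, C', hC'⟩ := hg
  refine ⟨h1.add h2, C + C', fun y hy => (abs_add_le _ _).trans ?_⟩
  rw [add_mul]
  exact add_le_add (hC y hy) (hC' y hy)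

lemma add (hf : Decay R n a f) (hg : Decay R n a g) : Decay R n a (fun y => f y + g y) := by
  induction n generalizing a f g with
  | zero => exact hf.zero_add hg
  | succ n ih =>
    refine ⟨hf.zero.zero_add hg.zero, fun k => (ih (hf.2 k) (hg.2 k)).congr fun y hy => ?_⟩
    rw [pd, fderiv_fun_add (hf.differentiableAt hy) (hg.differentiableAt hy)]
    rfl

lemma zero_mul (hR : 0 < R) (hf : Decay R 0 a f) (hg : Decay R 0 b g) :
    Decay R 0 (a + b) (fun y => f y * g y) := by
  obtain ⟨h1, C, hC⟩ := hf
  obtain ⟨h2, C', hC'⟩ := hg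
  refine ⟨h1.mul h2, C * C', fun y hy => ?_⟩
  rw [abs_mul, zpow_add₀ (hR.trans hy).ne']
  refine (mul_le_mul (hC y hy) (hC' y hy) (abs_nonneg _)
    ((abs_nonneg _).trans (hC y hy))).trans_eq ?_
  ring

lemma mul (hR : 0 < R) (hf : Decay R n a f) (hg : Decay R n b g) :
    Decay R n (a + b) (fun y => f y * g y) := by
  induction n generalizing a b f g with
  | zero => exact hf.zero_mul hR hg
  | succ n ih =>
    refine ⟨hf.zero.zero_mul hR hg.zero, fun k => ?_⟩
    have h1 := ih hf.of_succ (hg.2 k)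
    have h2 := ih (hf.2 k) hg.of_succ
    rw [show a + (b - 1) = a + b - 1 by ring] at h1
    rw [show a - 1 + b = a + b - 1 by ring] at h2
    refine (h1.add h2).congr fun y hy => ?_
    rw [pd, fderiv_fun_mul (hf.differentiableAt hy) (hg.differentiableAt hy)]
    simp only [add_apply, smul_apply, smul_eq_mul, pd]
    ring

lemma zero_fun (a : ℤ) : Decay R n a (fun _ => 0) := by
  induction n generalizing a with
  | zero => exact ⟨contDiffOn_const, 0, fun y _ => by simp⟩
  | succ n ih =>
    refine ⟨⟨contDiffOn_const, 0, fun y _ => by simp⟩, fun k => (ih (a - 1)).congr fun y _ => ?_⟩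
    simp [pd]

lemma const (c : ℝ) : Decay R n 0 (fun _ => c) := by
  cases n with
  | zero => exact ⟨contDiffOn_const, |c|, fun y _ => by simp⟩
  | succ n =>
    refine ⟨⟨contDiffOn_const, |c|, fun y _ => by simp⟩, fun k => (zero_fun (-1)).congr fun y _ => ?_⟩
    simp [pd]

lemma neg (hR : 0 < R) (h : Decay R n a f) : Decay R n a (fun y => -f y) := by
  have := (const (n := n) (R := R) (-1)).mul hR h
  rw [_root_.zero_add] at this
  exact this.congr fun y _ => by ring

lemma coord (i : Fin 3) : Decay R n 1 (fun y => y i) := by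
  have h0 : ContDiffOn ℝ ∞ (fun y : E3 => y i) {y | R < ‖y‖} ∧
      ∃ C, ∀ y : E3, R < ‖y‖ → |y i| ≤ C * ‖y‖ ^ (1 : ℤ) :=
    ⟨(EuclideanSpace.proj i : E3 →L[ℝ] ℝ).contDiff.contDiffOn, 1, fun y _ => by
      simpa using PiLp.norm_apply_le y i⟩
  cases n with
  | zero => exact h0
  | succ n =>
    refine ⟨h0, fun k => (const (if i = k then 1 else 0)).congr fun y _ => ?_⟩
    have : fderiv ℝ (fun y : E3 => y i) y = (EuclideanSpace.proj i : E3 →L[ℝ] ℝ) :=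
      (EuclideanSpace.proj i : E3 →L[ℝ] ℝ).fderiv
    rw [pd, this]
    simp

lemma contDiffAt_inv_norm_sub {μ : ℝ} {y : E3} (h0 : y ≠ 0) (h : ‖y‖ - μ ≠ 0) :
    ContDiffAt ℝ ∞ (fun y : E3 => (‖y‖ - μ)⁻¹) y :=
  ((contDiffAt_norm ℝ h0).sub contDiffAt_const).inv h

lemma pd_inv_norm_sub {μ : ℝ} {y : E3} (h0 : y ≠ 0) (h : ‖y‖ - μ ≠ 0) (k : Fin 3) :
    pd k (fun y : E3 => (‖y‖ - μ)⁻¹) y = -(y k * ‖y‖⁻¹ * ((‖y‖ - μ)⁻¹ * (‖y‖ - μ)⁻¹)) := by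
  have h1 := (hasDerivAt_inv h).comp_hasFDerivAt y ((hasFDerivAt_norm h0).sub_const μ)
  rw [pd, show (fun y : E3 => (‖y‖ - μ)⁻¹) = (fun x : ℝ => x⁻¹) ∘ fun y => ‖y‖ - μ from rfl,
    h1.fderiv]
  simp [EuclideanSpace.inner_single_right]
  field_simp

lemma bound_inv_norm_sub {μ : ℝ} (hR : 0 < R) (hμ : μ < R) :
    ∃ C, ∀ y : E3, R < ‖y‖ → |(‖y‖ - μ)⁻¹| ≤ C * ‖y‖ ^ (-1 : ℤ) := by
  obtain ⟨δ, hδ, hδ1, hδ2⟩ : ∃ δ : ℝ, 0 < δ ∧ δ ≤ 1 ∧ μ ≤ (1 - δ) * R := by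
    refine ⟨min 1 (1 - μ / R), lt_min one_pos (sub_pos.2 ((div_lt_one hR).2 hμ)), min_le_left _ _, ?_⟩
    have h1 := min_le_right 1 (1 - μ / R)
    have h2 : μ = μ / R * R := by field_simp
    nlinarith
  refine ⟨δ⁻¹, fun y hy => ?_⟩
  have h1 : δ * ‖y‖ ≤ ‖y‖ - μ := by nlinarith
  have h2 : 0 < δ * ‖y‖ := mul_pos hδ (hR.trans hy)
  rw [abs_of_pos (inv_pos.2 (h2.trans_le h1)), zpow_neg_one, ← mul_inv]
  exact inv_anti₀ h2 h1

lemma inv_norm (hR : 0 < R) : Decay R n (-1) (fun y => ‖y‖⁻¹) := by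
  have h0 : ContDiffOn ℝ ∞ (fun y : E3 => ‖y‖⁻¹) {y | R < ‖y‖} ∧
      ∃ C, ∀ y : E3, R < ‖y‖ → |‖y‖⁻¹| ≤ C * ‖y‖ ^ (-1 : ℤ) :=
    ⟨fun y hy => ((contDiffAt_norm ℝ (norm_ne_zero_iff.1 (hR.trans hy).ne')).inv
      (hR.trans hy).ne').contDiffWithinAt, 1, fun y _ => by simp⟩
  induction n with
  | zero => exact h0
  | succ n ih =>
    refine ⟨h0, fun k => ?_⟩
    have h1 := ((((coord k).mul hR ih).mul hR (ih.mul hR ih))).neg hR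
    refine h1.congr fun y hy => ?_
    have := pd_inv_norm_sub (μ := 0) (norm_ne_zero_iff.1 (hR.trans hy).ne')
      (by rw [sub_zero]; exact (hR.trans hy).ne') k
    simpa using this

lemma inv_norm_sub {μ : ℝ} (hR : 0 < R) (hμ : μ < R) :
    Decay R n (-1) (fun y => (‖y‖ - μ)⁻¹) := by
  have h0 : ContDiffOn ℝ ∞ (fun y : E3 => (‖y‖ - μ)⁻¹) {y | R < ‖y‖} ∧
      ∃ C, ∀ y : E3, R < ‖y‖ → |(‖y‖ - μ)⁻¹| ≤ C * ‖y‖ ^ (-1 : ℤ) :=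
    ⟨fun y hy => (contDiffAt_inv_norm_sub (norm_ne_zero_iff.1 (hR.trans hy).ne')
      (sub_pos.2 (hμ.trans hy)).ne').contDiffWithinAt, bound_inv_norm_sub hR hμ⟩
  induction n with
  | zero => exact h0
  | succ n ih =>
    refine ⟨h0, fun k => ?_⟩
    have h1 := ((((coord k).mul hR (inv_norm hR)).mul hR (ih.mul hR ih))).neg hR
    exact h1.congr fun y hy => pd_inv_norm_sub (norm_ne_zero_iff.1 (hR.trans hy).ne')
      (sub_pos.2 (hμ.trans hy)).ne' k

end Decay

/-- The deviation of the Schwarzschild metric of mass `me` from the Euclidean metric is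
`O_n(|y|⁻¹)`. -/
lemma decay_schwarzschild {R me : ℝ} (hR : 0 < R) (hme : 2 * me < R) (n : ℕ) (i j : Fin 3) :
    Decay R n (-1) (fun y => y i * y j * (‖y‖ ^ 2)⁻¹ * (‖y‖ / (‖y‖ - 2 * me) - 1)) := by
  have h1 := (((Decay.const (n := n) (R := R) (2 * me)).mul hR ((Decay.coord i).mul hR
    (Decay.coord j))).mul hR ((Decay.inv_norm hR).mul hR (Decay.inv_norm hR))).mul hR
      (Decay.inv_norm_sub hR hme)
  refine h1.congr fun y hy => ?_
  have h2 : ‖y‖ - 2 * me ≠ 0 := (sub_pos.2 (hme.trans hy)).ne'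
  have h3 : ‖y‖ ≠ 0 := (hR.trans hy).ne'
  field_simp
  ring

end Decay

/-! ### The extension -/

section Extension

variable {path : ℝ → SphereMetric} {g : SphereMetric} {φ : S2 ≃ₘ^∞⟮𝓡 2, 𝓡 2⟯ S2}
  {ro Ho α β me R : ℝ} {w τ : ℝ → ℝ}

/-- The radial coefficient `r / w` of the extension, where `r = s + ro`. -/
def lapseSq (ro : ℝ) (w : ℝ → ℝ) (s : ℝ) : ℝ := (s + ro) / w (s + ro)

/-- The factor `r² / ro²` of the metrics of the slices, where `r = s + ro`. -/
def dilation (ro : ℝ) (s : ℝ) : ℝ := (s + ro) ^ 2 / ro ^ 2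

lemma hasDerivAt_comp_shift {f : ℝ → ℝ} (hf : ContDiff ℝ ∞ f) (s ro : ℝ) :
    HasDerivAt (fun s => f (s + ro)) (deriv f (s + ro)) s :=
  ((hf.differentiable (by simp) (s + ro)).hasDerivAt).comp_add_const s ro

lemma hasDerivAt_dilation (s : ℝ) : HasDerivAt (dilation ro) (2 * (s + ro) / ro ^ 2) s := by
  have := (((hasDerivAt_id s).add_const ro).pow 2).div_const (ro ^ 2)
  convert! this using 1
  simp

lemma deriv_dilation (hro : 0 < ro) {s : ℝ} (hs : 0 ≤ s) :
    deriv (dilation ro) s = 2 / (s + ro) * dilation ro s := by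
  have : s + ro ≠ 0 := by linarith
  rw [(hasDerivAt_dilation s).deriv, dilation]
  field_simp

namespace ExtensionProfile

variable (P : ExtensionProfile ro Ho α β me w τ R)
include P

lemma collarData (hro : 0 < ro) (hpath : IsSmoothPath path) :
    CollarData path (lapseSq ro w) (dilation ro) (fun s => τ (s + ro)) where
  smooth_path := hpath
  smooth_u s hs := by
    have h1 : ContDiff ℝ ∞ fun s : ℝ => s + ro := contDiff_id.add contDiff_const
    exact h1.contDiffAt.div (P.smooth_w.comp h1).contDiffAt (P.w_pos _ (by linarith)).ne'
  smooth_c s _ := by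
    have h1 : ContDiff ℝ ∞ fun s : ℝ => s + ro := contDiff_id.add contDiff_const
    exact ((h1.pow 2).div_const (ro ^ 2)).contDiffAt
  smooth_τ s _ := (P.smooth_τ.comp (contDiff_id.add contDiff_const)).contDiffAt
  u_pos s hs := div_pos (by linarith) (P.w_pos _ (by linarith))
  c_pos s hs := div_pos (pow_pos (by linarith) 2) (pow_pos hro 2)
  τ_mem s hs := P.τ_mem _ (by linarith)

lemma hasDerivAt_lapseSq {s : ℝ} (hs : 0 ≤ s) :
    HasDerivAt (lapseSq ro w)
      ((w (s + ro) - (s + ro) * deriv w (s + ro)) / w (s + ro) ^ 2) s := by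
  have h := ((hasDerivAt_id s).add_const ro).fun_div (hasDerivAt_comp_shift P.smooth_w s ro)
    (P.w_pos _ (by linarith)).ne'
  convert! h using 1
  simp

/-- In terms of the area radius `r`, the scalar curvature is
`2 ro² K / r² - 2 w' / r² - ¼ τ'² |g'|² w / r`. -/
lemma scalarCurvature_eq (hro : 0 < ro) (hpath : IsRoundingPath g ro path φ) (p : HalfCylinder) :
    scalarCurvature (P.collarData hro hpath.smooth).metric basis3 p =
      2 / (height p + ro) ^ 2 * (ro ^ 2 * gaussCurvature (path (τ (height p + ro))) p.2
        - deriv w (height p + ro)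
        - 1 / 8 * normSqDeriv path (τ (height p + ro)) p.2 * deriv τ (height p + ro) ^ 2
          * ((height p + ro) * w (height p + ro))) := by
  have hs := height_nonneg p
  have hθ : ∀ s, 0 ≤ s → HasDerivAt (fun s => 2 / (s + ro)) (-2 / (s + ro) ^ 2) s := by
    intro s hs
    have h := ((hasDerivAt_id s).add_const ro).inv (by simp; linarith)
    have h2 := h.const_mul 2
    convert! h2 using 1
    simp
    ring
  rw [(P.collarData hro hpath.smooth).scalarCurvature_eq hpath.trace
    (fun s hs => (hθ s hs).differentiableAt) (fun s hs => deriv_dilation hro hs) p,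
    (hθ _ hs).deriv, (P.hasDerivAt_lapseSq hs).deriv,
    (hasDerivAt_comp_shift P.smooth_τ _ _).deriv]
  have hr : height p + ro ≠ 0 := by linarith
  have hw : w (height p + ro) ≠ 0 := (P.w_pos _ (by linarith)).ne'
  simp only [lapseSq, dilation]
  generalize height p + ro = r at *
  field_simp
  ring

lemma scalarCurvature_nonneg (hro : 0 < ro) (hpath : IsRoundingPath g ro path φ)
    (hα : IsAlpha path α) (hβ : IsBeta path ro β) (p : HalfCylinder) :
    0 ≤ scalarCurvature (P.collarData hro hpath.smooth).metric basis3 p := by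
  have hs := height_nonneg p
  have hr : 0 < height p + ro := by linarith
  have hw := P.w_pos (height p + ro) (by linarith)
  rw [P.scalarCurvature_eq hro hpath]
  refine mul_nonneg (div_nonneg zero_le_two (sq_nonneg _)) ?_
  rcases P.curvature (height p + ro) (by linarith) with h | ⟨h1, h2, h3⟩
  · have ht := P.τ_mem (height p + ro) (by linarith)
    have hK : β ≤ ro ^ 2 * gaussCurvature (path (τ (height p + ro))) p.2 :=
      hβ.2 ⟨_, ht, p.2, rfl⟩
    have hN : 1 / 4 * normSqDeriv path (τ (height p + ro)) p.2 ≤ α := hα.2 ⟨_, ht, p.2, rfl⟩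
    have hq : 0 ≤ 1 / 2 * deriv τ (height p + ro) ^ 2 * ((height p + ro) * w (height p + ro)) := by
      positivity
    have := mul_le_mul_of_nonneg_right hN hq
    linarith
  · rw [h1, h2, gaussCurvature_of_round hro hpath.round]
    have : ro ^ 2 * (1 / ro ^ 2) = 1 := by field_simp
    rw [this]
    linarith

lemma scalarCurvature_end (hro : 0 < ro) (hpath : IsRoundingPath g ro path φ) {p : HalfCylinder}
    (hp : R < height p + ro) :
    scalarCurvature (P.collarData hro hpath.smooth).metric basis3 p = 0 := by
  have he : ∀ᶠ r in nhds (height p + ro), R < r := eventually_gt_nhds hp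
  have hw : deriv w (height p + ro) = 1 := by
    have h1 : w =ᶠ[nhds (height p + ro)] fun r => r - 2 * me := by
      filter_upwards [he] with r hr
      exact (P.schwarzschild r hr.le).1
    rw [h1.deriv_eq]
    simp
  have hτ : deriv τ (height p + ro) = 0 := by
    have h1 : τ =ᶠ[nhds (height p + ro)] fun _ => 1 := by
      filter_upwards [he] with r hr
      exact (P.schwarzschild r hr.le).2
    rw [h1.deriv_eq]
    simp
  rw [P.scalarCurvature_eq hro hpath, hw, hτ, (P.schwarzschild _ hp.le).2,
    gaussCurvature_of_round hro hpath.round]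
  have : ro ^ 2 * (1 / ro ^ 2) = 1 := by field_simp
  rw [this]
  ring

lemma two_mul_lt : 2 * me < R := by
  have h := P.w_pos R P.le_R
  rw [(P.schwarzschild R le_rfl).1] at h
  linarith

lemma lapseSq_end {r : ℝ} (hr : R ≤ r) : lapseSq ro w (r - ro) = r / (r - 2 * me) := by
  rw [lapseSq, sub_add_cancel, (P.schwarzschild r hr).1]

lemma meanCurvature_slice (hro : 0 < ro) (hpath : IsRoundingPath g ro path φ)
    (s : EuclideanHalfSpace 1) (x : S2) :
    meanCurvature (𝓡 2) (P.collarData hro hpath.smooth).metric basis3 basis2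
      (fun q : S2 => ((s, q) : HalfCylinder)) x (CollarData.normal (lapseSq ro w) s) =
      2 / (s.1 0 + ro) / √(lapseSq ro w (s.1 0)) := by
  have hs : 0 ≤ s.1 0 := s.2
  rw [(P.collarData hro hpath.smooth).meanCurvature_slice hpath.trace, deriv_dilation hro hs,
    mul_div_cancel_right₀ _ ((P.collarData hro hpath.smooth).c_pos _ hs).ne']

lemma isBoundaryIsometry (hro : 0 < ro) (hpath : IsRoundingPath g ro path φ) :
    IsBoundaryIsometry (P.collarData hro hpath.smooth).metric g
      (fun q : S2 => ((halfPoint 0, q) : HalfCylinder)) := by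
  refine ⟨contMDiff_slice _, fun x y h => (Prod.ext_iff.1 h).2, ?_, fun x v w' => ?_⟩
  · ext p
    rw [boundary_halfCylinder]
    constructor
    · rintro ⟨q, rfl⟩
      exact halfPoint_apply le_rfl
    · intro hp
      refine ⟨p.2, Prod.ext ?_ rfl⟩
      rw [← hp]
      exact halfPoint_height p.1
  · refine ((P.collarData hro hpath.smooth).pullback_slice _ x v w').trans ?_
    have h0 : (halfPoint 0).1 0 = 0 := halfPoint_apply le_rfl
    have hd : dilation ro 0 = 1 := by
      rw [dilation, zero_add, div_self (pow_ne_zero 2 hro.ne')]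
    rw [h0, hd, one_mul, zero_add, P.τ_ro, hpath.zero]
    rfl

/-- The value of `w` at `ro` is chosen so that the boundary has mean curvature `Ho`. -/
lemma meanCurvature_boundary (hro : 0 < ro) (hHo : 0 < Ho) (hpath : IsRoundingPath g ro path φ)
    (x : S2) :
    meanCurvature (𝓡 2) (P.collarData hro hpath.smooth).metric basis3 basis2
      (fun q : S2 => ((halfPoint 0, q) : HalfCylinder)) x
      (CollarData.normal (lapseSq ro w) (halfPoint 0)) = Ho := by
  rw [P.meanCurvature_slice hro hpath, halfPoint_apply le_rfl, lapseSq, zero_add, P.w_ro]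
  have : ro / (ro * (Ho * ro / 2) ^ 2) = ((Ho * ro / 2)⁻¹) ^ 2 := by
    field_simp
  rw [this, Real.sqrt_sq (by positivity)]
  field_simp

lemma isSchwarzschildEnd (hro : 0 < ro) (hpath : IsRoundingPath g ro path φ) :
    IsSchwarzschildEnd (P.collarData hro hpath.smooth).metric me R
      (cylinderEnd ro R P.le_R φ) := by
  refine ⟨hro.trans_le P.le_R, P.two_mul_lt, rfl, fun r hr => ?_, fun r x hr a a' v v' => ?_⟩
  · rw [cylinderEnd_image hr]
    exact isCompact_height_le _
  · have hr0 : 0 < r := (hro.trans_le P.le_R).trans hr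
    refine ((P.collarData hro hpath.smooth).pullback_cylinderEnd hpath.round hr ?_ x a a' v
      v').trans ?_
    · show τ (r - ro + ro) = 1
      rw [sub_add_cancel]
      exact (P.schwarzschild r hr.le).2
    · have h1 : r - 2 * me ≠ 0 := (sub_pos.2 (P.two_mul_lt.trans hr)).ne'
      rw [P.lapseSq_end hr.le, dilation, sub_add_cancel]
      have h2 : (1 - 2 * me / r)⁻¹ = r / (r - 2 * me) := by
        rw [one_sub_div hr0.ne', inv_div]
      have h3 : ∀ z : ℝ, r ^ 2 / ro ^ 2 * (ro ^ 2 * z) = r ^ 2 * z := by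
        intro z
        rw [← mul_assoc, div_mul_cancel₀ _ (pow_ne_zero 2 hro.ne')]
      rw [h2]
      exact congrArg (r / (r - 2 * me) * (a * a') + ·) (h3 _)

lemma endCoeff_eq (hro : 0 < ro) (hpath : IsRoundingPath g ro path φ) (i j : Fin 3) :
    EqOn (endCoeff (P.collarData hro hpath.smooth).metric
        (flatEnd ro R (hro.trans_le P.le_R) P.le_R φ) i j)
      (fun y => (if i = j then 1 else 0) +
        y i * y j * (‖y‖ ^ 2)⁻¹ * (‖y‖ / (‖y‖ - 2 * me) - 1)) {y | R < ‖y‖} := by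
  intro y hy
  have hy' : R < ‖y‖ := hy
  refine ((P.collarData hro hpath.smooth).endCoeff_flatEnd hpath.round hy' ?_ ?_ i j).trans ?_
  · show τ (‖y‖ - ro + ro) = 1
    rw [sub_add_cancel]
    exact (P.schwarzschild _ hy'.le).2
  · rw [dilation, sub_add_cancel, div_mul_cancel₀ _ (pow_ne_zero 2 hro.ne')]
  · rw [P.lapseSq_end hy'.le]

/-- The metric is asymptotically flat of order `1`; its scalar curvature vanishes near infinity, so any
rate serves there. -/
lemma isAsymptoticallyFlat (hro : 0 < ro) (hpath : IsRoundingPath g ro path φ) :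
    IsAsymptoticallyFlat (P.collarData hro hpath.smooth).metric := by
  have hR : 0 < R := hro.trans_le P.le_R
  set γ := (P.collarData hro hpath.smooth).metric
  set Ψ := flatEnd ro R (hro.trans_le P.le_R) P.le_R φ
  set e : Fin 3 → Fin 3 → E3 → ℝ :=
    fun i j y => y i * y j * (‖y‖ ^ 2)⁻¹ * (‖y‖ / (‖y‖ - 2 * me) - 1) with he
  have hdec : ∀ i j, Decay R 2 (-1) (e i j) := decay_schwarzschild hR P.two_mul_lt 2
  have hpd : ∀ i j k, EqOn (pd k (endCoeff γ Ψ i j)) (pd k (e i j)) {y | R < ‖y‖} := by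
    intro i j k y hy
    rw [pd_congr (P.endCoeff_eq hro hpath i j) k hy, pd, fderiv_const_add]
    rfl
  obtain ⟨C, h0, h1, h2, hC⟩ := ((Filter.eventually_all.2 fun i => Filter.eventually_all.2 fun j =>
      (hdec i j).bound).and ((Filter.eventually_all.2 fun i => Filter.eventually_all.2 fun j =>
      Filter.eventually_all.2 fun k => ((hdec i j).2 k).bound).and
      ((Filter.eventually_all.2 fun i => Filter.eventually_all.2 fun j =>
      Filter.eventually_all.2 fun k => Filter.eventually_all.2 fun l =>
        (((hdec i j).2 k).2 l).bound).and (Filter.eventually_ge_atTop 0)))).exists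
  refine ⟨R, Ψ, 1, 4, C, hR, by norm_num, by norm_num, flatEnd_source, fun r hr => ?_,
    fun y hy => ⟨fun i j => ?_, fun i j k => ?_, fun i j k l => ?_, ?_⟩⟩
  · rw [flatEnd_image hr, cylinderEnd_image hr]
    exact isCompact_height_le _
  · have h := h0 i j y hy
    rw [P.endCoeff_eq hro hpath i j hy, add_sub_cancel_left]
    rw [← Real.rpow_intCast] at h
    convert! h using 3
    norm_num
  · have h := h1 i j k y hy
    rw [hpd i j k hy]
    rw [← Real.rpow_intCast] at h
    convert! h using 3
    norm_num
  · have h := h2 i j k l y hy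
    rw [pd_congr (hpd i j k) l hy]
    rw [← Real.rpow_intCast] at h
    convert! h using 3
    norm_num
  · have hh : R < height (Ψ y) + ro := by
      have : height (Ψ y) = ‖y‖ - ro := height_cylinderEnd (hR := P.le_R) hy (direction y)
      rw [this]
      linarith
    rw [P.scalarCurvature_end hro hpath hh, abs_zero]
    exact mul_nonneg hC (Real.rpow_nonneg (norm_nonneg y) _)

lemma isMeanConvexFoliation (hro : 0 < ro) (hpath : IsRoundingPath g ro path φ) :
    IsMeanConvexFoliation (P.collarData hro hpath.smooth).metric
      (Diffeomorph.refl I3 HalfCylinder ∞) := by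
  intro s x
  have hs : 0 ≤ s.1 0 := s.2
  have hu : 0 < lapseSq ro w (s.1 0) := (P.collarData hro hpath.smooth).u_pos _ hs
  refine ⟨CollarData.normal (lapseSq ro w) s,
    (P.collarData hro hpath.smooth).isUnitNormal_slice s x, ?_, ?_⟩
  · have h1 : (mfderiv I3 I3 (Diffeomorph.refl I3 HalfCylinder ∞) (s, x) : V3 →L[ℝ] V3)
        ((EuclideanSpace.single 0 1, 0) : V3) = ((EuclideanSpace.single 0 1, 0) : V3) :=
      congrArg (fun L : V3 →L[ℝ] V3 => L (EuclideanSpace.single 0 1, 0))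
        (mfderiv_id (I := I3) (x := ((s, x) : HalfCylinder)))
    have h2 := (P.collarData hro hpath.smooth).inner_normal s x
      ((EuclideanSpace.single 0 1, 0) : V3)
    refine lt_of_lt_of_eq ?_ (h2.symm.trans (congrArg (fun v : V3 =>
      (P.collarData hro hpath.smooth).metric.inner ((s, x) : HalfCylinder)
        (CollarData.normal (lapseSq ro w) s) v) h1.symm))
    simpa using hu
  · refine lt_of_lt_of_eq ?_ (P.meanCurvature_slice hro hpath s x).symm
    have : 0 < s.1 0 + ro := by linarith
    have := Real.sqrt_pos.2 hu
    positivity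

/-- Far out the slices are the rotationally symmetric spheres of the Schwarzschild end. -/
lemma slice_eq {s : EuclideanHalfSpace 1} (hs : R - ro + 1 ≤ s.1 0) :
    ∃ r : ℝ, R < r ∧ Diffeomorph.refl I3 HalfCylinder ∞ '' ({s} ×ˢ univ) =
      cylinderEnd ro R P.le_R φ '' ({r} ×ˢ univ) := by
  refine ⟨s.1 0 + ro, by linarith, ?_⟩
  have h : ∀ x, cylinderEnd ro R P.le_R φ (s.1 0 + ro, x) = (s, φ.symm x) := by
    intro x
    refine Prod.ext ?_ rfl
    show halfPoint (s.1 0 + ro - ro) = s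
    rw [add_sub_cancel_right, halfPoint_height]
  ext p
  constructor
  · rintro ⟨⟨s', x⟩, ⟨rfl, -⟩, rfl⟩
    refine ⟨(_, φ x), ⟨rfl, trivial⟩, (h _).trans ?_⟩
    rw [φ.symm_apply_apply]
    rfl
  · rintro ⟨⟨r, x⟩, ⟨rfl, -⟩, rfl⟩
    exact ⟨(s, φ.symm x), ⟨rfl, trivial⟩, (h x).symm⟩

end ExtensionProfile

lemma hawkingMass_const (hro : 0 < ro) (harea : area g = 4 * Real.pi * ro ^ 2) :
    hawkingMass g (fun _ => Ho) = ro / 2 * (1 - (Ho * ro / 2) ^ 2) := by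
  have h1 : area g / (16 * Real.pi) = (ro / 2) ^ 2 := by
    rw [harea]
    field_simp
    norm_num
  rw [hawkingMass, surfaceIntegral_const g (Ho ^ 2), h1, Real.sqrt_sq (by positivity), harea]
  field_simp
  ring

end Extension
end CMCExtension

end

open CMCExtension
theorem theorem2 (g : SphereMetric) (hK : ∀ x, 0 < gaussCurvature g x)
    (Ho : ℝ) (hHo : 0 < Ho)
    (ro : ℝ) (hro : 0 < ro) (harea : area g = 4 * Real.pi * ro ^ 2)
    (path : ℝ → SphereMetric) (hpath : IsAdmissiblePath g path)
    (α β : ℝ) (hα : IsAlpha path α) (hβ : IsBeta path ro β)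
    (hW : 1 / 4 * Ho ^ 2 * ro ^ 2 < β / (1 + α))
    (m : ℝ) (hm : m < ro / 2)
    (hWm : 1 / 4 * Ho ^ 2 * ro ^ 2 < β / (1 + α) * (1 - 2 * m / ro))
    (me : ℝ) (hme : mStar Ho ro α β m (hawkingMass g fun _ => Ho) < me) :
    ∃ (M : Type) (_ : TopologicalSpace M) (_ : T2Space M) (_ : SecondCountableTopology M)
      (_ : ChartedSpace Half3 M) (_ : IsManifold I3 ∞ M) (γ : RiemMetric I3 M),
      IsAsymptoticallyFlat γ ∧
      (∀ p : M, 0 ≤ scalarCurvature γ basis3 p) ∧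
      (∃ F : S2 → M, IsBoundaryIsometry γ g F ∧
        ∀ x : S2, ∃ ν : TangentSpace I3 (F x), IsUnitNormal (𝓡 2) γ F x ν ∧ PointsInward ν ∧
          meanCurvature (𝓡 2) γ basis3 basis2 F x ν = Ho) ∧
      ∃ (R : ℝ) (Ψ : PartialDiffeomorph (𝓘(ℝ, ℝ).prod (𝓡 2)) I3 (ℝ × S2) M ∞)
        (Φ : (EuclideanHalfSpace 1 × S2) ≃ₘ^∞⟮I3, I3⟯ M),
        IsSchwarzschildEnd γ me R Ψ ∧
        IsMeanConvexFoliation γ Φ ∧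
        ∃ s₀ : ℝ, ∀ s : EuclideanHalfSpace 1, s₀ ≤ s.1 0 → ∃ r : ℝ, R < r ∧
          Φ '' ({s} ×ˢ univ) = Ψ '' ({r} ×ˢ univ) := by
  have : T2Space (EuclideanHalfSpace 1) :=
    inferInstanceAs (T2Space {x : EuclideanSpace ℝ (Fin 1) // 0 ≤ x 0})
  have : SecondCountableTopology (EuclideanHalfSpace 1) :=
    inferInstanceAs (SecondCountableTopology {x : EuclideanSpace ℝ (Fin 1) // 0 ≤ x 0})
  obtain ⟨φ, hφ⟩ := hpath.exists_isRoundingPath hro harea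
  rw [hawkingMass_const hro harea] at hme
  obtain ⟨w, τ, R, P⟩ := exists_profile hro hHo (hφ.alpha_nonneg hα) (hφ.beta_le_one hro hβ) hW hm
    hWm hme
  refine ⟨HalfCylinder, inferInstance, inferInstance, inferInstance, inferInstance, inferInstance,
    (P.collarData hro hφ.smooth).metric, P.isAsymptoticallyFlat hro hφ,
    P.scalarCurvature_nonneg hro hφ hα hβ, ?_, R, cylinderEnd ro R P.le_R φ,
    Diffeomorph.refl I3 HalfCylinder ∞, P.isSchwarzschildEnd hro hφ,
    P.isMeanConvexFoliation hro hφ, R - ro + 1, fun s hs => P.slice_eq hs⟩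
  refine ⟨fun q => (halfPoint 0, q), P.isBoundaryIsometry hro hφ, fun x =>
    ⟨CollarData.normal (lapseSq ro w) (halfPoint 0),
      (P.collarData hro hφ.smooth).isUnitNormal_slice (halfPoint 0) x, ?_,
      P.meanCurvature_boundary hro hHo hφ x⟩⟩
  have h := (P.collarData hro hφ.smooth).u_pos _ (halfPoint 0).2
  show 0 < (CollarData.normal (lapseSq ro w) (halfPoint 0)).1 0
  simpa [CollarData.normal] using h
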